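/- **Notation.** Let $\hat f(\xi)=\int_{\mathbb R^2}e^{-ix\cdot\xi}f(x)\,dx$, $\widehat{m(D)f}=m\hat f$, $\langle\xi\rangle=(1+|\xi|^2)^{1/2}$, $\|f\|_{H^s}=\|\langle\nabla\rangle^sf\|_{L^2(\mathbb R^2)}$. Fix an even smooth $\varphi:\mathbb R\to[0,1]$ supported in $[-\frac32,\frac32]$ and equal to $1$ on $[-\frac54,\frac54]$, and put $\varphi_{\le k}(x)=\varphi(2^{-k}x)$, $\varphi_k=\varphi_{\le k}-\varphi_{\le k-1}$, $\varphi_{\ge k}=1-\varphi_{\le k-1}$, $P_k=\varphi_k(|D|)$, $P_{\le k}=\varphi_{\le k}(|D|)$ for $k\in\mathbb Z$, and $T_fg=\sum_{j\in\mathbb Z}P_{\le j-7}f\cdot P_jg$. A bilinear operator $Q$ has symbol $q(\xi,\eta)$ if $\widehat{Q(f,g)}(\xi)=\frac1{4\pi^2}\int_{\mathbb R^2}q(\xi,\eta)\hat f(\xi-\eta)\hat g(\eta)\,d\eta$. For $0<\epsilon\le1$ let $$B^\epsilon(f,g)=\tfrac12T_f\bigl((1+\epsilon\Delta)^{-1}\varphi_{\ge6}(\sqrt\epsilon|D|)g\bigr),\qquad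 \Lambda_\epsilon=|D|(1+\epsilon\Delta),\qquad \chi(\xi,\eta)=\sum_{j\in\mathbb Z}\varphi_{\le j-7}(|\xi-\eta|)\varphi_j(|\eta|),$$ and, for $\mu,\nu\in\{+,-\}$ (identified with $\pm1$), let $S^\epsilon_{\mu,+}$ and $Q^\epsilon_{\mu,\nu}$ be the bilinear operators with the symbols $$s^\epsilon_{\mu,+}(\xi,\eta)=i\epsilon\Bigl(\frac\mu2\,\frac{\xi\cdot(\xi-\eta)}{|\xi-\eta|}+\frac14|\xi|\Bigr)\chi(\xi,\eta),\qquad q^\epsilon_{\mu,\nu}(\xi,\eta)=\frac{i\epsilon}8\,\xi\cdot\Bigl(\nu\frac\eta{|\eta|}-\frac\xi{|\xi|}\Bigr)\varphi_{\le5}(\sqrt\epsilon|\eta|)\,\chi(\xi,\eta).$$ **Proposition.** Let $N_0\ge5$. There is a constant $K>0$, depending only on $N_0$ and $\varphi$, such that the following holds for all $0<\epsilon\le1$. (1) For all $\mu\in\{+,-\}$ and $\xi,\eta\in\mathbb R^2$, $\overline{s^\epsilon_{\mu,+}(\xi,\eta)}=-s^\epsilon_{\mu,+}(\xi,\eta)$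 and $$\Bigl|\langle\xi\rangle^{-N_0}\langle\eta\rangle^{-N_0}\bigl(\langle\xi\rangle^{2N_0}s^\epsilon_{\mu,+}(\xi,\eta)-\langle\eta\rangle^{2N_0}s^\epsilon_{-\mu,+}(\eta,\xi)\bigr)\Bigr|\le K\epsilon|\xi-\eta|\,\varphi_{\le-6}\Bigl(\frac{|\xi-\eta|}{\max\{|\xi|,|\eta|\}}\Bigr).$$ (2) For all $\mu\in\{+,-\}$ and $\xi,\eta\in\mathbb R^2$, $$|q^\epsilon_{\mu,-}(\xi,\eta)|\le K\epsilon|\xi|\,\varphi_{\le5}(\sqrt\epsilon|\eta|)\,\varphi_{\le-6}\Bigl(\frac{|\xi-\eta|}{|\eta|}\Bigr),\qquad |q^\epsilon_{\mu,+}(\xi,\eta)|\le K\epsilon|\xi-\eta|\,\varphi_{\le5}(\sqrt\epsilon|\eta|)\,\varphi_{\le-6}\Bigl(\frac{|\xi-\eta|}{|\eta|}\Bigr).$$ (Quotients with denominator $0$ are read as $0$ in (1) and (2).) (3) Let $(\zeta,v)$ be real-valued, with $\zeta(t),v(t)\in H^{N_0}(\mathbb R^2)$ and $\partial_1v^2=\partial_2v^1$,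 and solve on a time interval $[0,T]$, $T>0$, the system $$\partial_t\zeta+(1+\epsilon\Delta)\nabla\cdot v+\epsilon\nabla\cdot(\zeta v)=0,\qquad \partial_tv+(1+\epsilon\Delta)\nabla\zeta+\tfrac\epsilon2\nabla(|v|^2)=0,$$ the time derivatives existing in $L^2$. Put $u=v+\epsilon B^\epsilon(\zeta,v)$, $V=\zeta+i|D|^{-1}\mathrm{div}\,u$, $V^+=V$, $V^-=\overline V$. Then $u,V\in H^{N_0}$ at each time and $$\partial_tV-i\Lambda_\epsilon V=\sum_{\mu\in\{+,-\}}S^\epsilon_{\mu,+}(V^\mu,V^+)+\sum_{\mu,\nu\in\{+,-\}}Q^\epsilon_{\mu,\nu}(V^\mu,V^\nu)+\mathcal C+\mathcal N,\qquad \mathcal C=\epsilon^2\nabla\cdot\bigl(T_{\Delta^{-1}\nabla\mathrm{div}B^\epsilon(\zeta,v)}V\bigr),$$ where at each time $$\bigl|\mathrm{Re}\bigl(\langle\nabla\rangle^{N_0}\mathcal C\,\big|\,\langle\nabla\rangle^{N_0}V\bigr)_{L^2}\bigr|\le K\epsilon^2\|\zeta\|_{H^{N_0}}\|v\|_{H^{N_0}}\|V\|_{H^{N_0}}^2,$$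 $$\mathcal N\in H^{N_0},\qquad \|\mathcal N\|_{H^{N_0}}\le K\epsilon\bigl(1+\|\zeta\|_{H^{N_0}}\bigr)\bigl(\|\zeta\|_{H^{N_0}}^2+\|v\|_{H^{N_0}}^2+\|u\|_{H^{N_0}}^2\bigr).$$ Since $\mathcal C$ need not lie in $H^{N_0}$, the real part of the scalar product is understood as $\lim_{n\to\infty}\mathrm{Re}\bigl(\langle\nabla\rangle^{N_0}P_{\le n}\mathcal C\,|\,\langle\nabla\rangle^{N_0}V\bigr)_{L^2}$, and the existence of this limit is part of the claim. -/

import Mathlib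

noncomputable section

open MeasureTheory Filter Topology FourierTransform
open scoped ContDiff

namespace Bsq

/-- The plane `ℝ²` with its Euclidean norm. -/
abbrev Plane := EuclideanSpace ℝ (Fin 2)

/-- Complex-valued square integrable functions on the plane, modulo a.e. equality. -/
abbrev L2 := Lp (α := Plane) ℂ 2 volume

/-! ### Fourier transform, multipliers, Sobolev spaces -/

/-- The Fourier transform `f̂(ξ) = ∫ e^{-i x·ξ} f(x) dx`, extended to `L²`. The transform `𝓕` of
Mathlib has the kernel `e^{-2π i x·ξ}`, hence the rescaling. -/
def hat (f : L2) (ξ : Plane) : ℂ := (𝓕 f : L2) ((2 * Real.pi)⁻¹ • ξ)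

open Classical in
/-- The Fourier multiplier `m(D)` on `L²`: the Fourier transform of `m(D) f` is `m(ξ) f̂(ξ)`. It has
its natural domain, i.e. the `f ∈ L²` with `m f̂ ∈ L²`, and is set to `0` outside of it. -/
def mult (m : Plane → ℂ) (f : L2) : L2 :=
  if h : MemLp (fun w : Plane => m ((2 * Real.pi) • w) * (𝓕 f : L2) w) 2 volume then
    𝓕⁻ (h.toLp _)
  else 0

/-- The Japanese bracket `⟨ξ⟩ = (1 + |ξ|²)^{1/2}`. -/
def jap (ξ : Plane) : ℝ := Real.sqrt (1 + ‖ξ‖ ^ 2)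

/-- `f ∈ H^s(ℝ²)`, for a function `f` in `L²` (thus for `s ≥ 0`). -/
def MemH (s : ℝ) (f : L2) : Prop :=
  MemLp (fun ξ : Plane => ((jap ξ ^ s : ℝ) : ℂ) * hat f ξ) 2 volume

/-- The norm of `H^s(ℝ²)`, i.e. the `L²` norm of `⟨∇⟩^s f`; by Plancherel this is `(2π)⁻¹` times the
`L²` norm of `⟨ξ⟩^s f̂(ξ)`. -/
def hNorm (s : ℝ) (f : L2) : ℝ :=
  (2 * Real.pi)⁻¹ *
    (eLpNorm (fun ξ : Plane => ((jap ξ ^ s : ℝ) : ℂ) * hat f ξ) 2 volume).toReal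

/-- The `H^s` norm of a vector field. -/
def hNormVec (s : ℝ) (F : Fin 2 → L2) : ℝ := Real.sqrt (∑ k, hNorm s (F k) ^ 2)

/-- The operator `⟨∇⟩^s`. -/
def japD (s : ℝ) (f : L2) : L2 := mult (fun ξ => ((jap ξ ^ s : ℝ) : ℂ)) f

/-- The symbol `i ξ_k` of `∂_k`. -/
def dSym (k : Fin 2) (ξ : Plane) : ℂ := Complex.I * ((ξ k : ℝ) : ℂ)

/-- The derivative `∂_k`. -/
def deriv (k : Fin 2) (f : L2) : L2 := mult (dSym k) f

/-- The divergence `∇ · F`. -/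
def divg (F : Fin 2 → L2) : L2 := ∑ k, deriv k (F k)

/-- The symbol `1 - ε|ξ|²` of `1 + εΔ`. -/
def lapSym (ε : ℝ) (ξ : Plane) : ℂ := ((1 - ε * ‖ξ‖ ^ 2 : ℝ) : ℂ)

/-- The operator `Λ_ε = |D|(1 + εΔ)`. -/
def Lam (ε : ℝ) (f : L2) : L2 := mult (fun ξ => (‖ξ‖ : ℂ) * lapSym ε ξ) f

/-- The operator `|D|⁻¹ div`. -/
def rieszDiv (F : Fin 2 → L2) : L2 := ∑ k, mult (fun ξ => dSym k ξ / (‖ξ‖ : ℂ)) (F k)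

/-- The operator `Δ⁻¹ ∇ div`, whose symbol is the matrix `ξ_k ξ_l / |ξ|²`. -/
def gradPart (F : Fin 2 → L2) (k : Fin 2) : L2 :=
  ∑ l, mult (fun ξ => ((ξ k * ξ l / ‖ξ‖ ^ 2 : ℝ) : ℂ)) (F l)

open Classical in
/-- The pointwise product of two functions whose product is square integrable (otherwise `0`). -/
def prod (f g : L2) : L2 :=
  if h : MemLp (fun x : Plane => f x * g x) 2 volume then h.toLp _ else 0

/-- `f` is real-valued. -/
def IsRealValued (f : L2) : Prop := ∀ᵐ x : Plane, (f x).im = 0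

/-! ### Littlewood-Paley decomposition and paraproducts -/

/-- The smooth cut-off functions `φ` from which the Littlewood-Paley decomposition is built. -/
structure IsCutoff (φ : ℝ → ℝ) : Prop where
  smooth : ContDiff ℝ ∞ φ
  even : ∀ x, φ (-x) = φ x
  range : ∀ x, φ x ∈ Set.Icc (0 : ℝ) 1
  supp : Function.support φ ⊆ Set.Icc (-(3 / 2)) (3 / 2)
  one : ∀ x ∈ Set.Icc (-(5 / 4) : ℝ) (5 / 4), φ x = 1

/-- `φ_{≤k}(x) = φ(x / 2^k)`. -/
def phiLE (φ : ℝ → ℝ) (k : ℤ) (x : ℝ) : ℝ := φ (x / 2 ^ k)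

/-- `φ_k(x) = φ(x / 2^k) - φ(x / 2^{k-1})`. -/
def phi (φ : ℝ → ℝ) (k : ℤ) (x : ℝ) : ℝ := φ (x / 2 ^ k) - φ (x / 2 ^ (k - 1))

/-- `φ_{≥k}(x) = 1 - φ_{≤k-1}(x)`. -/
def phiGE (φ : ℝ → ℝ) (k : ℤ) (x : ℝ) : ℝ := 1 - phiLE φ (k - 1) x

/-- The Littlewood-Paley projection `P_k`. -/
def P (φ : ℝ → ℝ) (k : ℤ) (f : L2) : L2 := mult (fun ξ => (phi φ k ‖ξ‖ : ℂ)) f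

/-- The Littlewood-Paley projection `P_{≤k}`. -/
def PLE (φ : ℝ → ℝ) (k : ℤ) (f : L2) : L2 := mult (fun ξ => (phiLE φ k ‖ξ‖ : ℂ)) f

/-- The `j`-th term `P_{≤j-7} f · P_j g` of the paraproduct. -/
def paraTerm (φ : ℝ → ℝ) (f g : L2) (j : ℤ) : L2 := prod (PLE φ (j - 7) f) (P φ j g)

/-- The paraproduct `T_f g = ∑_j P_{≤j-7} f · P_j g`, a series in `L²`. -/
def para (φ : ℝ → ℝ) (f g : L2) : L2 := ∑' j : ℤ, paraTerm φ f g j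

/-! ### The system, the good unknown, and the complex unknown -/

/-- `(ζ, v)` is a real-valued, curl-free `H^N` solution on `[0, T]` of the system
`∂_t ζ + (1 + εΔ)∇·v + ε∇·(ζ v) = 0`, `∂_t v + (1 + εΔ)∇ζ + (ε/2)∇(|v|²) = 0`.
The time derivatives are taken in `L²`. This holds for the solutions in `C([0,T]; H^N)` in the sense
of distributions when `N ≥ 3`, for which `∂_t ζ, ∂_t v ∈ C([0,T]; H^{N-3})`. -/
structure IsSolution (ε N T : ℝ) (ζ : ℝ → L2) (v : ℝ → Fin 2 → L2) : Prop where
  mem_zeta : ∀ t ∈ Set.Icc 0 T, MemH N (ζ t)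
  mem_v : ∀ t ∈ Set.Icc 0 T, ∀ k, MemH N (v t k)
  real_zeta : ∀ t ∈ Set.Icc 0 T, IsRealValued (ζ t)
  real_v : ∀ t ∈ Set.Icc 0 T, ∀ k, IsRealValued (v t k)
  curl_free : ∀ t ∈ Set.Icc 0 T, deriv 0 (v t 1) = deriv 1 (v t 0)
  eq_zeta : ∀ t ∈ Set.Icc 0 T,
    HasDerivWithinAt ζ
      (-(∑ k, mult (fun ξ => lapSym ε ξ * dSym k ξ) (v t k))
        - (ε : ℂ) • divg (fun k => prod (ζ t) (v t k)))
      (Set.Icc 0 T) t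
  eq_v : ∀ t ∈ Set.Icc 0 T, ∀ k,
    HasDerivWithinAt (fun τ => v τ k)
      (-(mult (fun ξ => lapSym ε ξ * dSym k ξ) (ζ t))
        - ((ε / 2 : ℝ) : ℂ) • deriv k (∑ l, prod (v t l) (v t l)))
      (Set.Icc 0 T) t

/-- The vector field `(1 + εΔ)⁻¹ φ_{≥6}(√ε|D|) g`. The cut-off vanishes where `1 - ε|ξ|² = 0`. -/
def highInv (φ : ℝ → ℝ) (ε : ℝ) (g : Fin 2 → L2) (k : Fin 2) : L2 :=
  mult (fun ξ => (phiGE φ 6 (Real.sqrt ε * ‖ξ‖) : ℂ) / lapSym ε ξ) (g k)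

/-- The bilinear operator `B^ε(f, g) = ½ T_f ((1 + εΔ)⁻¹ φ_{≥6}(√ε|D|) g)`. -/
def Bop (φ : ℝ → ℝ) (ε : ℝ) (f : L2) (g : Fin 2 → L2) (k : Fin 2) : L2 :=
  (1 / 2 : ℂ) • para φ f (highInv φ ε g k)

/-- The good unknown `u = v + ε B^ε(ζ, v)`. -/
def goodU (φ : ℝ → ℝ) (ε : ℝ) (ζ : L2) (v : Fin 2 → L2) (k : Fin 2) : L2 :=
  v k + (ε : ℂ) • Bop φ ε ζ v k

/-- The complex unknown `V = ζ + i |D|⁻¹ div u`. -/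
def goodV (φ : ℝ → ℝ) (ε : ℝ) (ζ : L2) (v : Fin 2 → L2) : L2 :=
  ζ + Complex.I • rieszDiv (goodU φ ε ζ v)

/-- `V⁺ = V` and `V⁻` is the complex conjugate of `V`. The two signs are the units of `ℤ`. -/
def pm (μ : ℤˣ) (V : L2) : L2 := if μ = 1 then V else star V

/-- The vector field `Δ⁻¹ ∇ div B^ε(ζ, v)`. -/
def gradB (φ : ℝ → ℝ) (ε : ℝ) (ζ : L2) (v : Fin 2 → L2) : Fin 2 → L2 :=
  gradPart (Bop φ ε ζ v)

/-- The cubic term `ε² ∇ · (T_{Δ⁻¹ ∇ div B^ε} V)`. -/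
def cubic (φ : ℝ → ℝ) (ε : ℝ) (ζ : L2) (v : Fin 2 → L2) : L2 :=
  ((ε ^ 2 : ℝ) : ℂ) • divg (fun k => para φ (gradB φ ε ζ v k) (goodV φ ε ζ v))

/-! ### Bilinear operators and their symbols -/

/-- `h = Q(f, g)` for the bilinear operator `Q` with symbol `q`: the Fourier transform of `h` is
`(4π²)⁻¹ ∫ q(ξ, η) f̂(ξ - η) ĝ(η) dη`, the integral being absolutely convergent for a.e. `ξ`. -/
def IsBilinear (q : Plane → Plane → ℂ) (f g h : L2) : Prop :=
  (∀ᵐ ξ : Plane, Integrable (fun η : Plane => q ξ η * hat f (ξ - η) * hat g η) volume) ∧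
    ∀ᵐ ξ : Plane,
      hat h ξ = (1 / (4 * Real.pi ^ 2) : ℂ) * ∫ η : Plane, q ξ η * hat f (ξ - η) * hat g η

/-- The symbol `∑_j φ_{≤j-7}(|ξ - η|) φ_j(|η|)` of the paraproduct. -/
def paraSym (φ : ℝ → ℝ) (ξ η : Plane) : ℝ :=
  ∑' j : ℤ, phiLE φ (j - 7) ‖ξ - η‖ * phi φ j ‖η‖

/-- The symbol `s_{μ,+}^ε` of the symmetric quadratic term. -/
def sSym (φ : ℝ → ℝ) (ε : ℝ) (μ : ℤˣ) (ξ η : Plane) : ℂ :=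
  Complex.I * ((ε * (((μ : ℤ) : ℝ) * (1 / 2) * (inner ℝ ξ (ξ - η) / ‖ξ - η‖) + 1 / 4 * ‖ξ‖)
    * paraSym φ ξ η : ℝ) : ℂ)

/-- The symbol `q_{μ,ν}^ε`. It does not depend on `μ`. -/
def qSym (φ : ℝ → ℝ) (ε : ℝ) (_μ ν : ℤˣ) (ξ η : Plane) : ℂ :=
  Complex.I * ((ε / 8 * inner ℝ ξ (((ν : ℤ) : ℝ) • (‖η‖⁻¹ • η) - ‖ξ‖⁻¹ • ξ)
    * phiLE φ 5 (Real.sqrt ε * ‖η‖) * paraSym φ ξ η : ℝ) : ℂ)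

/-- The real part of `(⟨∇⟩^N F | ⟨∇⟩^N G)_2` is `ℓ`. When `F` is not in `H^N`, the scalar product is
understood as the limit of those with `P_{≤n} F` in the place of `F`; for `F, G ∈ H^N` this is the
scalar product itself. -/
def HasRePairing (φ : ℝ → ℝ) (N : ℝ) (F G : L2) (ℓ : ℝ) : Prop :=
  Tendsto (fun n : ℕ => (inner ℂ (japD N G) (japD N (PLE φ (n : ℤ) F)) : ℂ).re) atTop (𝓝 ℓ)

end Bsq

end

open MeasureTheory Filter Topology FourierTransform
open scoped ContDiff ENNReal

namespace Bsq

/-! ### The Fourier transform on `L² ∩ L¹` -/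

/-! Every quadratic expression is read on the Fourier side as an integral `bil q F G` with an
explicit symbol `q`. A pointwise bound of `q` by weights at `ξ - η` and `η` gives a Sobolev bound
through Young's inequality (`sNorm_bil_le`): the factor at `ξ - η` is put in weighted `L¹`
(`wNorm`), at the price of two derivatives (`wNorm_le_sNorm`), and the factor at `η` in weighted
`L²` (`sNorm`).

Put `w = |D|⁻¹ div u` and `b = Δ⁻¹∇div B^ε`. Since `v` is curl-free, `v = -∇|D|⁻¹w - εb`
(`hat_v_eq`). Split each product `fg` into `T_f g + T_g f` and a part where both frequencies are
comparable. The terms `T_v ζ` and `T_v v` combine, up to order zero, into the transport `-ε∇·(T_v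
V)`: the `w`-part of `v` yields the `μ/2` term of `s^ε`, and the `b`-part is the cubic term.

The term `-ε∇·(T_ζ v)` has no counterpart in the equation of `v` and would lose a derivative. The
correction `εB^ε` redistributes it: since `(1 + εΔ)` undoes the inverse in `B^ε` (`mHi_mul_lap`),
writing `v` in terms of `u` removes half of its high-frequency part from the equation of `ζ`, while
`ε∂_t B^ε` produces the matching half `-(ε/2) T_ζ∇ζ` in the equation of `u`. Together they form
`i(ε/2)|D| T_ζ V` to leading order, which is the `|ξ|/4` term of `s^ε`. Where `√ε|η|` is bounded no
correction is made, and `q^ε` records the discrepancy. What is left has order zero: commutators,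
comparable frequencies, terms with `∂_t ζ` or `|v|²` inside `B^ε`, and terms with `εb`, where `b`
gains one derivative at the price `1/ε`. The exact cancellation is the polynomial identity
`quadratic_algebra`, integrated in `quadratic_identity`; the remaining symbols are `remSymA` to
`remSymH`.

The symmetry of `s^ε` and the energy estimate of the cubic term rest on the same commutator bound
`exists_symbol_symm_bound`: exchanging `ξ` and `η` in `⟨ξ⟩^{2N} ψ(ξ)a(ξ)χ(ξ, η)` costs only a factor
`|ξ - η|`. For the cubic term, reality of `b` reduces the real part of the pairing to the
antisymmetrized kernel (`re_integral_triInt`). The bound is uniform in the truncation `P_{≤n}`, so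
dominated convergence gives the limit.

The time derivatives exist only in `L²`. They pass through `B^ε` because, for fixed `ε`, this
operator is a bounded bilinear map on `L² × L²` (`isBoundedBilinearMap_highPara`). -/

theorem integral_fourierInv_mul_eq_flip {f g : Plane → ℂ} (hf : Integrable f) (hg : Integrable g) :
    ∫ x, 𝓕⁻ f x * g x = ∫ x, f x * 𝓕⁻ g x := by
  have h := VectorFourier.integral_fourierIntegral_smul_eq_flip (L := -innerₗ Plane)
    Real.continuous_fourierChar (by
      simp only [LinearMap.neg_apply, innerₗ_apply_apply]
      fun_prop) hf hg
  have e : (-innerₗ Plane).flip = -innerₗ Plane := by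
    ext x y; simp [real_inner_comm]
  rw [e] at h
  exact h

/-- Both sides agree as distributions: against a smooth compactly supported function, the
multiplication formula moves the inverse transform from `F` to the test function, where the `L²` and
the integral definitions coincide. -/
theorem coe_fourierInv_ae_eq {F : L2} (hF : Integrable F volume) :
    ((𝓕⁻ F : L2) : Plane → ℂ) =ᵐ[volume] fun x => 𝓕⁻ (F : Plane → ℂ) x := by
  have hcont : Continuous fun x => 𝓕⁻ (F : Plane → ℂ) x :=
    VectorFourier.fourierIntegral_continuous Real.continuous_fourierChar
      (by simp only [LinearMap.neg_apply, innerₗ_apply_apply]; fun_prop) hF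
  refine ae_eq_of_integral_contDiff_smul_eq
    ((Lp.memLp (𝓕⁻ F : L2)).locallyIntegrable (by norm_num)) hcont.locallyIntegrable ?_
  intro g hg hgs
  have hg' : ContDiff ℝ ∞ fun x => (g x : ℂ) := Complex.ofRealCLM.contDiff.comp hg
  have hgs' : HasCompactSupport fun x => (g x : ℂ) :=
    hgs.comp_left (g := fun r : ℝ => (r : ℂ)) (by simp)
  set ψ : SchwartzMap Plane ℂ := hgs'.toSchwartzMap hg' with hψ
  have hψv : ∀ x, ψ x = (g x : ℂ) := fun x => rfl
  have h1 := DFunLike.congr_fun (Lp.fourierInv_toTemperedDistribution_eq F) ψ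
  rw [TemperedDistribution.fourierInv_apply, Lp.toTemperedDistribution_apply,
    Lp.toTemperedDistribution_apply] at h1
  simp only [hψv, smul_eq_mul] at h1
  simp only [Complex.real_smul]
  rw [← h1]
  have h2 := integral_fourierInv_mul_eq_flip hF ψ.integrable
  have h3 : ∀ x, (𝓕⁻ ψ : SchwartzMap Plane ℂ) x = 𝓕⁻ (ψ : Plane → ℂ) x := fun x => by
    rw [SchwartzMap.fourierInv_coe]
  calc ∫ x, (𝓕⁻ ψ : SchwartzMap Plane ℂ) x * F x = ∫ x, F x * 𝓕⁻ (ψ : Plane → ℂ) x := by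
        simp only [h3, mul_comm]
    _ = ∫ x, 𝓕⁻ (F : Plane → ℂ) x * ψ x := h2.symm
    _ = _ := by simp only [hψv, mul_comm]

/-! ### Basic properties of `hat` -/

theorem two_pi_pos : 0 < 2 * Real.pi := by positivity

theorem two_pi_ne : 2 * Real.pi ≠ 0 := two_pi_pos.ne'

theorem quasi_smul {r : ℝ} (hr : r ≠ 0) :
    Measure.QuasiMeasurePreserving (fun x : Plane => r • x) volume volume :=
  Measure.quasiMeasurePreserving_smul volume hr

theorem ae_smul {p : Plane → Prop} (h : ∀ᵐ x, p x) {r : ℝ} (hr : r ≠ 0) : ∀ᵐ x : Plane, p (r • x) :=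
  (quasi_smul hr).ae h

/-- In dimension two the Jacobian is `r⁻²`, and the `L²` norm takes its square root. -/
theorem eLpNorm_comp_smul {F : Plane → ℂ} (hF : AEStronglyMeasurable F volume) {r : ℝ}
    (hr : 0 < r) : eLpNorm (fun x => F (r • x)) 2 volume = ENNReal.ofReal r⁻¹ * eLpNorm F 2 volume := by
  have hm := Measure.map_addHaar_smul (volume : Measure Plane) hr.ne'
  have h1 : eLpNorm F 2 (Measure.map (fun x : Plane => r • x) volume)
      = eLpNorm (F ∘ fun x => r • x) 2 volume := by
    refine eLpNorm_map_measure ?_ (measurable_const_smul r).aemeasurable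
    rw [hm]
    exact hF.mono_ac (Measure.smul_absolutelyContinuous)
  have h2 : eLpNorm (F ∘ fun x => r • x) 2 volume = eLpNorm (fun x => F (r • x)) 2 volume := rfl
  rw [← h2, ← h1, hm, eLpNorm_smul_measure_of_ne_top (by norm_num)]
  have : |(r ^ Module.finrank ℝ Plane)⁻¹| = r⁻¹ ^ 2 := by
    rw [finrank_euclideanSpace_fin, abs_of_pos (by positivity), inv_pow]
  rw [this, ENNReal.ofReal_pow (by positivity)]
  simp only [ENNReal.toReal_div, smul_eq_mul]
  congr 1
  rw [← ENNReal.rpow_natCast, ← ENNReal.rpow_mul]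
  norm_num

theorem memLp_comp_smul {F : Plane → ℂ} (hF : MemLp F 2 volume) {r : ℝ} (hr : 0 < r) :
    MemLp (fun x => F (r • x)) 2 volume := by
  refine ⟨hF.1.comp_quasiMeasurePreserving (quasi_smul hr.ne'), ?_⟩
  rw [eLpNorm_comp_smul hF.1 hr]
  exact ENNReal.mul_lt_top ENNReal.ofReal_lt_top hF.2

theorem memLp_hat (f : L2) : MemLp (hat f) 2 volume :=
  memLp_comp_smul (Lp.memLp (𝓕 f : L2)) (inv_pos.2 two_pi_pos)

theorem aesm_hat (f : L2) : AEStronglyMeasurable (hat f) volume := (memLp_hat f).1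

theorem hat_smul_two_pi (f : L2) (w : Plane) : hat f ((2 * Real.pi) • w) = (𝓕 f : L2) w := by
  rw [hat, smul_smul, inv_mul_cancel₀ two_pi_ne, one_smul]

/-- The element of `L²` with a given Fourier transform. -/
noncomputable def ofHat (H : Plane → ℂ) (h : MemLp H 2 volume) : L2 :=
  𝓕⁻ ((memLp_comp_smul h two_pi_pos).toLp _)

theorem hat_ofHat {H : Plane → ℂ} (h : MemLp H 2 volume) : hat (ofHat H h) =ᵐ[volume] H := by
  have h1 := (memLp_comp_smul h two_pi_pos).coeFn_toLp
  filter_upwards [ae_smul h1 (inv_ne_zero two_pi_ne)] with ξ hξ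
  rw [hat, ofHat, fourier_fourierInv_eq, hξ, smul_smul, mul_inv_cancel₀ two_pi_ne, one_smul]

theorem hat_ext {f g : L2} (h : hat f =ᵐ[volume] hat g) : f = g := by
  have h1 : (𝓕 f : L2) = (𝓕 g : L2) := by
    refine Lp.ext ?_
    filter_upwards [ae_smul h two_pi_ne] with ξ hξ
    rwa [hat_smul_two_pi, hat_smul_two_pi] at hξ
  exact (Lp.fourierTransformₗᵢ Plane ℂ).injective h1

theorem hat_add (f g : L2) : hat (f + g) =ᵐ[volume] fun ξ => hat f ξ + hat g ξ := by
  have h : (𝓕 (f + g) : L2) = 𝓕 f + 𝓕 g := FourierTransform.fourier_add f g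
  filter_upwards [ae_smul (Lp.coeFn_add (𝓕 f : L2) (𝓕 g)) (inv_ne_zero two_pi_ne)] with ξ hξ
  simpa [hat, h] using hξ

theorem hat_smul (c : ℂ) (f : L2) : hat (c • f) =ᵐ[volume] fun ξ => c * hat f ξ := by
  have h : (𝓕 (c • f) : L2) = c • 𝓕 f := FourierTransform.fourier_smul c f
  filter_upwards [ae_smul (Lp.coeFn_smul c (𝓕 f : L2)) (inv_ne_zero two_pi_ne)] with ξ hξ
  simpa [hat, h] using hξ

theorem hat_neg (f : L2) : hat (-f) =ᵐ[volume] fun ξ => - hat f ξ := by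
  have := hat_smul (-1) f
  simpa using this

theorem hat_sub (f g : L2) : hat (f - g) =ᵐ[volume] fun ξ => hat f ξ - hat g ξ := by
  rw [sub_eq_add_neg]
  filter_upwards [hat_add f (-g), hat_neg g] with ξ h1 h2
  rw [h1, h2, sub_eq_add_neg]

theorem hat_zero : hat 0 =ᵐ[volume] fun _ => 0 := by
  simpa using hat_smul 0 0

theorem hat_sum {ι : Type*} (s : Finset ι) (f : ι → L2) :
    hat (∑ i ∈ s, f i) =ᵐ[volume] fun ξ => ∑ i ∈ s, hat (f i) ξ := by
  classical
  induction s using Finset.induction_on with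
  | empty => simpa using hat_zero
  | insert i s hi ih =>
    rw [Finset.sum_insert hi]
    filter_upwards [hat_add (f i) (∑ j ∈ s, f j), ih] with ξ h1 h2
    rw [h1, h2, Finset.sum_insert hi]

theorem enorm_eq_hat (f : L2) :
    ENNReal.ofReal (2 * Real.pi) * ‖f‖ₑ = eLpNorm (hat f) 2 volume := by
  have h1 := eLpNorm_comp_smul (Lp.memLp (𝓕 f : L2)).1 (inv_pos.2 two_pi_pos)
  rw [inv_inv] at h1
  have h2 : eLpNorm ((𝓕 f : L2) : Plane → ℂ) 2 volume = ‖f‖ₑ := by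
    rw [← Lp.enorm_def, ← ofReal_norm, Lp.norm_fourier_eq, ofReal_norm]
  rw [← h2, ← h1]
  rfl

theorem norm_eq_hat (f : L2) : 2 * Real.pi * ‖f‖ = (eLpNorm (hat f) 2 volume).toReal := by
  rw [← enorm_eq_hat, ENNReal.toReal_mul, ENNReal.toReal_ofReal two_pi_pos.le, toReal_enorm]

theorem inner_eq_hat (f g : L2) : inner ℂ f g
    = (1 / (4 * Real.pi ^ 2) : ℂ) * ∫ ξ, (starRingEnd ℂ) (hat f ξ) * hat g ξ := by
  rw [← Lp.inner_fourier_eq, L2.inner_def]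
  have h := Measure.integral_comp_smul (volume : Measure Plane)
    (fun ξ => (starRingEnd ℂ) (hat f ξ) * hat g ξ) (2 * Real.pi)
  simp only [hat_smul_two_pi, finrank_euclideanSpace_fin] at h
  simp only [RCLike.inner_apply, mul_comm ((𝓕 g : L2) _)]
  rw [h, abs_of_pos (by positivity), Complex.real_smul]
  congr 1
  push_cast
  ring

/-! ### Fourier multipliers -/

theorem mult_eq_ofHat {m : Plane → ℂ} {f : L2} (h : MemLp (fun ξ => m ξ * hat f ξ) 2 volume) :
    mult m f = ofHat _ h := by
  have h1 : MemLp (fun w : Plane => m ((2 * Real.pi) • w) * (𝓕 f : L2) w) 2 volume := by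
    simpa only [hat_smul_two_pi] using memLp_comp_smul h two_pi_pos
  rw [mult, dif_pos h1, ofHat]
  simp only [hat_smul_two_pi]

theorem hat_mult {m : Plane → ℂ} {f : L2} (h : MemLp (fun ξ => m ξ * hat f ξ) 2 volume) :
    hat (mult m f) =ᵐ[volume] fun ξ => m ξ * hat f ξ := by
  rw [mult_eq_ofHat h]; exact hat_ofHat h

theorem memLp_mult {m : Plane → ℂ} {C : ℝ} (hm : Measurable m) (hC : ∀ ξ, ‖m ξ‖ ≤ C) (f : L2) :
    MemLp (fun ξ => m ξ * hat f ξ) 2 volume :=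
  (memLp_hat f).of_le_mul (c := C) (hm.aestronglyMeasurable.mul (aesm_hat f))
    (ae_of_all _ fun ξ => by rw [norm_mul]; gcongr; exact hC ξ)

/-- A bounded Fourier multiplier as a continuous linear map. -/
noncomputable def multCLM (m : Plane → ℂ) (C : ℝ) (hm : Measurable m) (hC : ∀ ξ, ‖m ξ‖ ≤ C) :
    L2 →L[ℂ] L2 :=
  LinearMap.mkContinuous
    { toFun := mult m
      map_add' := fun f g => hat_ext <| by
        filter_upwards [hat_add f g, hat_add (mult m f) (mult m g), hat_mult (memLp_mult hm hC f),
          hat_mult (memLp_mult hm hC g), hat_mult (memLp_mult hm hC (f + g))] with ξ h1 h2 h3 h4 h5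
        rw [h5, h2, h1, h3, h4, mul_add]
      map_smul' := fun c f => hat_ext <| by
        filter_upwards [hat_smul c f, hat_smul c (mult m f), hat_mult (memLp_mult hm hC f),
          hat_mult (memLp_mult hm hC (c • f))] with ξ h1 h2 h3 h5
        simp only [RingHom.id_apply]
        rw [h5, h2, h1, h3, mul_left_comm] }
    C (fun f => by
      have hC0 : 0 ≤ C := (norm_nonneg _).trans (hC 0)
      have h1 : eLpNorm (hat (mult m f)) 2 volume ≤ ENNReal.ofReal C * eLpNorm (hat f) 2 volume := by
        rw [eLpNorm_congr_ae (hat_mult (memLp_mult hm hC f))]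
        refine eLpNorm_le_mul_eLpNorm_of_ae_le_mul (ae_of_all _ fun ξ => ?_) 2
        rw [norm_mul]; gcongr; exact hC ξ
      have h2 := ENNReal.toReal_mono (ENNReal.mul_ne_top ENNReal.ofReal_ne_top (memLp_hat f).2.ne) h1
      rw [ENNReal.toReal_mul, ENNReal.toReal_ofReal hC0, ← norm_eq_hat, ← norm_eq_hat] at h2
      have := two_pi_pos
      change ‖mult m f‖ ≤ C * ‖f‖
      nlinarith)

/-! ### Convolutions of nonnegative functions and Young's inequality -/

/-- The convolution of nonnegative functions. -/
noncomputable def conv (a b : Plane → ℝ≥0∞) (ξ : Plane) : ℝ≥0∞ := ∫⁻ η, a (ξ - η) * b η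

theorem quasi_sub : Measure.QuasiMeasurePreserving (fun p : Plane × Plane => p.1 - p.2)
    (volume.prod volume) volume := by
  have := quasiMeasurePreserving_sub_of_right_invariant (volume : Measure Plane) (volume : Measure Plane)
  exact this

theorem quasi_sub_left (ξ : Plane) :
    Measure.QuasiMeasurePreserving (fun η : Plane => ξ - η) volume volume :=
  (Measure.measurePreserving_sub_left volume ξ).quasiMeasurePreserving

theorem ae_sub_left {p : Plane → Prop} (h : ∀ᵐ x, p x) (ξ : Plane) : ∀ᵐ η : Plane, p (ξ - η) :=
  (quasi_sub_left ξ).ae h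

theorem aemeasurable_conv_integrand {a b : Plane → ℝ≥0∞} (ha : AEMeasurable a) (hb : AEMeasurable b) :
    AEMeasurable (fun p : Plane × Plane => a (p.1 - p.2) * b p.2) (volume.prod volume) :=
  (ha.comp_quasiMeasurePreserving quasi_sub).mul
    (hb.comp_quasiMeasurePreserving Measure.quasiMeasurePreserving_snd)

theorem aemeasurable_conv {a b : Plane → ℝ≥0∞} (ha : AEMeasurable a) (hb : AEMeasurable b) :
    AEMeasurable (conv a b) :=
  (aemeasurable_conv_integrand ha hb).lintegral_prod_right'

theorem conv_comm (a b : Plane → ℝ≥0∞) : conv a b = conv b a := by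
  funext ξ
  rw [conv, conv, ← lintegral_sub_left_eq_self _ ξ]
  simp only [sub_sub_cancel, mul_comm]

theorem lintegral_conv {a b : Plane → ℝ≥0∞} (ha : AEMeasurable a) (hb : AEMeasurable b) :
    ∫⁻ ξ, conv a b ξ = (∫⁻ ξ, a ξ) * ∫⁻ ξ, b ξ := by
  unfold conv
  rw [lintegral_lintegral_swap (aemeasurable_conv_integrand ha hb)]
  have : ∀ η : Plane, ∫⁻ ξ, a (ξ - η) * b η = (∫⁻ ξ, a ξ) * b η := fun η => by
    have h : AEMeasurable (fun ξ => a (ξ - η)) := ha.comp_quasiMeasurePreserving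
      (measurePreserving_sub_right volume η).quasiMeasurePreserving
    rw [lintegral_mul_const'' _ h, lintegral_sub_right_eq_self a]
  simp only [this]
  rw [lintegral_const_mul'' _ hb]

theorem eLpNorm_two_sq {E : Type*} [ENorm E] (f : Plane → E) :
    eLpNorm f 2 volume ^ 2 = ∫⁻ ξ, ‖f ξ‖ₑ ^ 2 := by
  rw [eLpNorm_eq_lintegral_rpow_enorm_toReal (by norm_num) (by norm_num), ← ENNReal.rpow_natCast,
    ← ENNReal.rpow_mul]
  norm_num

theorem lintegral_mul_le_eLpNorm {f g : Plane → ℝ≥0∞} (hf : AEMeasurable f) (hg : AEMeasurable g) :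
    ∫⁻ ξ, f ξ * g ξ ≤ eLpNorm f 2 volume * eLpNorm g 2 volume := by
  have := ENNReal.lintegral_mul_le_Lp_mul_Lq volume Real.HolderConjugate.two_two hf hg
  rw [eLpNorm_eq_lintegral_rpow_enorm_toReal (by norm_num) (by norm_num),
    eLpNorm_eq_lintegral_rpow_enorm_toReal (by norm_num) (by norm_num)]
  simpa using this

/-- Young's inequality `L¹ * L² ⊆ L²`. Cauchy-Schwarz with `a = a^{1/2} a^{1/2}` gives the pointwise
bound `(a * b)² ≤ ‖a‖₁ (a * b²)`, which Tonelli integrates. -/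
theorem eLpNorm_conv_le {a b : Plane → ℝ≥0∞} (ha : AEMeasurable a) (hb : AEMeasurable b) :
    eLpNorm (conv a b) 2 volume ≤ (∫⁻ ξ, a ξ) * eLpNorm b 2 volume := by
  have hpt : ∀ ξ, conv a b ξ ^ 2 ≤ (∫⁻ ξ, a ξ) * conv a (fun η => b η ^ 2) ξ := fun ξ => by
    have ha' : AEMeasurable (fun η => a (ξ - η)) := ha.comp_quasiMeasurePreserving (quasi_sub_left ξ)
    have hs : AEMeasurable (fun η => a (ξ - η) ^ (1 / 2 : ℝ)) := ha'.pow_const _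
    have h := lintegral_mul_le_eLpNorm hs (hs.mul hb)
    have e : ∀ x : ℝ≥0∞, x ^ (1 / 2 : ℝ) * x ^ (1 / 2 : ℝ) = x := fun x => by
      rw [← ENNReal.rpow_add_of_nonneg _ _ (by norm_num) (by norm_num)]; norm_num
    have e2 : ∀ x : ℝ≥0∞, (x ^ (1 / 2 : ℝ)) ^ 2 = x := fun x => by rw [sq, e]
    simp only [Pi.mul_apply, ← mul_assoc, e] at h
    calc conv a b ξ ^ 2 ≤ _ := pow_le_pow_left' h 2
      _ = _ := by
        rw [mul_pow, eLpNorm_two_sq, eLpNorm_two_sq]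
        simp only [enorm_eq_self, Pi.mul_apply, mul_pow, e2, conv]
        rw [lintegral_sub_left_eq_self a]
  have h2 : eLpNorm (conv a b) 2 volume ^ 2 ≤ ((∫⁻ ξ, a ξ) * eLpNorm b 2 volume) ^ 2 := by
    rw [mul_pow, eLpNorm_two_sq, eLpNorm_two_sq]
    simp only [enorm_eq_self]
    calc ∫⁻ ξ, conv a b ξ ^ 2 ≤ ∫⁻ ξ, (∫⁻ ξ, a ξ) * conv a (fun η => b η ^ 2) ξ :=
          lintegral_mono hpt
      _ = _ := by
        rw [lintegral_const_mul'' _ (aemeasurable_conv ha (hb.pow_const 2)),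
          lintegral_conv ha (hb.pow_const 2), sq, mul_assoc]
  exact (ENNReal.pow_right_strictMono two_ne_zero).le_iff_le.1 h2

theorem eLpNorm_conv_le' {a b : Plane → ℝ≥0∞} (ha : AEMeasurable a) (hb : AEMeasurable b) :
    eLpNorm (conv a b) 2 volume ≤ eLpNorm a 2 volume * ∫⁻ ξ, b ξ := by
  rw [conv_comm, mul_comm]; exact eLpNorm_conv_le hb ha

theorem conv_lt_top_ae {a b : Plane → ℝ≥0∞} (ha : AEMeasurable a) (hb : AEMeasurable b)
    (ha1 : ∫⁻ ξ, a ξ ≠ ⊤) (hb2 : eLpNorm b 2 volume ≠ ⊤) : ∀ᵐ ξ, conv a b ξ < ⊤ := by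
  have h1 : ∫⁻ ξ, conv a b ξ ^ 2 ≠ ⊤ := by
    have h := eLpNorm_two_sq (conv a b)
    simp only [enorm_eq_self] at h
    rw [← h]
    exact ENNReal.pow_ne_top (ne_top_of_le_ne_top (ENNReal.mul_ne_top ha1 hb2) (eLpNorm_conv_le ha hb))
  filter_upwards [ae_lt_top' ((aemeasurable_conv ha hb).pow_const 2) h1] with ξ hξ
  exact (ENNReal.pow_lt_top_iff.1 hξ).resolve_right two_ne_zero

/-! ### Weighted norms -/

theorem one_le_jap (ξ : Plane) : 1 ≤ jap ξ := by
  rw [jap, Real.one_le_sqrt]; nlinarith [sq_nonneg ‖ξ‖]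

theorem jap_pos (ξ : Plane) : 0 < jap ξ := one_pos.trans_le (one_le_jap ξ)

theorem norm_le_jap (ξ : Plane) : ‖ξ‖ ≤ jap ξ := Real.le_sqrt_of_sq_le (by linarith)

theorem jap_sq (ξ : Plane) : jap ξ ^ 2 = 1 + ‖ξ‖ ^ 2 := Real.sq_sqrt (by positivity)

theorem continuous_jap : Continuous jap := by unfold jap; fun_prop

theorem measurable_jap_rpow (s : ℝ) : Measurable fun ξ => jap ξ ^ s :=
  continuous_jap.measurable.pow_const s

theorem jap_rpow_pos (s : ℝ) (ξ : Plane) : 0 < jap ξ ^ s := Real.rpow_pos_of_pos (jap_pos ξ) s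

/-- The weighted `L¹` norm `∫ ⟨ξ⟩^a |F(ξ)| dξ`. -/
noncomputable def wNorm (a : ℝ) (F : Plane → ℂ) : ℝ≥0∞ := ∫⁻ ξ, ENNReal.ofReal (jap ξ ^ a) * ‖F ξ‖ₑ

/-- The weighted `L²` norm. -/
noncomputable def sNorm (s : ℝ) (F : Plane → ℂ) : ℝ≥0∞ :=
  eLpNorm (fun ξ => ENNReal.ofReal (jap ξ ^ s) * ‖F ξ‖ₑ) 2 volume

theorem enorm_jap_mul (s : ℝ) (F : Plane → ℂ) (ξ : Plane) :
    ‖((jap ξ ^ s : ℝ) : ℂ) * F ξ‖ₑ = ENNReal.ofReal (jap ξ ^ s) * ‖F ξ‖ₑ := by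
  rw [enorm_mul, ← ofReal_norm, Complex.norm_real, Real.norm_of_nonneg (jap_rpow_pos s ξ).le]

theorem sNorm_eq (s : ℝ) (F : Plane → ℂ) :
    sNorm s F = eLpNorm (fun ξ => ((jap ξ ^ s : ℝ) : ℂ) * F ξ) 2 volume := by
  refine eLpNorm_congr_enorm_ae (ae_of_all _ fun ξ => ?_)
  rw [enorm_jap_mul, enorm_eq_self]

theorem aem_weight (s : ℝ) {F : Plane → ℂ} (hF : AEStronglyMeasurable F volume) :
    AEMeasurable (fun ξ => ENNReal.ofReal (jap ξ ^ s) * ‖F ξ‖ₑ) :=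
  (measurable_jap_rpow s).ennreal_ofReal.aemeasurable.mul hF.enorm

theorem aesm_weight (s : ℝ) {F : Plane → ℂ} (hF : AEStronglyMeasurable F volume) :
    AEStronglyMeasurable (fun ξ => ((jap ξ ^ s : ℝ) : ℂ) * F ξ) volume :=
  (Complex.measurable_ofReal.comp (measurable_jap_rpow s)).aestronglyMeasurable.mul hF

theorem memH_iff {s : ℝ} {f : L2} : MemH s f ↔ sNorm s (hat f) ≠ ⊤ := by
  rw [sNorm_eq, MemH, MemLp, lt_top_iff_ne_top]
  exact ⟨fun h => h.2, fun h => ⟨aesm_weight s (aesm_hat f), h⟩⟩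

theorem hNorm_eq (s : ℝ) (f : L2) : hNorm s f = (2 * Real.pi)⁻¹ * (sNorm s (hat f)).toReal := by
  rw [sNorm_eq, hNorm]

theorem hNorm_nonneg (s : ℝ) (f : L2) : 0 ≤ hNorm s f := by
  rw [hNorm]; positivity

theorem sNorm_hat {s : ℝ} {f : L2} (h : MemH s f) :
    sNorm s (hat f) = ENNReal.ofReal (2 * Real.pi * hNorm s f) := by
  rw [hNorm_eq, ← mul_assoc, mul_inv_cancel₀ two_pi_ne, one_mul,
    ENNReal.ofReal_toReal (memH_iff.1 h)]

theorem sNorm_congr {s : ℝ} {F G : Plane → ℂ} (h : F =ᵐ[volume] G) : sNorm s F = sNorm s G :=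
  eLpNorm_congr_ae (by filter_upwards [h] with ξ hξ; rw [hξ])

theorem wNorm_congr {s : ℝ} {F G : Plane → ℂ} (h : F =ᵐ[volume] G) : wNorm s F = wNorm s G :=
  lintegral_congr_ae (by filter_upwards [h] with ξ hξ; rw [hξ])

theorem sNorm_mono {s r : ℝ} (h : s ≤ r) (F : Plane → ℂ) : sNorm s F ≤ sNorm r F :=
  eLpNorm_mono_enorm fun ξ => by
    simp only [enorm_eq_self]
    gcongr
    exact one_le_jap ξ

theorem wNorm_mono {s r : ℝ} (h : s ≤ r) (F : Plane → ℂ) : wNorm s F ≤ wNorm r F :=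
  lintegral_mono fun ξ => by
    gcongr
    exact one_le_jap ξ

theorem sNorm_zero (F : Plane → ℂ) : sNorm 0 F = eLpNorm F 2 volume := by
  rw [sNorm_eq]; simp

theorem wNorm_zero (F : Plane → ℂ) : wNorm 0 F = ∫⁻ ξ, ‖F ξ‖ₑ := by
  simp [wNorm]

theorem memLp_of_sNorm {s : ℝ} (hs : 0 ≤ s) {F : Plane → ℂ} (hF : AEStronglyMeasurable F volume)
    (h : sNorm s F ≠ ⊤) : MemLp F 2 volume :=
  ⟨hF, by
    rw [← sNorm_zero]; exact (sNorm_mono hs F).trans_lt h.lt_top⟩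

theorem integrable_of_wNorm {a : ℝ} (ha : 0 ≤ a) {F : Plane → ℂ} (hF : AEStronglyMeasurable F volume)
    (h : wNorm a F ≠ ⊤) : Integrable F volume :=
  ⟨hF, by
    rw [HasFiniteIntegral, ← wNorm_zero]; exact (wNorm_mono ha F).trans_lt h.lt_top⟩

theorem sNorm_add_le (s : ℝ) {F G : Plane → ℂ} (hF : AEStronglyMeasurable F volume)
    (hG : AEStronglyMeasurable G volume) :
    sNorm s (fun ξ => F ξ + G ξ) ≤ sNorm s F + sNorm s G := by
  simp only [sNorm_eq, mul_add]
  exact eLpNorm_add_le (aesm_weight s hF) (aesm_weight s hG) (by norm_num)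

theorem sNorm_sum_le {ι : Type*} (t : Finset ι) (s : ℝ) {F : ι → Plane → ℂ}
    (hF : ∀ i, AEStronglyMeasurable (F i) volume) :
    sNorm s (fun ξ => ∑ i ∈ t, F i ξ) ≤ ∑ i ∈ t, sNorm s (F i) := by
  classical
  induction t using Finset.induction_on with
  | empty => simp [sNorm]
  | insert i t hi ih =>
    simp only [Finset.sum_insert hi]
    exact (sNorm_add_le s (hF i) (Finset.aestronglyMeasurable_fun_sum t fun i _ => hF i)).trans
      (by gcongr)

theorem wNorm_add_le (s : ℝ) {F G : Plane → ℂ} (hF : AEStronglyMeasurable F volume) :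
    wNorm s (fun ξ => F ξ + G ξ) ≤ wNorm s F + wNorm s G := by
  unfold wNorm
  rw [← lintegral_add_left' (aem_weight s hF)]
  refine lintegral_mono fun ξ => ?_
  rw [← mul_add]
  gcongr
  exact enorm_add_le _ _

theorem sNorm_mul_le {s r : ℝ} {C : ℝ} {m F : Plane → ℂ}
    (h : ∀ ξ, jap ξ ^ s * ‖m ξ‖ ≤ C * jap ξ ^ r) :
    sNorm s (fun ξ => m ξ * F ξ) ≤ ENNReal.ofReal C * sNorm r F := by
  refine (eLpNorm_mono_enorm (g := fun ξ => ENNReal.ofReal C * (ENNReal.ofReal (jap ξ ^ r) * ‖F ξ‖ₑ))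
    fun ξ => ?_).trans (le_of_eq ?_)
  · simp only [enorm_eq_self]
    rw [enorm_mul, ← mul_assoc, ← mul_assoc, ← ofReal_norm (m ξ),
      ← ENNReal.ofReal_mul (jap_rpow_pos s ξ).le, ← ENNReal.ofReal_mul']
    · gcongr ENNReal.ofReal ?_ * _; exact h ξ
    · exact (jap_rpow_pos r ξ).le
  · refine (ENNReal.pow_right_strictMono two_ne_zero).injective ?_
    rw [mul_pow, sNorm, eLpNorm_two_sq, eLpNorm_two_sq]
    simp only [enorm_eq_self, mul_pow]
    rw [lintegral_const_mul' _ _ (by finiteness)]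

theorem wNorm_mul_le {s r : ℝ} {C : ℝ} {m F : Plane → ℂ}
    (h : ∀ ξ, jap ξ ^ s * ‖m ξ‖ ≤ C * jap ξ ^ r) :
    wNorm s (fun ξ => m ξ * F ξ) ≤ ENNReal.ofReal C * wNorm r F := by
  unfold wNorm
  rw [← lintegral_const_mul' _ _ (by finiteness)]
  refine lintegral_mono fun ξ => ?_
  simp only
  rw [enorm_mul, ← mul_assoc, ← mul_assoc, ← ofReal_norm (m ξ),
      ← ENNReal.ofReal_mul (jap_rpow_pos s ξ).le, ← ENNReal.ofReal_mul']
  · gcongr ENNReal.ofReal ?_ * _; exact h ξ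
  · exact (jap_rpow_pos r ξ).le

/-- The constant of the embedding of weighted `L²` into weighted `L¹`. -/
noncomputable def embC : ℝ := (eLpNorm (fun ξ : Plane => ENNReal.ofReal (jap ξ ^ (-2 : ℝ))) 2 volume).toReal

theorem embC_nonneg : 0 ≤ embC := ENNReal.toReal_nonneg

/-- The point is finiteness, since `toReal` would otherwise return a spurious `0`: the square
`⟨ξ⟩⁻⁴` is integrable on the plane because `4 > 2`. -/
theorem ofReal_embC : ENNReal.ofReal embC
    = eLpNorm (fun ξ : Plane => ENNReal.ofReal (jap ξ ^ (-2 : ℝ))) 2 volume := by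
  refine ENNReal.ofReal_toReal fun h => ?_
  have h2 := eLpNorm_two_sq (fun ξ : Plane => ENNReal.ofReal (jap ξ ^ (-2 : ℝ)))
  rw [h] at h2
  have h3 : Integrable (fun x : Plane => ((1 : ℝ) + ‖x‖ ^ 2) ^ (-(4 : ℝ) / 2)) volume :=
    integrable_rpow_neg_one_add_norm_sq (by rw [finrank_euclideanSpace_fin]; norm_num)
  have h4 := h3.lintegral_lt_top
  have h5 : ∫⁻ ξ : Plane, ‖ENNReal.ofReal (jap ξ ^ (-2 : ℝ))‖ₑ ^ 2
      = ∫⁻ x : Plane, ENNReal.ofReal (((1 : ℝ) + ‖x‖ ^ 2) ^ (-(4 : ℝ) / 2)) := by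
    refine lintegral_congr fun ξ => ?_
    rw [enorm_eq_self, ← ENNReal.ofReal_pow (jap_rpow_pos _ _).le, ← jap_sq,
      ← Real.rpow_natCast, ← Real.rpow_natCast, ← Real.rpow_mul (jap_pos ξ).le,
      ← Real.rpow_mul (jap_pos ξ).le]
    norm_num
  rw [← h2] at h5
  rw [← h5] at h4
  simp at h4

/-- Cauchy-Schwarz against `⟨ξ⟩⁻² ∈ L²(ℝ²)`. This is the Fourier-side form of the embedding of `H²`
into bounded functions. -/
theorem wNorm_le_sNorm (a : ℝ) {F : Plane → ℂ} (hF : AEStronglyMeasurable F volume) :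
    wNorm a F ≤ ENNReal.ofReal embC * sNorm (a + 2) F := by
  rw [ofReal_embC]
  have h := lintegral_mul_le_eLpNorm (measurable_jap_rpow (-2)).ennreal_ofReal.aemeasurable
    (aem_weight (a + 2) hF)
  refine (le_of_eq (lintegral_congr fun ξ => ?_)).trans h
  rw [← mul_assoc, ← ENNReal.ofReal_mul (jap_rpow_pos _ _).le, ← Real.rpow_add (jap_pos ξ)]
  congr 3
  ring

/-! ### Bilinear Fourier integrals -/

/-- The integral `∫ q(ξ, η) F(ξ - η) G(η) dη`. -/
noncomputable def bil (q : Plane → Plane → ℂ) (F G : Plane → ℂ) (ξ : Plane) : ℂ :=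
  ∫ η, q ξ η * F (ξ - η) * G η

theorem aesm_bilIntegrand {q : Plane → Plane → ℂ} (hq : Measurable fun p : Plane × Plane => q p.1 p.2)
    {F G : Plane → ℂ} (hF : AEStronglyMeasurable F volume) (hG : AEStronglyMeasurable G volume) :
    AEStronglyMeasurable (fun p : Plane × Plane => q p.1 p.2 * F (p.1 - p.2) * G p.2)
      (volume.prod volume) :=
  (hq.aestronglyMeasurable.mul (hF.comp_quasiMeasurePreserving quasi_sub)).mul
    (hG.comp_quasiMeasurePreserving Measure.quasiMeasurePreserving_snd)

theorem aesm_bilIntegrand_right {q : Plane → Plane → ℂ}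
    (hq : Measurable fun p : Plane × Plane => q p.1 p.2)
    {F G : Plane → ℂ} (hF : AEStronglyMeasurable F volume) (hG : AEStronglyMeasurable G volume)
    (ξ : Plane) : AEStronglyMeasurable (fun η => q ξ η * F (ξ - η) * G η) volume :=
  ((hq.comp (measurable_const.prodMk measurable_id)).aestronglyMeasurable.mul
    (hF.comp_quasiMeasurePreserving (quasi_sub_left ξ))).mul hG

theorem aesm_bil {q : Plane → Plane → ℂ} (hq : Measurable fun p : Plane × Plane => q p.1 p.2)
    {F G : Plane → ℂ} (hF : AEStronglyMeasurable F volume) (hG : AEStronglyMeasurable G volume) :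
    AEStronglyMeasurable (bil q F G) volume :=
  (aesm_bilIntegrand hq hF hG).integral_prod_right'

theorem bil_congr_ae {q : Plane → Plane → ℂ} {F F' G G' : Plane → ℂ} (hF : F =ᵐ[volume] F')
    (hG : G =ᵐ[volume] G') (ξ : Plane) : bil q F G ξ = bil q F' G' ξ :=
  integral_congr_ae (by
    filter_upwards [ae_sub_left hF ξ, hG] with η h1 h2
    rw [h1, h2])

theorem bil_swap (q : Plane → Plane → ℂ) (F G : Plane → ℂ) (ξ : Plane) :
    bil q F G ξ = bil (fun ξ η => q ξ (ξ - η)) G F ξ := by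
  rw [bil, bil, ← integral_sub_left_eq_self _ volume ξ]
  simp only [sub_sub_cancel]
  congr 1; ext η; ring

theorem enorm_bilIntegrand_le {q : Plane → Plane → ℂ} {s a r C : ℝ}
    (h : ∀ ξ η, jap ξ ^ s * ‖q ξ η‖ ≤ C * (jap (ξ - η) ^ a * jap η ^ r)) (F G : Plane → ℂ)
    (ξ η : Plane) :
    ENNReal.ofReal (jap ξ ^ s) * ‖q ξ η * F (ξ - η) * G η‖ₑ
      ≤ ENNReal.ofReal C * ((ENNReal.ofReal (jap (ξ - η) ^ a) * ‖F (ξ - η)‖ₑ)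
        * (ENNReal.ofReal (jap η ^ r) * ‖G η‖ₑ)) := by
  have h' := ENNReal.ofReal_le_ofReal (h ξ η)
  rw [ENNReal.ofReal_mul (jap_rpow_pos _ _).le,
    ENNReal.ofReal_mul' (mul_pos (jap_rpow_pos _ _) (jap_rpow_pos _ _)).le,
    ENNReal.ofReal_mul (jap_rpow_pos _ _).le, ofReal_norm] at h'
  rw [enorm_mul, enorm_mul]
  calc _ = (ENNReal.ofReal (jap ξ ^ s) * ‖q ξ η‖ₑ) * (‖F (ξ - η)‖ₑ * ‖G η‖ₑ) := by ring
    _ ≤ (ENNReal.ofReal C * (ENNReal.ofReal (jap (ξ - η) ^ a) * ENNReal.ofReal (jap η ^ r)))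
        * (‖F (ξ - η)‖ₑ * ‖G η‖ₑ) := by gcongr
    _ = _ := by ring

theorem lintegral_bilIntegrand_le {q : Plane → Plane → ℂ} {s a r C : ℝ}
    (h : ∀ ξ η, jap ξ ^ s * ‖q ξ η‖ ≤ C * (jap (ξ - η) ^ a * jap η ^ r)) (F G : Plane → ℂ)
    (ξ : Plane) :
    ENNReal.ofReal (jap ξ ^ s) * ∫⁻ η, ‖q ξ η * F (ξ - η) * G η‖ₑ
      ≤ ENNReal.ofReal C * conv (fun η => ENNReal.ofReal (jap η ^ a) * ‖F η‖ₑ)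
        (fun η => ENNReal.ofReal (jap η ^ r) * ‖G η‖ₑ) ξ := by
  rw [conv, ← lintegral_const_mul' _ _ (by finiteness), ← lintegral_const_mul' _ _ (by finiteness)]
  exact lintegral_mono fun η => enorm_bilIntegrand_le h F G ξ η

theorem enorm_bil_le {q : Plane → Plane → ℂ} {s a r C : ℝ}
    (h : ∀ ξ η, jap ξ ^ s * ‖q ξ η‖ ≤ C * (jap (ξ - η) ^ a * jap η ^ r)) (F G : Plane → ℂ)
    (ξ : Plane) :
    ENNReal.ofReal (jap ξ ^ s) * ‖bil q F G ξ‖ₑ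
      ≤ ENNReal.ofReal C * conv (fun η => ENNReal.ofReal (jap η ^ a) * ‖F η‖ₑ)
        (fun η => ENNReal.ofReal (jap η ^ r) * ‖G η‖ₑ) ξ :=
  (mul_le_mul_right (enorm_integral_le_lintegral_enorm _) _).trans (lintegral_bilIntegrand_le h F G ξ)

theorem eLpNorm_const_mul_ennreal {c : ℝ≥0∞} (hc : c ≠ ⊤) (f : Plane → ℝ≥0∞) :
    eLpNorm (fun ξ => c * f ξ) 2 volume = c * eLpNorm f 2 volume := by
  refine (ENNReal.pow_right_strictMono two_ne_zero).injective ?_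
  rw [mul_pow, eLpNorm_two_sq, eLpNorm_two_sq]
  simp only [enorm_eq_self, mul_pow]
  rw [lintegral_const_mul' _ _ (by finiteness)]

/-- The integrand is dominated by that of a convolution of an `L¹` and an `L²` function, which is
finite almost everywhere; the positive weight `⟨ξ⟩^s` can then be dropped. -/
theorem integrable_bil {q : Plane → Plane → ℂ} (hq : Measurable fun p : Plane × Plane => q p.1 p.2)
    {s a r C : ℝ} (h : ∀ ξ η, jap ξ ^ s * ‖q ξ η‖ ≤ C * (jap (ξ - η) ^ a * jap η ^ r))
    {F G : Plane → ℂ} (hF : AEStronglyMeasurable F volume) (hG : AEStronglyMeasurable G volume)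
    (hF1 : wNorm a F ≠ ⊤) (hG1 : sNorm r G ≠ ⊤) :
    ∀ᵐ ξ : Plane, Integrable (fun η => q ξ η * F (ξ - η) * G η) volume := by
  filter_upwards [conv_lt_top_ae (aem_weight a hF) (aem_weight r hG) hF1 hG1] with ξ hξ
  refine ⟨aesm_bilIntegrand_right hq hF hG ξ, ?_⟩
  have h1 := (lintegral_bilIntegrand_le h F G ξ).trans_lt
    (ENNReal.mul_lt_top ENNReal.ofReal_lt_top hξ)
  rw [HasFiniteIntegral]
  by_contra h2
  rw [not_lt, top_le_iff] at h2
  rw [h2, ENNReal.mul_top] at h1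
  · exact lt_irrefl _ h1
  · simpa using jap_rpow_pos s ξ

/-- The basic bilinear estimate: once the symbol bound has distributed the weights, `bil` is
dominated by a convolution and Young's inequality applies. The Sobolev bounds of the paraproducts
and of the remainder terms all come from it. -/
theorem sNorm_bil_le {q : Plane → Plane → ℂ}
    {s a r C : ℝ} (h : ∀ ξ η, jap ξ ^ s * ‖q ξ η‖ ≤ C * (jap (ξ - η) ^ a * jap η ^ r))
    {F G : Plane → ℂ} (hF : AEStronglyMeasurable F volume) (hG : AEStronglyMeasurable G volume) :
    sNorm s (bil q F G) ≤ ENNReal.ofReal C * (wNorm a F * sNorm r G) := by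
  refine (eLpNorm_mono_enorm fun ξ => (?_ : _ ≤ ‖_‖ₑ)).trans
    ((eLpNorm_const_mul_ennreal (c := ENNReal.ofReal C) (by finiteness) _).le.trans
      (mul_le_mul_right (eLpNorm_conv_le (aem_weight a hF) (aem_weight r hG)) _))
  simp only [enorm_eq_self]
  exact enorm_bil_le h F G ξ

theorem wNorm_bil_le {q : Plane → Plane → ℂ}
    {s a r C : ℝ} (h : ∀ ξ η, jap ξ ^ s * ‖q ξ η‖ ≤ C * (jap (ξ - η) ^ a * jap η ^ r))
    {F G : Plane → ℂ} (hF : AEStronglyMeasurable F volume) (hG : AEStronglyMeasurable G volume) :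
    wNorm s (bil q F G) ≤ ENNReal.ofReal C * (wNorm a F * wNorm r G) := by
  refine (lintegral_mono fun ξ => enorm_bil_le h F G ξ).trans (le_of_eq ?_)
  rw [lintegral_const_mul' _ _ (by finiteness),
    lintegral_conv (aem_weight a hF) (aem_weight r hG)]
  rfl

theorem memLp_bil {q : Plane → Plane → ℂ} (hq : Measurable fun p : Plane × Plane => q p.1 p.2)
    {s a r C : ℝ} (hs : 0 ≤ s) (h : ∀ ξ η, jap ξ ^ s * ‖q ξ η‖ ≤ C * (jap (ξ - η) ^ a * jap η ^ r))
    {F G : Plane → ℂ} (hF : AEStronglyMeasurable F volume) (hG : AEStronglyMeasurable G volume)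
    (hF1 : wNorm a F ≠ ⊤) (hG1 : sNorm r G ≠ ⊤) : MemLp (bil q F G) 2 volume :=
  memLp_of_sNorm hs (aesm_bil hq hF hG) <| ne_top_of_le_ne_top
    (ENNReal.mul_ne_top (by finiteness) (ENNReal.mul_ne_top hF1 hG1)) (sNorm_bil_le h hF hG)

/-! ### Triangle inequalities for the weights and the algebra property -/

theorem jap_add_le (ξ η : Plane) : jap ξ ≤ jap (ξ - η) + jap η := by
  have h1 : ‖ξ‖ ≤ ‖ξ - η‖ + ‖η‖ := by simpa using norm_add_le (ξ - η) η
  have h3 := jap_sq ξ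
  have h4 := jap_sq η
  have h5 := jap_sq (ξ - η)
  have h6 := one_le_jap η
  have h7 := one_le_jap (ξ - η)
  have h8 := mul_le_mul (norm_le_jap (ξ - η)) (norm_le_jap η) (norm_nonneg _) (by linarith)
  have h9 := norm_nonneg ξ
  refine le_of_sq_le_sq ?_ (by linarith)
  nlinarith
where
  le_of_sq_le_sq {a b : ℝ} (h : a ^ 2 ≤ b ^ 2) (hb : 0 ≤ b) : a ≤ b := by
    exact le_trans (le_abs_self a) (by rw [← abs_of_nonneg hb]; exact sq_le_sq.1 h)

theorem jap_le_mul (ξ η : Plane) : jap ξ ≤ 2 * (jap (ξ - η) * jap η) := by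
  have h1 := jap_add_le ξ η
  have h6 := one_le_jap η
  have h7 := one_le_jap (ξ - η)
  nlinarith

theorem jap_rpow_add_le {s : ℝ} (hs : 0 ≤ s) (ξ η : Plane) :
    jap ξ ^ s ≤ 2 ^ s * (jap (ξ - η) ^ s + jap η ^ s) := by
  have h1 := jap_add_le ξ η
  have h2 : jap ξ ≤ 2 * max (jap (ξ - η)) (jap η) := by
    have := le_max_left (jap (ξ - η)) (jap η)
    have := le_max_right (jap (ξ - η)) (jap η)
    linarith
  refine (Real.rpow_le_rpow (jap_pos ξ).le h2 hs).trans ?_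
  rw [Real.mul_rpow (by norm_num) ((jap_pos η).le.trans (le_max_right _ _))]
  gcongr
  rcases max_choice (jap (ξ - η)) (jap η) with h | h <;> rw [h]
  · linarith [jap_rpow_pos s η]
  · linarith [jap_rpow_pos s (ξ - η)]

/-- In a full product neither factor is known to have the lower frequency, so the weight `⟨ξ⟩^s` is
split over both factors; in each term the unweighted factor goes into `L¹`. -/
theorem sNorm_conv_le {s : ℝ} (hs : 0 ≤ s) {F G : Plane → ℂ} (hF : AEStronglyMeasurable F volume)
    (hG : AEStronglyMeasurable G volume) :
    sNorm s (bil (fun _ _ => 1) F G)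
      ≤ ENNReal.ofReal (2 ^ s) * (sNorm s F * wNorm 0 G + wNorm 0 F * sNorm s G) := by
  have a0 := aem_weight 0 hF
  have b0 := aem_weight 0 hG
  have a1 := aem_weight s hF
  have b1 := aem_weight s hG
  set A0 : Plane → ℝ≥0∞ := fun ξ => ENNReal.ofReal (jap ξ ^ (0 : ℝ)) * ‖F ξ‖ₑ with hA0
  set B0 : Plane → ℝ≥0∞ := fun ξ => ENNReal.ofReal (jap ξ ^ (0 : ℝ)) * ‖G ξ‖ₑ with hB0
  set A1 : Plane → ℝ≥0∞ := fun ξ => ENNReal.ofReal (jap ξ ^ s) * ‖F ξ‖ₑ with hA1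
  set B1 : Plane → ℝ≥0∞ := fun ξ => ENNReal.ofReal (jap ξ ^ s) * ‖G ξ‖ₑ with hB1
  have hpt : ∀ ξ, ENNReal.ofReal (jap ξ ^ s) * ‖bil (fun _ _ => 1) F G ξ‖ₑ
      ≤ ENNReal.ofReal (2 ^ s) * (conv A1 B0 ξ + conv A0 B1 ξ) := fun ξ => by
    refine (mul_le_mul_right (enorm_integral_le_lintegral_enorm _) _).trans ?_
    unfold conv
    have hm : AEMeasurable (fun η => A1 (ξ - η) * B0 η) :=
      (a1.comp_quasiMeasurePreserving (quasi_sub_left ξ)).mul b0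
    rw [← lintegral_add_left' hm,
      ← lintegral_const_mul' _ _ (by finiteness), ← lintegral_const_mul' _ _ (by finiteness)]
    refine lintegral_mono fun η => ?_
    have h := ENNReal.ofReal_le_ofReal (jap_rpow_add_le hs ξ η)
    rw [ENNReal.ofReal_mul (by positivity),
      ENNReal.ofReal_add (jap_rpow_pos _ _).le (jap_rpow_pos _ _).le] at h
    simp only [hA0, hA1, hB0, hB1, one_mul, enorm_mul, Real.rpow_zero, ENNReal.ofReal_one]
    calc _ ≤ (ENNReal.ofReal (2 ^ s) * (ENNReal.ofReal (jap (ξ - η) ^ s) + ENNReal.ofReal (jap η ^ s)))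
          * (‖F (ξ - η)‖ₑ * ‖G η‖ₑ) := by gcongr
      _ = _ := by ring
  refine (eLpNorm_mono_enorm fun ξ => (?_ : _ ≤ ‖ENNReal.ofReal (2 ^ s) * ((conv A1 B0 + conv A0 B1) ξ)‖ₑ)).trans ?_
  · simp only [enorm_eq_self]
    exact hpt ξ
  · rw [eLpNorm_const_mul_ennreal (by finiteness)]
    gcongr
    refine (eLpNorm_add_le (aemeasurable_conv a1 b0).aestronglyMeasurable
      (aemeasurable_conv a0 b1).aestronglyMeasurable (by norm_num)).trans ?_
    exact add_le_add (eLpNorm_conv_le' a1 b0) (eLpNorm_conv_le a0 b1)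

/-! ### Products and complex conjugates on the Fourier side -/

theorem integrable_fourier_of_hat {f : L2} (h : Integrable (hat f) volume) :
    Integrable ((𝓕 f : L2) : Plane → ℂ) volume := by
  have := (integrable_comp_smul_iff volume (hat f) two_pi_ne).2 h
  simpa only [hat_smul_two_pi] using this

theorem coe_ae_eq_fourierInv {f : L2} (h : Integrable (hat f) volume) :
    (f : Plane → ℂ) =ᵐ[volume] fun x => 𝓕⁻ ((𝓕 f : L2) : Plane → ℂ) x := by
  have h1 := coe_fourierInv_ae_eq (integrable_fourier_of_hat h)
  have h2 : (𝓕⁻ (𝓕 f : L2) : L2) = f := fourierInv_fourier_eq f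
  rwa [h2] at h1

theorem fourierInv_convolution {F G : Plane → ℂ} (hF : Integrable F volume)
    (hG : Integrable G volume) (x : Plane) :
    𝓕⁻ (fun ξ => ∫ η, F (ξ - η) * G η) x = 𝓕⁻ F x * 𝓕⁻ G x := by
  have h := Real.fourier_mul_convolution_eq hG hF (-x)
  rw [Real.fourierInv_eq_fourier_neg, Real.fourierInv_eq_fourier_neg, Real.fourierInv_eq_fourier_neg,
    mul_comm, ← h]
  have e : (fun ξ => ∫ η, F (ξ - η) * G η)
      = convolution G F (ContinuousLinearMap.mul ℂ ℂ) volume := by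
    funext ξ
    simp only [convolution, ContinuousLinearMap.mul_apply', mul_comm]
  rw [e]

theorem memLp_convolution {F G : Plane → ℂ} (hF : Integrable F volume) (hG : MemLp G 2 volume) :
    MemLp (fun ξ => ∫ η, F (ξ - η) * G η) 2 volume := by
  have h := memLp_bil (q := fun _ _ => 1) measurable_const (s := 0) (a := 0) (r := 0) (C := 1) le_rfl
    (by simp) hF.1 hG.1 (by rw [wNorm_zero]; exact hF.2.ne) (by rw [sNorm_zero]; exact hG.2.ne)
  have e : bil (fun _ _ => 1) F G = fun ξ => ∫ η, F (ξ - η) * G η := by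
    funext ξ
    simp only [bil, one_mul]
  rwa [e] at h

/-- The candidate is the inverse transform of the convolution, which lies in `L¹ ∩ L²`. This shows
at once that the pointwise product is square integrable, so that `prod` does not take its default
value, and identifies its transform. -/
theorem prod_aux {f g : L2} (hf : Integrable (hat f) volume) (hg : Integrable (hat g) volume) :
    ∃ h : L2, (∀ᵐ x, (h : Plane → ℂ) x = f x * g x) ∧
      ((𝓕 h : L2) : Plane → ℂ) =ᵐ[volume]
        fun ξ => ∫ η, (𝓕 f : L2) (ξ - η) * (𝓕 g : L2) η := by
  have hF := integrable_fourier_of_hat hf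
  have hG := integrable_fourier_of_hat hg
  have hm := memLp_convolution hF (Lp.memLp (𝓕 g : L2))
  have hi : Integrable (fun ξ => ∫ η, (𝓕 f : L2) (ξ - η) * (𝓕 g : L2) η) volume := by
    have := hG.integrable_convolution (ContinuousLinearMap.mul ℂ ℂ) hF
    refine this.congr (ae_of_all _ fun ξ => ?_)
    simp only [convolution, ContinuousLinearMap.mul_apply']
    congr 1; ext η; ring
  set H : L2 := hm.toLp _ with hH
  have hHc := hm.coeFn_toLp
  refine ⟨𝓕⁻ H, ?_, ?_⟩
  · have h1 := coe_fourierInv_ae_eq (F := H) (hi.congr hHc.symm)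
    filter_upwards [h1, coe_ae_eq_fourierInv hf, coe_ae_eq_fourierInv hg] with x h1 h2 h3
    rw [h1, h2, h3, ← fourierInv_convolution hF hG]
    exact Real.fourierInv_congr_ae hHc x
  · have : (𝓕 (𝓕⁻ H : L2) : L2) = H := fourier_fourierInv_eq H
    rw [this]
    exact hHc

theorem hat_prod {f g : L2} (hf : Integrable (hat f) volume) (hg : Integrable (hat g) volume) :
    hat (prod f g) =ᵐ[volume]
      fun ξ => (1 / (4 * Real.pi ^ 2) : ℂ) * ∫ η, hat f (ξ - η) * hat g η := by
  obtain ⟨h, h1, h2⟩ := prod_aux hf hg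
  have hm : MemLp (fun x : Plane => f x * g x) 2 volume := (memLp_congr_ae h1).1 (Lp.memLp h)
  have hp : prod f g = h := by
    rw [prod, dif_pos hm]
    refine Lp.ext ?_
    filter_upwards [hm.coeFn_toLp, h1] with x h3 h4
    rw [h3, h4]
  filter_upwards [ae_smul h2 (inv_ne_zero two_pi_ne)] with ξ hξ
  rw [hp, hat, hξ]
  -- The rescaling by `2π` between the two normalizations of the transform, in dimension two, is the
  -- source of the factor `(4π²)⁻¹`.
  have h4 := Measure.integral_comp_smul (volume : Measure Plane)
    (fun η => (𝓕 f : L2) ((2 * Real.pi)⁻¹ • ξ - η) * (𝓕 g : L2) η) (2 * Real.pi)⁻¹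
  simp only [← smul_sub, finrank_euclideanSpace_fin] at h4
  have h5 : ∫ η, hat f (ξ - η) * hat g η
    = ∫ η, (𝓕 f : L2) ((2 * Real.pi)⁻¹ • (ξ - η)) * (𝓕 g : L2) ((2 * Real.pi)⁻¹ • η) := rfl
  rw [h5, h4, abs_of_pos (by positivity), Complex.real_smul, ← mul_assoc]
  have : (1 / (4 * Real.pi ^ 2) : ℂ) * (((((2 * Real.pi)⁻¹ ^ 2)⁻¹ : ℝ)) : ℂ) = 1 := by
    have : (Real.pi : ℂ) ≠ 0 := by exact_mod_cast Real.pi_ne_zero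
    push_cast
    field_simp
    norm_num
  rw [this, one_mul]

theorem fourierInv_conj_neg (F : Plane → ℂ) (x : Plane) :
    𝓕⁻ (fun ξ => (starRingEnd ℂ) (F (-ξ))) x = (starRingEnd ℂ) (𝓕⁻ F x) := by
  rw [Real.fourierInv_eq', Real.fourierInv_eq', ← integral_conj, ← integral_neg_eq_self]
  congr 1
  ext ξ
  simp only [neg_neg, smul_eq_mul, map_mul, ← Complex.exp_conj, inner_neg_left, Complex.conj_I,
    Complex.conj_ofReal]
  congr 2
  push_cast
  ring

theorem ae_neg {p : Plane → Prop} (h : ∀ᵐ x, p x) : ∀ᵐ x : Plane, p (-x) :=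
  (Measure.measurePreserving_neg (volume : Measure Plane)).quasiMeasurePreserving.ae h

theorem hat_star {f : L2} (h : Integrable (hat f) volume) :
    hat (star f) =ᵐ[volume] fun ξ => (starRingEnd ℂ) (hat f (-ξ)) := by
  have hF := integrable_fourier_of_hat h
  have hm : MemLp (fun ξ => (starRingEnd ℂ) ((𝓕 f : L2) (-ξ))) 2 volume :=
    ((Lp.memLp (𝓕 f : L2)).comp_measurePreserving
      (Measure.measurePreserving_neg (volume : Measure Plane))).star
  have hi : Integrable (fun ξ => (starRingEnd ℂ) ((𝓕 f : L2) (-ξ))) volume :=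
    (Complex.conjLIE.toContinuousLinearEquiv.toContinuousLinearMap).integrable_comp hF.comp_neg
  set H : L2 := hm.toLp _ with hH
  have hHc := hm.coeFn_toLp
  have e : star f = 𝓕⁻ H := by
    refine Lp.ext ?_
    filter_upwards [coe_fourierInv_ae_eq (F := H) (hi.congr hHc.symm), coe_ae_eq_fourierInv h,
      Lp.coeFn_star f] with x h1 h2 h3
    rw [h3, h1, Pi.star_apply, h2, Real.fourierInv_congr_ae hHc x, fourierInv_conj_neg]
    rfl
  have e2 : (𝓕 (𝓕⁻ H : L2) : L2) = H := fourier_fourierInv_eq H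
  filter_upwards [ae_smul hHc (inv_ne_zero two_pi_ne)] with ξ hξ
  rw [hat, e, e2, hξ, hat, smul_neg]

theorem isRealValued_iff_star {f : L2} : IsRealValued f ↔ star f = f := by
  constructor
  · intro h
    refine Lp.ext ?_
    filter_upwards [Lp.coeFn_star f, h] with x h1 h2
    rw [h1, Pi.star_apply]
    exact Complex.conj_eq_iff_im.2 h2
  · intro h
    have h0 := Lp.coeFn_star f
    rw [h] at h0
    filter_upwards [h0] with x h1
    exact Complex.conj_eq_iff_im.1 h1.symm

/-! ### The Littlewood-Paley cut-offs and the paraproduct symbol -/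

section Cutoff

variable {φ : ℝ → ℝ}

theorem two_zpow_pos (j : ℤ) : (0 : ℝ) < 2 ^ j := by positivity

theorem IsCutoff.eq_zero (hφ : IsCutoff φ) {x : ℝ} (hx : 3 / 2 < x) : φ x = 0 := by
  by_contra h
  exact absurd (hφ.supp (Function.mem_support.2 h)).2 (not_le.2 hx)

theorem IsCutoff.eq_one (hφ : IsCutoff φ) {x : ℝ} (h0 : 0 ≤ x) (hx : x ≤ 5 / 4) : φ x = 1 :=
  hφ.one x ⟨by linarith, hx⟩

theorem phiLE_nonneg (hφ : IsCutoff φ) (k : ℤ) (x : ℝ) : 0 ≤ phiLE φ k x := (hφ.range _).1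

theorem phiLE_le_one (hφ : IsCutoff φ) (k : ℤ) (x : ℝ) : phiLE φ k x ≤ 1 := (hφ.range _).2

theorem phiLE_eq_one (hφ : IsCutoff φ) {k : ℤ} {x : ℝ} (h0 : 0 ≤ x) (hx : x ≤ 5 / 4 * 2 ^ k) :
    phiLE φ k x = 1 :=
  hφ.eq_one (div_nonneg h0 (two_zpow_pos k).le) ((div_le_iff₀ (two_zpow_pos k)).2 hx)

theorem phiLE_eq_zero (hφ : IsCutoff φ) {k : ℤ} {x : ℝ} (hx : 3 / 2 * 2 ^ k < x) :
    phiLE φ k x = 0 :=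
  hφ.eq_zero ((lt_div_iff₀ (two_zpow_pos k)).2 hx)

theorem phi_eq (φ : ℝ → ℝ) (j : ℤ) (r : ℝ) : phi φ j r = phiLE φ j r - phiLE φ (j - 1) r := rfl

theorem two_zpow_sub_one (j : ℤ) : (2 : ℝ) ^ (j - 1) = 2 ^ j / 2 := by
  rw [zpow_sub_one₀ two_ne_zero]; ring

theorem two_zpow_add_one (j : ℤ) : (2 : ℝ) ^ (j + 1) = 2 * 2 ^ j := by
  rw [zpow_add_one₀ two_ne_zero]; ring

theorem phi_eq_zero_of_le (hφ : IsCutoff φ) {j : ℤ} {r : ℝ} (h0 : 0 ≤ r) (h : r ≤ 5 / 8 * 2 ^ j) :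
    phi φ j r = 0 := by
  have := two_zpow_pos j
  rw [phi_eq, phiLE_eq_one hφ h0 (by linarith),
    phiLE_eq_one hφ h0 (by rw [two_zpow_sub_one]; linarith), sub_self]

theorem phi_eq_zero_of_lt (hφ : IsCutoff φ) {j : ℤ} {r : ℝ} (h : 3 / 2 * 2 ^ j < r) :
    phi φ j r = 0 := by
  have := two_zpow_pos j
  rw [phi_eq, phiLE_eq_zero hφ h, phiLE_eq_zero hφ (by rw [two_zpow_sub_one]; linarith), sub_self]

theorem phi_nonneg (hφ : IsCutoff φ) (j : ℤ) {r : ℝ} (h0 : 0 ≤ r) : 0 ≤ phi φ j r := by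
  have := two_zpow_pos j
  rcases le_or_gt r (5 / 4 * 2 ^ j) with h | h
  · rw [phi_eq, phiLE_eq_one hφ h0 h]
    linarith [phiLE_le_one hφ (j - 1) r]
  · rw [phi_eq, phiLE_eq_zero hφ (k := j - 1) (by rw [two_zpow_sub_one]; linarith)]
    linarith [phiLE_nonneg hφ j r]

theorem phi_le_one (hφ : IsCutoff φ) (j : ℤ) (r : ℝ) : phi φ j r ≤ 1 := by
  rw [phi_eq]
  linarith [phiLE_nonneg hφ (j - 1) r, phiLE_le_one hφ j r]

theorem phi_zero (hφ : IsCutoff φ) (j : ℤ) : phi φ j 0 = 0 :=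
  phi_eq_zero_of_le hφ le_rfl (by positivity)

theorem phi_eq_zero_of_dyadic (hφ : IsCutoff φ) {J j : ℤ} {r : ℝ} (h1 : 2 ^ J ≤ r) (h2 : r < 2 ^ (J + 1))
    (hj : j < J ∨ J + 1 < j) : phi φ j r = 0 := by
  have := two_zpow_pos j
  rcases hj with h | h
  · refine phi_eq_zero_of_lt hφ ?_
    have h3 : (2 : ℝ) ^ (j + 1) ≤ 2 ^ J := zpow_le_zpow_right₀ (by norm_num) (by omega)
    rw [two_zpow_add_one] at h3
    linarith
  · refine phi_eq_zero_of_le hφ ((two_zpow_pos J).le.trans h1) ?_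
    have h3 : (2 : ℝ) ^ (J + 1) ≤ 2 ^ (j - 1) := zpow_le_zpow_right₀ (by norm_num) (by omega)
    rw [two_zpow_sub_one] at h3
    linarith

theorem exists_dyadic {r : ℝ} (hr : 0 < r) : ∃ J : ℤ, (2 : ℝ) ^ J ≤ r ∧ r < 2 ^ (J + 1) :=
  exists_mem_Ico_zpow hr one_lt_two

/-- The terms `J` and `J + 1` telescope to `φ_{≤J+1} - φ_{≤J-1}`, which equals `1` at `r`, and all
other `φ_j` vanish at `r`. Allowing larger finite sets makes different frequencies summable over a
common window. -/
theorem sum_phi (hφ : IsCutoff φ) {J : ℤ} {r : ℝ} (h1 : 2 ^ J ≤ r) (h2 : r < 2 ^ (J + 1))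
    {s : Finset ℤ} (hs : {J, J + 1} ⊆ s) : ∑ j ∈ s, phi φ j r = 1 := by
  have h0 := two_zpow_pos J
  rw [← Finset.sum_subset hs]
  · rw [Finset.sum_pair (by omega), phi_eq, phi_eq, add_sub_cancel_right,
      phiLE_eq_one hφ (h0.le.trans h1) (k := J + 1) (by linarith [two_zpow_pos (J + 1)]),
      phiLE_eq_zero hφ (k := J - 1) (by rw [two_zpow_sub_one]; linarith)]
    ring
  · intro j _ hj
    refine phi_eq_zero_of_dyadic hφ h1 h2 ?_
    simp only [Finset.mem_insert, Finset.mem_singleton] at hj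
    omega

theorem sum_phi_le_one (hφ : IsCutoff φ) {r : ℝ} (hr : 0 ≤ r) (s : Finset ℤ) :
    ∑ j ∈ s, phi φ j r ≤ 1 := by
  rcases hr.eq_or_lt with rfl | hr
  · simp [phi_zero hφ]
  · obtain ⟨J, h1, h2⟩ := exists_dyadic hr
    rw [← sum_phi hφ h1 h2 (s := {J, J + 1} ∪ s) Finset.subset_union_left]
    exact Finset.sum_le_sum_of_subset_of_nonneg Finset.subset_union_right
      fun j _ _ => phi_nonneg hφ j hr.le

theorem paraSym_eq_sum (hφ : IsCutoff φ) (ξ : Plane) {η : Plane} {J : ℤ} (h1 : 2 ^ J ≤ ‖η‖)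
    (h2 : ‖η‖ < 2 ^ (J + 1)) {s : Finset ℤ} (hs : {J, J + 1} ⊆ s) :
    paraSym φ ξ η = ∑ j ∈ s, phiLE φ (j - 7) ‖ξ - η‖ * phi φ j ‖η‖ := by
  refine tsum_eq_sum fun j hj => ?_
  have hj' : j ≠ J ∧ j ≠ J + 1 :=
    ⟨fun h => hj (hs (by simp [h])), fun h => hj (hs (by simp [h]))⟩
  rw [phi_eq_zero_of_dyadic hφ h1 h2 (by omega), mul_zero]

theorem summable_paraSym (hφ : IsCutoff φ) (ξ η : Plane) :
    Summable fun j : ℤ => phiLE φ (j - 7) ‖ξ - η‖ * phi φ j ‖η‖ := by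
  rcases (norm_nonneg η).eq_or_lt with h | h
  · rw [← h]
    simpa only [phi_zero hφ, mul_zero] using summable_zero
  · obtain ⟨J, h1, h2⟩ := exists_dyadic h
    refine summable_of_ne_finset_zero (s := {J, J + 1}) fun j hj => ?_
    simp only [Finset.mem_insert, Finset.mem_singleton] at hj
    rw [phi_eq_zero_of_dyadic hφ h1 h2 (by omega), mul_zero]

theorem paraSym_zero_right (hφ : IsCutoff φ) (ξ : Plane) : paraSym φ ξ 0 = 0 := by
  simp [paraSym, phi_zero hφ]

theorem paraSym_nonneg (hφ : IsCutoff φ) (ξ η : Plane) : 0 ≤ paraSym φ ξ η :=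
  tsum_nonneg fun j => mul_nonneg (phiLE_nonneg hφ _ _) (phi_nonneg hφ j (norm_nonneg _))

theorem paraSym_le_one (hφ : IsCutoff φ) (ξ η : Plane) : paraSym φ ξ η ≤ 1 := by
  refine (summable_paraSym hφ ξ η).tsum_le_of_sum_le fun s => ?_
  refine (Finset.sum_le_sum fun j _ => ?_).trans (sum_phi_le_one hφ (norm_nonneg η) s)
  exact mul_le_of_le_one_left (phi_nonneg hφ j (norm_nonneg _)) (phiLE_le_one hφ _ _)

theorem abs_paraSym_le_one (hφ : IsCutoff φ) (ξ η : Plane) : |paraSym φ ξ η| ≤ 1 := by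
  rw [abs_of_nonneg (paraSym_nonneg hφ ξ η)]; exact paraSym_le_one hφ ξ η

theorem two_zpow_sub_seven (j : ℤ) : (2 : ℝ) ^ (j - 7) = 2 ^ j / 128 := by
  rw [zpow_sub₀ two_ne_zero]; norm_num

/-- A nonzero term needs `|η| > (5/8) 2^j` and `|ξ - η| ≤ (3/2) 2^j / 128`, so the ratio of the two
exceeds `160/3 > 53`. -/
theorem paraSym_eq_zero (hφ : IsCutoff φ) {ξ η : Plane} (h : ‖η‖ < 53 * ‖ξ - η‖) :
    paraSym φ ξ η = 0 := by
  rw [paraSym]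
  convert tsum_zero with j
  have := two_zpow_pos j
  rcases le_or_gt ‖η‖ (5 / 8 * 2 ^ j) with h1 | h1
  · rw [phi_eq_zero_of_le hφ (norm_nonneg _) h1, mul_zero]
  · rw [phiLE_eq_zero hφ (by rw [two_zpow_sub_seven]; linarith), zero_mul]

/-- For `|η| ≤ (3/2) 2^j` the low-frequency cut-off equals `1` as soon as `|ξ - η| ≤ (5/4) 2^j /
128`, and the quotient of these bounds is `153.6`. The sum then reduces to the partition of unity.
-/
theorem paraSym_eq_one (hφ : IsCutoff φ) {ξ η : Plane} (hη : η ≠ 0) (h : 154 * ‖ξ - η‖ ≤ ‖η‖) :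
    paraSym φ ξ η = 1 := by
  obtain ⟨J, h1, h2⟩ := exists_dyadic (norm_pos_iff.2 hη)
  rw [paraSym_eq_sum hφ ξ h1 h2 subset_rfl, ← sum_phi hφ h1 h2 subset_rfl]
  refine Finset.sum_congr rfl fun j _ => ?_
  rcases le_or_gt ‖η‖ (3 / 2 * 2 ^ j) with h3 | h3
  · rw [phiLE_eq_one hφ (norm_nonneg _), one_mul]
    rw [two_zpow_sub_seven]
    linarith [two_zpow_pos j]
  · rw [phi_eq_zero_of_lt hφ h3, mul_zero]

theorem IsCutoff.continuous (hφ : IsCutoff φ) : Continuous φ := hφ.smooth.continuous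

theorem measurable_phiLE (hφ : IsCutoff φ) (k : ℤ) : Measurable (phiLE φ k) :=
  hφ.continuous.measurable.comp (measurable_id.div_const _)

theorem measurable_phi (hφ : IsCutoff φ) (k : ℤ) : Measurable (phi φ k) :=
  (measurable_phiLE hφ k).sub (measurable_phiLE hφ (k - 1))

theorem measurable_paraTermSym (hφ : IsCutoff φ) (j : ℤ) : Measurable fun p : Plane × Plane =>
    phiLE φ (j - 7) ‖p.1 - p.2‖ * phi φ j ‖p.2‖ :=
  ((measurable_phiLE hφ _).comp (measurable_fst.sub measurable_snd).norm).mul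
    ((measurable_phi hφ j).comp measurable_snd.norm)

theorem measurable_paraSym (hφ : IsCutoff φ) :
    Measurable fun p : Plane × Plane => paraSym φ p.1 p.2 := by
  refine measurable_of_tendsto_metrizable' (atTop : Filter (Finset ℤ))
    (f := fun s p => ∑ j ∈ s, phiLE φ (j - 7) ‖p.1 - p.2‖ * phi φ j ‖p.2‖)
    (fun s => Finset.measurable_fun_sum s fun j _ => measurable_paraTermSym hφ j) ?_
  rw [tendsto_pi_nhds]
  exact fun p => (summable_paraSym hφ p.1 p.2).hasSum

theorem IsCutoff.exists_lipschitz (hφ : IsCutoff φ) :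
    ∃ L : ℝ, 0 ≤ L ∧ ∀ x y, |φ x - φ y| ≤ L * |x - y| := by
  have hc : HasCompactSupport φ :=
    HasCompactSupport.of_support_subset_isCompact isCompact_Icc hφ.supp
  obtain ⟨L, hL⟩ := hφ.smooth.lipschitzWith_of_hasCompactSupport hc (by simp)
  exact ⟨L, L.2, fun x y => by simpa [Real.dist_eq] using hL.dist_le_mul x y⟩

/-- Two frequencies of comparable size. -/
def Near (ξ η : Plane) : Prop := ‖ξ‖ ≤ 2 * ‖η‖ ∧ ‖η‖ ≤ 2 * ‖ξ‖

theorem Near.symm {ξ η : Plane} (h : Near ξ η) : Near η ξ := ⟨h.2, h.1⟩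

theorem norm_le_sub_add (ξ η : Plane) : ‖ξ‖ ≤ ‖ξ - η‖ + ‖η‖ := by
  simpa using norm_add_le (ξ - η) η

theorem norm_le_sub_add' (ξ η : Plane) : ‖η‖ ≤ ‖ξ - η‖ + ‖ξ‖ := by
  rw [norm_sub_rev]; exact norm_le_sub_add η ξ

theorem near_of_le {ξ η : Plane} (h : 53 * ‖ξ - η‖ ≤ ‖η‖) : Near ξ η := by
  have h1 := norm_le_sub_add ξ η
  have h2 := norm_le_sub_add' ξ η
  have h3 := norm_nonneg ξ
  have h4 := norm_nonneg η
  exact ⟨by linarith, by linarith⟩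

theorem near_of_paraSym_ne (hφ : IsCutoff φ) {ξ η : Plane} (h : paraSym φ ξ η ≠ 0) : Near ξ η :=
  near_of_le (not_lt.1 fun h' => h (paraSym_eq_zero hφ h'))

theorem Near.jap_le {ξ η : Plane} (h : Near ξ η) : jap ξ ≤ 2 * jap η := by
  have h1 := jap_sq ξ
  have h2 := jap_sq η
  have h3 := one_le_jap η
  have h4 := norm_nonneg ξ
  have h5 := h.1
  refine jap_add_le.le_of_sq_le_sq ?_ (by linarith)
  nlinarith

theorem Near.jap_rpow_le {ξ η : Plane} (h : Near ξ η) {s : ℝ} (hs : 0 ≤ s) :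
    jap ξ ^ s ≤ 2 ^ s * jap η ^ s := by
  rw [← Real.mul_rpow (by norm_num) (jap_pos η).le]
  exact Real.rpow_le_rpow (jap_pos ξ).le h.jap_le hs

theorem phiLE_sub_le {L : ℝ} (hL : ∀ x y, |φ x - φ y| ≤ L * |x - y|) (k : ℤ)
    (x y : ℝ) : |phiLE φ k x - phiLE φ k y| * 2 ^ k ≤ L * |x - y| := by
  have h := hL (x / 2 ^ k) (y / 2 ^ k)
  rw [← sub_div, abs_div, abs_of_pos (two_zpow_pos k), ← mul_div_assoc,
    le_div_iff₀ (two_zpow_pos k)] at h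
  exact h

theorem abs_norm_sub (ξ η : Plane) : |‖η‖ - ‖ξ‖| ≤ ‖ξ - η‖ := by
  rw [abs_sub_comm]; exact abs_norm_sub_norm_le ξ η

/-- Uniformity in `k` is what matters, since the truncations `P_{≤n}` use it. The Lipschitz constant
`L / 2^k` is harmless when `|η| ≤ 3·2^k`; beyond that both values vanish, the frequencies being
within a factor two. -/
theorem phiLE_norm_sub_le (hφ : IsCutoff φ) {L : ℝ} (hL0 : 0 ≤ L)
    (hL : ∀ x y, |φ x - φ y| ≤ L * |x - y|) (k : ℤ) {ξ η : Plane} (h : Near ξ η) :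
    |phiLE φ k ‖ξ‖ - phiLE φ k ‖η‖| * ‖η‖ ≤ 3 * L * ‖ξ - η‖ := by
  have h0 := two_zpow_pos k
  rcases le_or_gt ‖η‖ (3 * 2 ^ k) with h1 | h1
  · have h2 := phiLE_sub_le hL k ‖ξ‖ ‖η‖
    have h3 := abs_norm_sub_norm_le ξ η
    have h4 := mul_le_mul_of_nonneg_left h3 hL0
    have h5 := mul_le_mul_of_nonneg_left h1 (abs_nonneg (phiLE φ k ‖ξ‖ - phiLE φ k ‖η‖))
    linarith
  · have h2 := h.2
    rw [phiLE_eq_zero hφ (by linarith), phiLE_eq_zero hφ (by linarith), sub_zero, abs_zero, zero_mul]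
    positivity

/-- The low-frequency cut-off depends on `|ξ - η|` only and is unaffected by the exchange. It
remains to compare `φ_j(|η|)` with `φ_j(|ξ|)`: at most four scales are involved and each contributes
`12L`. -/
theorem paraSym_sub_le (hφ : IsCutoff φ) {L : ℝ} (hL0 : 0 ≤ L)
    (hL : ∀ x y, |φ x - φ y| ≤ L * |x - y|) {ξ η : Plane} (h : Near ξ η) :
    |paraSym φ ξ η - paraSym φ η ξ| * ‖η‖ ≤ 48 * L * ‖ξ - η‖ := by
  rcases eq_or_ne η 0 with rfl | hη
  · simp only [norm_zero, mul_zero]; positivity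
  obtain ⟨J, h1, h2⟩ := exists_dyadic (norm_pos_iff.2 hη)
  have hξ : ξ ≠ 0 := by
    rintro rfl
    have := h.2
    rw [norm_zero, mul_zero] at this
    exact hη (norm_le_zero_iff.1 this)
  obtain ⟨I, h3, h4⟩ := exists_dyadic (norm_pos_iff.2 hξ)
  have hI1 : J - 1 ≤ I := by
    by_contra hc
    have : (2 : ℝ) ^ (I + 1) ≤ 2 ^ (J - 1) := zpow_le_zpow_right₀ (by norm_num) (by omega)
    rw [two_zpow_sub_one] at this
    linarith [h.2]
  have hI2 : I ≤ J + 1 := by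
    by_contra hc
    have : (2 : ℝ) ^ (J + 1 + 1) ≤ 2 ^ I := zpow_le_zpow_right₀ (by norm_num) (by omega)
    rw [two_zpow_add_one] at this
    linarith [h.1]
  -- As `J - 1 ≤ I ≤ J + 1`, this window contains both `{J, J + 1}` and `{I, I + 1}`.
  rw [paraSym_eq_sum hφ ξ h1 h2 (s := Finset.Icc (J - 1) (J + 2)) (by
      intro j hj; simp only [Finset.mem_insert, Finset.mem_singleton] at hj
      rw [Finset.mem_Icc]; omega),
    paraSym_eq_sum hφ η h3 h4 (s := Finset.Icc (J - 1) (J + 2)) (by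
      intro j hj; simp only [Finset.mem_insert, Finset.mem_singleton] at hj
      rw [Finset.mem_Icc]; omega), ← Finset.sum_sub_distrib]
  have hterm : ∀ j ∈ Finset.Icc (J - 1) (J + 2), |phiLE φ (j - 7) ‖ξ - η‖ * phi φ j ‖η‖
      - phiLE φ (j - 7) ‖η - ξ‖ * phi φ j ‖ξ‖| * ‖η‖ ≤ 12 * L * ‖ξ - η‖ := by
    intro j hj
    rw [Finset.mem_Icc] at hj
    have hj1 : (2 : ℝ) ^ (J - 1) ≤ 2 ^ j := zpow_le_zpow_right₀ (by norm_num) hj.1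
    rw [two_zpow_sub_one] at hj1
    have h5 := phiLE_sub_le hL j ‖η‖ ‖ξ‖
    have h6 := phiLE_sub_le hL (j - 1) ‖η‖ ‖ξ‖
    rw [two_zpow_sub_one] at h6
    have h7 := mul_le_mul_of_nonneg_left (abs_norm_sub ξ η) hL0
    rw [norm_sub_rev η ξ, ← mul_sub, abs_mul, abs_of_nonneg (phiLE_nonneg hφ _ _)]
    have h8 : |phi φ j ‖η‖ - phi φ j ‖ξ‖| * 2 ^ j ≤ 3 * L * ‖ξ - η‖ := by
      have : |phi φ j ‖η‖ - phi φ j ‖ξ‖| ≤ |phiLE φ j ‖η‖ - phiLE φ j ‖ξ‖|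
          + |phiLE φ (j - 1) ‖η‖ - phiLE φ (j - 1) ‖ξ‖| := by
        rw [phi_eq, phi_eq]
        refine le_trans (le_of_eq ?_) (abs_sub _ _)
        congr 1; ring
      have := mul_le_mul_of_nonneg_right this (two_zpow_pos j).le
      linarith
    have h9 : ‖η‖ ≤ 4 * 2 ^ j := by rw [two_zpow_add_one] at h2; linarith
    calc _ ≤ 1 * |phi φ j ‖η‖ - phi φ j ‖ξ‖| * (4 * 2 ^ j) := by
          gcongr
          exact phiLE_le_one hφ _ _
      _ ≤ _ := by linarith
  calc _ ≤ (∑ j ∈ Finset.Icc (J - 1) (J + 2), |phiLE φ (j - 7) ‖ξ - η‖ * phi φ j ‖η‖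
      - phiLE φ (j - 7) ‖η - ξ‖ * phi φ j ‖ξ‖|) * ‖η‖ := by
        gcongr
        exact Finset.abs_sum_le_sum_abs _ _
    _ ≤ ∑ j ∈ Finset.Icc (J - 1) (J + 2), 12 * L * ‖ξ - η‖ := by
        rw [Finset.sum_mul]
        exact Finset.sum_le_sum hterm
    _ = _ := by
        rw [Finset.sum_const, Int.card_Icc]
        have : (J + 2 + 1 - (J - 1)).toNat = 4 := by omega
        rw [this]
        simp only [nsmul_eq_mul]
        push_cast
        ring

end Cutoff

/-! ### Commutator bounds for weighted symbols -/

theorem abs_rpow_sub_le {x y M p : ℝ} (hx : 0 ≤ x) (hy : 0 ≤ y) (hxM : x ≤ M) (hyM : y ≤ M)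
    (hp : 1 ≤ p) : |x ^ p - y ^ p| ≤ p * M ^ (p - 1) * |x - y| := by
  have h := Convex.norm_image_sub_le_of_norm_hasDerivWithin_le (𝕜 := ℝ) (f := fun t : ℝ => t ^ p)
    (f' := fun t => p * t ^ (p - 1)) (s := Set.Icc 0 M) (C := p * M ^ (p - 1)) (x := y) (y := x)
    (fun t _ => (Real.hasDerivAt_rpow_const (Or.inr hp)).hasDerivWithinAt)
    (fun t ht => by
      rw [Real.norm_of_nonneg (mul_nonneg (by linarith) (Real.rpow_nonneg ht.1 _))]
      have := Real.rpow_le_rpow ht.1 ht.2 (show 0 ≤ p - 1 by linarith)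
      gcongr) (convex_Icc 0 M) ⟨hy, hyM⟩ ⟨hx, hxM⟩
  simpa only [Real.norm_eq_abs] using h

theorem abs_jap_sub_le (ξ η : Plane) : |jap ξ - jap η| ≤ ‖ξ - η‖ := by
  have key : ∀ ξ η : Plane, jap ξ - jap η ≤ ‖ξ - η‖ := fun ξ η => by
    have h1 := jap_sq ξ
    have h2 := jap_sq η
    have h3 := norm_le_sub_add ξ η
    have h4 := norm_le_jap η
    have h5 := norm_nonneg (ξ - η)
    have h6 := norm_nonneg ξ
    have h7 := norm_nonneg η
    have h8 : jap ξ ≤ ‖ξ - η‖ + jap η := by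
      refine jap_add_le.le_of_sq_le_sq ?_ (by linarith [jap_pos η])
      nlinarith
    linarith
  rw [abs_le]
  exact ⟨by have := key η ξ; rw [norm_sub_rev] at this; linarith, key ξ η⟩

/-- The mean value theorem gives `2N M^{2N-1}|ξ - η|` with `M` the larger bracket. The factor `|ξ| ≤
M` completes the power to `M^{2N}`, which is shared evenly because both brackets are comparable to
`M`. -/
theorem jap_rpow_sub_le {N : ℝ} (hN : 1 / 2 ≤ N) {ξ η : Plane} (h : Near ξ η) :
    |jap ξ ^ (2 * N) - jap η ^ (2 * N)| * ‖ξ‖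
      ≤ 2 * N * 4 ^ N * (‖ξ - η‖ * (jap ξ ^ N * jap η ^ N)) := by
  set M := max (jap ξ) (jap η) with hM
  have hM0 : 0 < M := (jap_pos ξ).trans_le (le_max_left _ _)
  have h1 := abs_rpow_sub_le (jap_pos ξ).le (jap_pos η).le (le_max_left _ _ : _ ≤ M)
    (le_max_right _ _) (p := 2 * N) (by linarith)
  have h2 := abs_jap_sub_le ξ η
  have h3 : ‖ξ‖ ≤ M := (norm_le_jap ξ).trans (le_max_left _ _)
  have h4 : M ^ (2 * N - 1) * M = M ^ N * M ^ N := by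
    rw [← Real.rpow_add_one hM0.ne', ← Real.rpow_add hM0]
    congr 1; ring
  have h5 : M ≤ 2 * jap ξ := max_le (by linarith [jap_pos ξ]) h.symm.jap_le
  have h6 : M ≤ 2 * jap η := max_le h.jap_le (by linarith [jap_pos η])
  have hN0 : 0 ≤ N := by linarith
  have hj1 := jap_pos ξ
  have hj2 := jap_pos η
  have h7 : M ^ N * M ^ N ≤ (2 ^ N * jap ξ ^ N) * (2 ^ N * jap η ^ N) := by
    rw [← Real.mul_rpow (by norm_num) (jap_pos ξ).le, ← Real.mul_rpow (by norm_num) (jap_pos η).le]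
    gcongr
  have h8 : (4 : ℝ) ^ N = 2 ^ N * 2 ^ N := by
    rw [← Real.mul_rpow (by norm_num) (by norm_num)]; norm_num
  have h9 := Real.rpow_nonneg hM0.le (2 * N - 1)
  calc _ ≤ (2 * N * M ^ (2 * N - 1) * ‖ξ - η‖) * M := by
        refine mul_le_mul (h1.trans ?_) h3 (norm_nonneg _) (by positivity)
        gcongr
    _ = 2 * N * ‖ξ - η‖ * (M ^ (2 * N - 1) * M) := by ring
    _ ≤ 2 * N * ‖ξ - η‖ * ((2 ^ N * jap ξ ^ N) * (2 ^ N * jap η ^ N)) := by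
        rw [h4]; gcongr
    _ = _ := by rw [h8]; ring

/-- The weighted symbol `⟨ξ⟩^{2N} ψ(ξ) a(ξ) χ(ξ, η)` is symmetric up to a gain of one derivative. -/
theorem exists_symbol_symm_bound {φ : ℝ → ℝ} (hφ : IsCutoff φ) {N : ℝ} (hN : 1 / 2 ≤ N) {C : ℝ} (hC : 0 ≤ C) :
    ∃ K : ℝ, 0 ≤ K ∧ ∀ (a ψ : Plane → ℝ), (∀ z, |a z| ≤ ‖z‖) → (∀ z z', |a z - a z'| ≤ ‖z - z'‖) →
      (∀ z, |ψ z| ≤ 1) → (∀ ξ η, Near ξ η → |ψ ξ - ψ η| * ‖η‖ ≤ C * ‖ξ - η‖) → ∀ ξ η,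
      |jap ξ ^ (2 * N) * (ψ ξ * a ξ * paraSym φ ξ η) - jap η ^ (2 * N) * (ψ η * a η * paraSym φ η ξ)|
        ≤ K * (‖ξ - η‖ * (jap ξ ^ N * jap η ^ N)) := by
  obtain ⟨L, hL0, hL⟩ := hφ.exists_lipschitz
  have hN0 : 0 ≤ N := by linarith
  refine ⟨2 * N * 4 ^ N + 2 ^ N * (2 * C + 1 + 48 * L), by positivity, ?_⟩
  intro a ψ ha ha' hψ hψ' ξ η
  by_cases hnear : Near ξ η
  swap
  · have h1 : paraSym φ ξ η = 0 := by
      by_contra h; exact hnear (near_of_paraSym_ne hφ h)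
    have h2 : paraSym φ η ξ = 0 := by
      by_contra h; exact hnear (near_of_paraSym_ne hφ h).symm
    rw [h1, h2, mul_zero, mul_zero, mul_zero, mul_zero, sub_zero, abs_zero]
    have := jap_rpow_pos N ξ
    have := jap_rpow_pos N η
    positivity
  have p1 := jap_rpow_pos N ξ
  have p2 := jap_rpow_pos N η
  have hχ := abs_paraSym_le_one hφ ξ η
  have hY : jap η ^ (2 * N) ≤ 2 ^ N * (jap ξ ^ N * jap η ^ N) := by
    have := hnear.symm.jap_rpow_le hN0
    rw [two_mul, Real.rpow_add (jap_pos η)]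
    nlinarith
  have hY0 := jap_rpow_pos (2 * N) η
  have e1 : |(jap ξ ^ (2 * N) - jap η ^ (2 * N)) * (ψ ξ * a ξ * paraSym φ ξ η)|
      ≤ 2 * N * 4 ^ N * (‖ξ - η‖ * (jap ξ ^ N * jap η ^ N)) := by
    refine le_trans ?_ (jap_rpow_sub_le hN hnear)
    rw [abs_mul, abs_mul, abs_mul]
    gcongr
    calc |ψ ξ| * |a ξ| * |paraSym φ ξ η| ≤ 1 * ‖ξ‖ * 1 := by gcongr; exacts [hψ ξ, ha ξ]
      _ = _ := by ring
  have e2 : |(ψ ξ - ψ η) * a ξ * paraSym φ ξ η| ≤ 2 * C * ‖ξ - η‖ := by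
    rw [abs_mul, abs_mul]
    have h1 := hψ' ξ η hnear
    calc |ψ ξ - ψ η| * |a ξ| * |paraSym φ ξ η| ≤ |ψ ξ - ψ η| * (2 * ‖η‖) * 1 := by
          gcongr; exact (ha ξ).trans hnear.1
      _ ≤ _ := by linarith
  have e3 : |ψ η * (a ξ - a η) * paraSym φ ξ η| ≤ ‖ξ - η‖ := by
    rw [abs_mul, abs_mul]
    calc |ψ η| * |a ξ - a η| * |paraSym φ ξ η| ≤ 1 * ‖ξ - η‖ * 1 := by
          gcongr; exacts [hψ η, ha' ξ η]
      _ = _ := by ring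
  have e4 : |ψ η * a η * (paraSym φ ξ η - paraSym φ η ξ)| ≤ 48 * L * ‖ξ - η‖ := by
    rw [abs_mul, abs_mul]
    have h1 := paraSym_sub_le hφ hL0 hL hnear
    calc |ψ η| * |a η| * |paraSym φ ξ η - paraSym φ η ξ|
        ≤ 1 * ‖η‖ * |paraSym φ ξ η - paraSym φ η ξ| := by gcongr; exacts [hψ η, ha η]
      _ ≤ _ := by linarith
  -- Product rule: one factor at a time passes from `ξ` to `η`. The differences of the weight, of
  -- `ψ` and of `χ` save one power of the frequency, which compensates `|a z| ≤ |z|`; the difference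
  -- of `a` is itself at most `|ξ - η|`.
  have hsplit : jap ξ ^ (2 * N) * (ψ ξ * a ξ * paraSym φ ξ η)
      - jap η ^ (2 * N) * (ψ η * a η * paraSym φ η ξ)
      = (jap ξ ^ (2 * N) - jap η ^ (2 * N)) * (ψ ξ * a ξ * paraSym φ ξ η)
        + jap η ^ (2 * N) * ((ψ ξ - ψ η) * a ξ * paraSym φ ξ η
          + ψ η * (a ξ - a η) * paraSym φ ξ η + ψ η * a η * (paraSym φ ξ η - paraSym φ η ξ)) := by
    ring
  rw [hsplit]
  refine (abs_add_le _ _).trans ?_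
  rw [abs_mul (jap η ^ (2 * N)), abs_of_pos hY0]
  have e5 := (abs_add_three ((ψ ξ - ψ η) * a ξ * paraSym φ ξ η)
    (ψ η * (a ξ - a η) * paraSym φ ξ η) (ψ η * a η * (paraSym φ ξ η - paraSym φ η ξ)))
  have e6 : |(ψ ξ - ψ η) * a ξ * paraSym φ ξ η + ψ η * (a ξ - a η) * paraSym φ ξ η
      + ψ η * a η * (paraSym φ ξ η - paraSym φ η ξ)| ≤ (2 * C + 1 + 48 * L) * ‖ξ - η‖ := by
    linarith
  have e7 : jap η ^ (2 * N) * |(ψ ξ - ψ η) * a ξ * paraSym φ ξ η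
      + ψ η * (a ξ - a η) * paraSym φ ξ η + ψ η * a η * (paraSym φ ξ η - paraSym φ η ξ)|
      ≤ (2 ^ N * (jap ξ ^ N * jap η ^ N)) * ((2 * C + 1 + 48 * L) * ‖ξ - η‖) := by
    gcongr
  linarith

/-! ### Bounds of the symbols of the quadratic terms -/

theorem abs_apply_le (ξ : Plane) (k : Fin 2) : |ξ k| ≤ ‖ξ‖ := by
  simpa using PiLp.norm_apply_le ξ k

/-- Rescaling `η` to the sphere of radius `|ξ|` moves it by `||ξ| - |η|| ≤ |ξ - η|`. This is the
gain of one derivative in `q_{μ,+}` and in the remainder symbols containing `|ξ| η_k / |η|`. -/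
theorem norm_mul_unit_sub_le {ξ η : Plane} (hη : η ≠ 0) :
    ‖(‖ξ‖ * ‖η‖⁻¹) • η - ξ‖ ≤ 2 * ‖ξ - η‖ := by
  have h0 : ‖η‖ ≠ 0 := norm_ne_zero_iff.2 hη
  have e : (‖ξ‖ * ‖η‖⁻¹) • η - ξ = ((‖ξ‖ - ‖η‖) * ‖η‖⁻¹) • η + (η - ξ) := by
    rw [sub_mul, mul_inv_cancel₀ h0, sub_smul, one_smul]; abel
  rw [e]
  refine (norm_add_le _ _).trans ?_
  rw [norm_smul, norm_mul, norm_inv, norm_norm, mul_assoc, inv_mul_cancel₀ h0, mul_one,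
    norm_sub_rev η ξ, Real.norm_eq_abs]
  linarith [abs_norm_sub_norm_le ξ η]

theorem abs_unit_sub_le {ξ η : Plane} (hη : η ≠ 0) (k : Fin 2) :
    |‖ξ‖ * η k / ‖η‖ - ξ k| ≤ 2 * ‖ξ - η‖ := by
  refine le_trans (le_of_eq ?_) ((abs_apply_le ((‖ξ‖ * ‖η‖⁻¹) • η - ξ) k).trans
    (norm_mul_unit_sub_le hη))
  simp only [PiLp.sub_apply, PiLp.smul_apply, smul_eq_mul]
  congr 1; ring

theorem units_int_cases (μ : ℤˣ) : (((μ : ℤ) : ℝ) = 1) ∨ (((μ : ℤ) : ℝ) = -1) := by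
  rcases Int.units_eq_one_or μ with rfl | rfl <;> simp

theorem conj_sSym (φ : ℝ → ℝ) (ε : ℝ) (μ : ℤˣ) (ξ η : Plane) :
    (starRingEnd ℂ) (sSym φ ε μ ξ η) = -sSym φ ε μ ξ η := by
  rw [sSym, map_mul, Complex.conj_I, Complex.conj_ofReal, neg_mul]

theorem norm_I_mul_ofReal (r : ℝ) : ‖Complex.I * (r : ℂ)‖ = |r| := by
  rw [norm_mul, Complex.norm_I, one_mul, Complex.norm_real, Real.norm_eq_abs]

theorem phiLE_ratio_eq_one {φ : ℝ → ℝ} (hφ : IsCutoff φ) {d r : ℝ} (hd : 0 ≤ d) (h : 53 * d ≤ r) :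
    phiLE φ (-6) (d / r) = 1 := by
  have hr : 0 ≤ r := by linarith
  refine phiLE_eq_one hφ (div_nonneg hd hr) ?_
  refine div_le_of_le_mul₀ hr (by positivity) ?_
  have : (2 : ℝ) ^ (-6 : ℤ) = 1 / 64 := by norm_num
  rw [this]
  linarith

theorem abs_inner_div_norm_le (z e : Plane) : |inner ℝ z e / ‖e‖| ≤ ‖z‖ := by
  rw [abs_div, abs_of_nonneg (norm_nonneg e)]
  exact div_le_of_le_mul₀ (norm_nonneg _) (norm_nonneg _) (abs_real_inner_le_norm z e)

/-- Freeze the direction of `ξ - η`. The symbol is `iε a(ξ) χ(ξ, η)`, where `a` is Lipschitz with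
constant at most `1/2 + 1/4`. Exchanging `ξ` and `η` reverses this direction and the change from `μ`
to `-μ` restores it, so the second term is the same `a` evaluated at `η`. -/
theorem exists_sSym_bound {φ : ℝ → ℝ} (hφ : IsCutoff φ) {N : ℝ} (hN : 1 / 2 ≤ N) :
    ∃ K : ℝ, 0 ≤ K ∧ ∀ (ε : ℝ), 0 < ε → ∀ (μ : ℤˣ) (ξ η : Plane),
      ‖((jap ξ ^ (-N) * jap η ^ (-N) : ℝ) : ℂ) * (((jap ξ ^ (2 * N) : ℝ) : ℂ) * sSym φ ε μ ξ η
        - ((jap η ^ (2 * N) : ℝ) : ℂ) * sSym φ ε (-μ) η ξ)‖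
      ≤ K * (ε * ‖ξ - η‖ * phiLE φ (-6) (‖ξ - η‖ / max ‖ξ‖ ‖η‖)) := by
  obtain ⟨K, hK0, hK⟩ := exists_symbol_symm_bound hφ hN (le_refl (0 : ℝ))
  refine ⟨K, hK0, fun ε hε μ ξ η => ?_⟩
  have hφn := phiLE_nonneg hφ (-6) (‖ξ - η‖ / max ‖ξ‖ ‖η‖)
  by_cases hne : 53 * ‖ξ - η‖ ≤ max ‖ξ‖ ‖η‖
  swap
  · have h1 : paraSym φ ξ η = 0 :=
      paraSym_eq_zero hφ ((le_max_right _ _).trans_lt (not_le.1 hne))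
    have h2 : paraSym φ η ξ = 0 := paraSym_eq_zero hφ (by
      rw [norm_sub_rev]; exact (le_max_left _ _).trans_lt (not_le.1 hne))
    simp only [sSym, h1, h2, mul_zero, Complex.ofReal_zero, sub_self, norm_zero]
    positivity
  rw [phiLE_ratio_eq_one hφ (norm_nonneg _) hne, mul_one]
  set a : Plane → ℝ := fun z => ((μ : ℤ) : ℝ) * (1 / 2) * (inner ℝ z (ξ - η) / ‖ξ - η‖) + 1 / 4 * ‖z‖
    with ha
  have hμ : |((μ : ℤ) : ℝ)| = 1 := by rcases units_int_cases μ with h | h <;> simp [h]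
  have ha1 : ∀ z, |a z| ≤ ‖z‖ := fun z => by
    refine (abs_add_le _ _).trans ?_
    rw [abs_mul, abs_mul, hμ, abs_mul, abs_norm]
    norm_num
    linarith [abs_inner_div_norm_le z (ξ - η), norm_nonneg z]
  have ha2 : ∀ z z', |a z - a z'| ≤ ‖z - z'‖ := fun z z' => by
    have e : a z - a z' = ((μ : ℤ) : ℝ) * (1 / 2) * (inner ℝ (z - z') (ξ - η) / ‖ξ - η‖)
        + 1 / 4 * (‖z‖ - ‖z'‖) := by
      rw [ha, inner_sub_left]; ring
    rw [e]
    refine (abs_add_le _ _).trans ?_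
    rw [abs_mul, abs_mul, hμ, abs_mul (1 / 4)]
    norm_num
    linarith [abs_inner_div_norm_le (z - z') (ξ - η), norm_nonneg (z - z'), abs_norm_sub_norm_le z z']
  have h := hK a (fun _ => 1) ha1 ha2 (by simp) (by simp) ξ η
  have e1 : sSym φ ε μ ξ η = Complex.I * ((ε * (1 * a ξ * paraSym φ ξ η) : ℝ) : ℂ) := by
    rw [sSym, ha, one_mul, mul_assoc]
  have e2 : sSym φ ε (-μ) η ξ = Complex.I * ((ε * (1 * a η * paraSym φ η ξ) : ℝ) : ℂ) := by
    rw [sSym, ha, one_mul, mul_assoc, ← neg_sub ξ η, norm_neg, inner_neg_right]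
    congr 2
    push_cast
    ring
  have e3 : ((jap ξ ^ (-N) * jap η ^ (-N) : ℝ) : ℂ) * (((jap ξ ^ (2 * N) : ℝ) : ℂ) * sSym φ ε μ ξ η
        - ((jap η ^ (2 * N) : ℝ) : ℂ) * sSym φ ε (-μ) η ξ)
      = Complex.I * ((jap ξ ^ (-N) * jap η ^ (-N) * (ε *
        (jap ξ ^ (2 * N) * (1 * a ξ * paraSym φ ξ η)
          - jap η ^ (2 * N) * (1 * a η * paraSym φ η ξ))) : ℝ) : ℂ) := by
    rw [e1, e2]; push_cast; ring
  have q1 := jap_rpow_pos (-N) ξ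
  have q2 := jap_rpow_pos (-N) η
  rw [e3, norm_I_mul_ofReal, abs_mul, abs_mul ε, abs_of_pos (mul_pos q1 q2), abs_of_pos hε]
  calc _ ≤ jap ξ ^ (-N) * jap η ^ (-N) * (ε * (K * (‖ξ - η‖ * (jap ξ ^ N * jap η ^ N)))) := by
        gcongr
    _ = K * (ε * ‖ξ - η‖) * ((jap ξ ^ (-N) * jap ξ ^ N) * (jap η ^ (-N) * jap η ^ N)) := by ring
    _ = _ := by
        rw [← Real.rpow_add (jap_pos ξ), ← Real.rpow_add (jap_pos η), neg_add_cancel,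
          Real.rpow_zero, Real.rpow_zero]
        ring

theorem norm_inv_smul_le (z : Plane) : ‖‖z‖⁻¹ • z‖ ≤ 1 := by
  rw [norm_smul, norm_inv, norm_norm]
  exact inv_mul_le_one

theorem norm_qSym (φ : ℝ → ℝ) (ε : ℝ) (μ ν : ℤˣ) (ξ η : Plane) :
    ‖qSym φ ε μ ν ξ η‖ = |ε / 8 * inner ℝ ξ (((ν : ℤ) : ℝ) • (‖η‖⁻¹ • η) - ‖ξ‖⁻¹ • ξ)
      * phiLE φ 5 (Real.sqrt ε * ‖η‖) * paraSym φ ξ η| := norm_I_mul_ofReal _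

theorem qSym_bound_aux {φ : ℝ → ℝ} (hφ : IsCutoff φ) {ε : ℝ} (hε : 0 < ε) (μ ν : ℤˣ) {ξ η : Plane}
    {A : ℝ} (hA : 0 ≤ A)
    (h : η ≠ 0 → |inner ℝ ξ (((ν : ℤ) : ℝ) • (‖η‖⁻¹ • η) - ‖ξ‖⁻¹ • ξ)| ≤ 2 * A) :
    ‖qSym φ ε μ ν ξ η‖ ≤ ε * A * phiLE φ 5 (Real.sqrt ε * ‖η‖) * phiLE φ (-6) (‖ξ - η‖ / ‖η‖) := by
  have h1 := phiLE_nonneg hφ 5 (Real.sqrt ε * ‖η‖)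
  have h2 := phiLE_nonneg hφ (-6) (‖ξ - η‖ / ‖η‖)
  rw [norm_qSym]
  by_cases hχ : paraSym φ ξ η = 0
  · rw [hχ, mul_zero, abs_zero]; positivity
  have h3 : 53 * ‖ξ - η‖ ≤ ‖η‖ := not_lt.1 fun h' => hχ (paraSym_eq_zero hφ h')
  have hη : η ≠ 0 := fun h' => hχ (by rw [h', paraSym_zero_right hφ])
  rw [phiLE_ratio_eq_one hφ (norm_nonneg _) h3, abs_mul, abs_mul, abs_mul, abs_of_nonneg h1,
    abs_of_pos (by positivity : 0 < ε / 8)]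
  calc _ ≤ ε / 8 * (2 * A) * phiLE φ 5 (Real.sqrt ε * ‖η‖) * 1 := by
        gcongr
        · exact h hη
        · exact abs_paraSym_le_one hφ ξ η
    _ ≤ _ := by
        have : 0 ≤ ε * A * phiLE φ 5 (Real.sqrt ε * ‖η‖) := by positivity
        linarith

theorem abs_inner_unit_le (ν : ℤˣ) (ξ η : Plane) :
    |inner ℝ ξ (((ν : ℤ) : ℝ) • (‖η‖⁻¹ • η) - ‖ξ‖⁻¹ • ξ)| ≤ 2 * ‖ξ‖ := by
  refine (abs_real_inner_le_norm _ _).trans ?_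
  have h1 := norm_inv_smul_le η
  have h2 := norm_inv_smul_le ξ
  have h3 : ‖((ν : ℤ) : ℝ) • (‖η‖⁻¹ • η) - ‖ξ‖⁻¹ • ξ‖ ≤ 2 := by
    refine (norm_sub_le _ _).trans ?_
    rw [norm_smul]
    have : ‖((ν : ℤ) : ℝ)‖ = 1 := by rcases units_int_cases ν with h | h <;> simp [h]
    rw [this]
    linarith
  nlinarith [norm_nonneg ξ]

theorem qSym_bound {φ : ℝ → ℝ} (hφ : IsCutoff φ) {ε : ℝ} (hε : 0 < ε) (μ ν : ℤˣ) (ξ η : Plane) :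
    ‖qSym φ ε μ ν ξ η‖
      ≤ ε * ‖ξ‖ * phiLE φ 5 (Real.sqrt ε * ‖η‖) * phiLE φ (-6) (‖ξ - η‖ / ‖η‖) :=
  qSym_bound_aux hφ hε μ ν (norm_nonneg _) fun _ => abs_inner_unit_le ν ξ η

/-- For `ν = +` the two unit vectors nearly cancel: `|ξ|` times their difference is `(|ξ|/|η|)η -
ξ`. For `ν = -` they add up, hence the weaker bound with `|ξ|`. -/
theorem qSym_one_bound {φ : ℝ → ℝ} (hφ : IsCutoff φ) {ε : ℝ} (hε : 0 < ε) (μ : ℤˣ) (ξ η : Plane) :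
    ‖qSym φ ε μ 1 ξ η‖
      ≤ ε * ‖ξ - η‖ * phiLE φ 5 (Real.sqrt ε * ‖η‖) * phiLE φ (-6) (‖ξ - η‖ / ‖η‖) := by
  refine qSym_bound_aux hφ hε μ 1 (norm_nonneg _) fun hη => ?_
  have e : ∀ z : Plane, |inner ℝ ξ z| ≤ ‖‖ξ‖ • z‖ := fun z => by
    rw [norm_smul, norm_norm]; exact abs_real_inner_le_norm _ _
  refine (e _).trans ?_
  rcases eq_or_ne ξ 0 with rfl | hξ
  · rw [norm_zero, zero_smul, norm_zero]; positivity
  · refine le_trans (le_of_eq ?_) (norm_mul_unit_sub_le hη)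
    congr 1
    rw [smul_sub, smul_smul ‖ξ‖ ‖ξ‖⁻¹, mul_inv_cancel₀ (norm_ne_zero_iff.2 hξ), one_smul]
    simp [smul_smul]

/-! ### The high-frequency inverse of `1 + εΔ` and the symbols of the remainder -/

section Symbols

variable {φ : ℝ → ℝ}

/-- The symbol of `(1 + εΔ)⁻¹ φ_{≥6}(√ε|D|)`. -/
noncomputable def mHi (φ : ℝ → ℝ) (ε : ℝ) (η : Plane) : ℝ :=
  phiGE φ 6 (Real.sqrt ε * ‖η‖) / (1 - ε * ‖η‖ ^ 2)

theorem ofReal_mHi (φ : ℝ → ℝ) (ε : ℝ) (η : Plane) :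
    ((mHi φ ε η : ℝ) : ℂ) = (phiGE φ 6 (Real.sqrt ε * ‖η‖) : ℂ) / lapSym ε η := by
  rw [mHi, lapSym, Complex.ofReal_div]

theorem phiGE_eq (φ : ℝ → ℝ) (x : ℝ) : phiGE φ 6 x = 1 - phiLE φ 5 x := by
  rw [phiGE]; norm_num

theorem phiGE_nonneg (hφ : IsCutoff φ) (x : ℝ) : 0 ≤ phiGE φ 6 x := by
  rw [phiGE_eq]; linarith [phiLE_le_one hφ 5 x]

theorem phiGE_le_one (hφ : IsCutoff φ) (x : ℝ) : phiGE φ 6 x ≤ 1 := by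
  rw [phiGE_eq]; linarith [phiLE_nonneg hφ 5 x]

theorem phiGE_eq_zero (hφ : IsCutoff φ) {x : ℝ} (h0 : 0 ≤ x) (hx : x ≤ 40) : phiGE φ 6 x = 0 := by
  rw [phiGE_eq, phiLE_eq_one hφ h0 (by norm_num; linarith), sub_self]

theorem measurable_mHi (hφ : IsCutoff φ) (ε : ℝ) : Measurable (mHi φ ε) := by
  unfold mHi phiGE
  refine Measurable.div (measurable_const.sub ((measurable_phiLE hφ _).comp ?_)) ?_ <;> fun_prop

theorem sq_sqrt_mul {ε : ℝ} (hε : 0 ≤ ε) (r : ℝ) : (Real.sqrt ε * r) ^ 2 = ε * r ^ 2 := by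
  rw [mul_pow, Real.sq_sqrt hε]

/-- The cut-off vanishes for `√ε|η| ≤ (5/4)·2⁵ = 40`. Beyond, `ε|η|² > 1600` is far from the zero of
`1 - ε|η|²`, so the quotient is comparable to `(1 + ε|η|²)⁻¹`. -/
theorem abs_mHi_le (hφ : IsCutoff φ) {ε : ℝ} (hε : 0 < ε) (η : Plane) :
    |mHi φ ε η| * (1 + ε * ‖η‖ ^ 2) ≤ 2 := by
  have h1 : 0 ≤ Real.sqrt ε * ‖η‖ := by positivity
  rcases le_or_gt (Real.sqrt ε * ‖η‖) 40 with h | h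
  · rw [mHi, phiGE_eq_zero hφ h1 h, zero_div, abs_zero, zero_mul]; norm_num
  · have h2 : 1600 < ε * ‖η‖ ^ 2 := by rw [← sq_sqrt_mul hε.le]; nlinarith
    rw [mHi, abs_div, abs_of_nonneg (phiGE_nonneg hφ _), abs_of_neg (by linarith : 1 - ε * ‖η‖ ^ 2 < 0),
      div_mul_eq_mul_div, div_le_iff₀ (by linarith)]
    have := phiGE_le_one hφ (Real.sqrt ε * ‖η‖)
    nlinarith

theorem abs_mHi_le_two (hφ : IsCutoff φ) {ε : ℝ} (hε : 0 < ε) (η : Plane) : |mHi φ ε η| ≤ 2 := by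
  have h := abs_mHi_le hφ hε η
  have : 0 ≤ |mHi φ ε η| * (ε * ‖η‖ ^ 2) := by positivity
  linarith

theorem abs_mHi_mul_sq_le (hφ : IsCutoff φ) {ε : ℝ} (hε : 0 < ε) (η : Plane) :
    |mHi φ ε η| * (ε * ‖η‖ ^ 2) ≤ 2 := by
  have h := abs_mHi_le hφ hε η
  have := abs_nonneg (mHi φ ε η)
  linarith

theorem abs_mHi_mul_le (hφ : IsCutoff φ) {ε : ℝ} (hε : 0 < ε) (hε1 : ε ≤ 1) (η : Plane) :
    |mHi φ ε η| * (ε * ‖η‖) ≤ 2 := by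
  have h := abs_mHi_le hφ hε η
  have h1 := abs_nonneg (mHi φ ε η)
  have h2 : ε * ‖η‖ ≤ 1 + ε * ‖η‖ ^ 2 := by nlinarith [sq_nonneg (‖η‖ - 1), sq_nonneg (‖η‖)]
  nlinarith

/-- A gain of two derivatives at the price `1/ε`. It serves only for the continuity of `highPara` on
`L²`, where `ε` is fixed; no estimate uniform in `ε` uses it. -/
theorem abs_mHi_le_jap (hφ : IsCutoff φ) {ε : ℝ} (hε : 0 < ε) (hε1 : ε ≤ 1) (η : Plane) :
    |mHi φ ε η| ≤ 2 / ε * jap η ^ (-2 : ℝ) := by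
  have h := abs_mHi_le hφ hε η
  have h1 := abs_nonneg (mHi φ ε η)
  have h2 : jap η ^ (-2 : ℝ) = 1 / jap η ^ 2 := by
    rw [Real.rpow_neg (jap_pos η).le, one_div]; norm_cast
  rw [h2, div_mul_div_comm, mul_one, jap_sq, le_div_iff₀ (by positivity)]
  nlinarith

/-- The defining property of the correction `B^ε`: applying `1 + εΔ` leaves the pure high-frequency
cut-off. It holds also where `1 - ε|η|² = 0`, because the cut-off vanishes there. -/
theorem mHi_mul_lap (hφ : IsCutoff φ) {ε : ℝ} (hε : 0 < ε) (η : Plane) :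
    mHi φ ε η * (1 - ε * ‖η‖ ^ 2) = 1 - phiLE φ 5 (Real.sqrt ε * ‖η‖) := by
  rw [← phiGE_eq]
  rcases le_or_gt (Real.sqrt ε * ‖η‖) 40 with h | h
  · rw [mHi, phiGE_eq_zero hφ (by positivity) h, zero_div, zero_mul]
  · have h2 : 1600 < ε * ‖η‖ ^ 2 := by rw [← sq_sqrt_mul hε.le]; nlinarith
    rw [mHi, div_mul_cancel₀]
    linarith

/-- The symbol of the remainder in the product `f g = T_f g + T_g f + R(f, g)`. -/
noncomputable def rhoSym (φ : ℝ → ℝ) (ξ η : Plane) : ℝ := 1 - paraSym φ ξ η - paraSym φ ξ (ξ - η)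

theorem abs_rhoSym_le_one (hφ : IsCutoff φ) (ξ η : Plane) : |rhoSym φ ξ η| ≤ 1 := by
  have h1 := paraSym_nonneg hφ ξ η
  have h2 := paraSym_nonneg hφ ξ (ξ - η)
  have h3 := paraSym_le_one hφ ξ η
  have h4 := paraSym_le_one hφ ξ (ξ - η)
  rw [rhoSym, abs_le]
  exact ⟨by linarith, by linarith⟩

theorem rhoSym_eq_zero (hφ : IsCutoff φ) {ξ η : Plane} (hη : η ≠ 0) (h : 154 * ‖ξ - η‖ ≤ ‖η‖) :
    rhoSym φ ξ η = 0 := by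
  rw [rhoSym, paraSym_eq_one hφ hη h, paraSym_eq_zero hφ]
  · ring
  · rw [sub_sub_cancel]
    have := norm_pos_iff.2 hη
    linarith

theorem rhoSym_eq_zero' (hφ : IsCutoff φ) {ξ η : Plane} (hη : ξ - η ≠ 0) (h : 154 * ‖η‖ ≤ ‖ξ - η‖) :
    rhoSym φ ξ η = 0 := by
  rw [rhoSym, paraSym_eq_one hφ hη (by rwa [sub_sub_cancel]), paraSym_eq_zero hφ]
  · ring
  · have := norm_pos_iff.2 hη
    linarith

/-- On the support of the symbol with `ξ ≠ 0`, `|η|` and `|ξ - η|` are within a factor `154`, so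
`|ξ|` is at most `155` times either of them: the `N` derivatives are charged to `η` and the
additional one to `ξ - η`. -/
theorem rhoSym_bound (hφ : IsCutoff φ) {N : ℝ} (hN : 0 ≤ N) (ξ η : Plane) :
    jap ξ ^ N * (‖ξ‖ * |rhoSym φ ξ η|) ≤ 155 ^ N * 155 * (jap (ξ - η) ^ (1 : ℝ) * jap η ^ N) := by
  have p1 := jap_rpow_pos N η
  have p2 := jap_rpow_pos N ξ
  have p3 := jap_pos (ξ - η)
  rw [Real.rpow_one]
  by_cases hρ : rhoSym φ ξ η = 0
  · rw [hρ, abs_zero, mul_zero, mul_zero]; positivity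
  by_cases h0 : ‖ξ‖ = 0
  · rw [h0, zero_mul, mul_zero]; positivity
  have h1 : ‖η‖ ≤ 154 * ‖ξ - η‖ := by
    by_contra hc
    refine hρ (rhoSym_eq_zero hφ ?_ (not_le.1 hc).le)
    rintro rfl
    rw [norm_zero] at hc
    exact hc (by positivity)
  have h2 : ‖ξ - η‖ ≤ 154 * ‖η‖ := by
    by_contra hc
    refine hρ (rhoSym_eq_zero' hφ ?_ (not_le.1 hc).le)
    intro h
    rw [h, norm_zero] at hc
    exact hc (by positivity)
  have h3 := norm_le_sub_add ξ η
  have h4 : ‖ξ‖ ≤ 155 * ‖η‖ := by linarith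
  have h5 : jap ξ ≤ 155 * jap η := by
    have h1 := jap_sq ξ
    have h2 := jap_sq η
    have h3 := one_le_jap η
    have h4' := norm_nonneg ξ
    refine jap_add_le.le_of_sq_le_sq ?_ (by linarith)
    nlinarith
  have h6 : jap ξ ^ N ≤ 155 ^ N * jap η ^ N := by
    rw [← Real.mul_rpow (by norm_num) (jap_pos η).le]
    exact Real.rpow_le_rpow (jap_pos ξ).le h5 hN
  have h7 : ‖ξ‖ ≤ 155 * jap (ξ - η) := by linarith [norm_le_jap (ξ - η)]
  calc _ ≤ (155 ^ N * jap η ^ N) * (155 * jap (ξ - η) * 1) := by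
        gcongr; exact abs_rhoSym_le_one hφ ξ η
    _ = _ := by ring

/-- On the support of `χ` the frequencies `ξ` and `η` are comparable, so the output weight is
charged to `η` with the factor `2^N`, and `t` only has to be estimated for nonzero comparable
frequencies. -/
theorem paraSym_mul_bound (hφ : IsCutoff φ) {N : ℝ} (hN : 0 ≤ N) {a r c : ℝ} (hc : 0 ≤ c)
    {t : Plane → Plane → ℝ}
    (h : ∀ ξ η, Near ξ η → η ≠ 0 → ξ ≠ 0 → |t ξ η| ≤ c * (jap (ξ - η) ^ a * jap η ^ r)) (ξ η : Plane) :
    jap ξ ^ N * |t ξ η * paraSym φ ξ η| ≤ 2 ^ N * c * (jap (ξ - η) ^ a * jap η ^ (N + r)) := by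
  have p1 := jap_rpow_pos (N + r) η
  have p2 := jap_rpow_pos N ξ
  have p3 := jap_rpow_pos a (ξ - η)
  have p4 := jap_rpow_pos r η
  have p5 := jap_rpow_pos N η
  by_cases hχ : paraSym φ ξ η = 0
  · rw [hχ, mul_zero, abs_zero, mul_zero]; positivity
  have hn := near_of_paraSym_ne hφ hχ
  have hη : η ≠ 0 := fun h' => hχ (by rw [h', paraSym_zero_right hφ])
  have hξ : ξ ≠ 0 := by
    rintro rfl
    have := hn.2
    rw [norm_zero, mul_zero] at this
    exact hη (norm_le_zero_iff.1 this)
  rw [abs_mul, Real.rpow_add (jap_pos η)]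
  calc _ ≤ (2 ^ N * jap η ^ N) * (c * (jap (ξ - η) ^ a * jap η ^ r) * 1) := by
        gcongr
        · exact hn.jap_rpow_le hN
        · exact h ξ η hn hη hξ
        · exact abs_paraSym_le_one hφ ξ η
    _ = _ := by ring

end Symbols

/-! ### The paraproduct on the Fourier side -/

section Para

variable {φ : ℝ → ℝ}

/-- The constant `(4π²)⁻¹` of the convolution theorem. -/
noncomputable def convC : ℂ := 1 / (4 * Real.pi ^ 2)

theorem measurable_ofReal_symbol {q : Plane → Plane → ℝ}
    (hq : Measurable fun p : Plane × Plane => q p.1 p.2) :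
    Measurable fun p : Plane × Plane => ((q p.1 p.2 : ℝ) : ℂ) := Complex.measurable_ofReal.comp hq

theorem norm_mult_le_one {m : Plane → ℝ} (h0 : ∀ ξ, 0 ≤ m ξ) (h1 : ∀ ξ, m ξ ≤ 1) (ξ : Plane) :
    ‖((m ξ : ℝ) : ℂ)‖ ≤ 1 := by
  rw [Complex.norm_real, Real.norm_of_nonneg (h0 ξ)]; exact h1 ξ

theorem hat_PLE (hφ : IsCutoff φ) (k : ℤ) (f : L2) :
    hat (PLE φ k f) =ᵐ[volume] fun ξ => (phiLE φ k ‖ξ‖ : ℂ) * hat f ξ :=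
  hat_mult (memLp_mult (Complex.measurable_ofReal.comp
    ((measurable_phiLE hφ k).comp measurable_norm))
    (norm_mult_le_one (fun _ => phiLE_nonneg hφ k _) fun _ => phiLE_le_one hφ k _) f)

theorem hat_P (hφ : IsCutoff φ) (k : ℤ) (f : L2) :
    hat (P φ k f) =ᵐ[volume] fun ξ => (phi φ k ‖ξ‖ : ℂ) * hat f ξ :=
  hat_mult (memLp_mult (Complex.measurable_ofReal.comp
    ((measurable_phi hφ k).comp measurable_norm))
    (norm_mult_le_one (fun _ => phi_nonneg hφ k (norm_nonneg _)) fun _ => phi_le_one hφ k _) f)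

theorem sNorm_zero_hat_ne_top (f : L2) : sNorm 0 (hat f) ≠ ⊤ := by
  rw [sNorm_zero]; exact (memLp_hat f).2.ne

theorem wNorm_zero_ne_top {f : L2} (h : Integrable (hat f) volume) : wNorm 0 (hat f) ≠ ⊤ := by
  rw [wNorm_zero]; exact h.2.ne

theorem integrable_hat_PLE (hφ : IsCutoff φ) (k : ℤ) {f : L2} (hf : Integrable (hat f) volume) :
    Integrable (hat (PLE φ k f)) volume := by
  refine (hf.bdd_mul (c := 1) ?_ (ae_of_all _ ?_)).congr (hat_PLE hφ k f).symm
  · exact (Complex.measurable_ofReal.comp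
      ((measurable_phiLE hφ k).comp measurable_norm)).aestronglyMeasurable
  · exact norm_mult_le_one (fun _ => phiLE_nonneg hφ k _) fun _ => phiLE_le_one hφ k _

theorem integrable_of_sNorm_two {F : Plane → ℂ} (hF : AEStronglyMeasurable F volume)
    (h : sNorm 2 F ≠ ⊤) : Integrable F volume := by
  refine integrable_of_wNorm le_rfl hF (ne_top_of_le_ne_top ?_ (wNorm_le_sNorm 0 hF))
  rw [zero_add]
  exact ENNReal.mul_ne_top ENNReal.ofReal_ne_top h

theorem integrable_hat_P (hφ : IsCutoff φ) (k : ℤ) (f : L2) :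
    Integrable (hat (P φ k f)) volume := by
  refine integrable_of_sNorm_two (aesm_hat _) ?_
  rw [sNorm_congr (hat_P hφ k f)]
  refine ne_top_of_le_ne_top ?_ (sNorm_mul_le (r := 0) (C := 1 + (3 / 2 * 2 ^ k) ^ 2) fun ξ => ?_)
  · exact ENNReal.mul_ne_top ENNReal.ofReal_ne_top (sNorm_zero_hat_ne_top f)
  · rw [Real.rpow_zero, mul_one, Complex.norm_real, Real.norm_of_nonneg (phi_nonneg hφ k (norm_nonneg _)),
      Real.rpow_two, jap_sq]
    rcases le_or_gt ‖ξ‖ (3 / 2 * 2 ^ k) with h | h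
    · have h1 : ‖ξ‖ ^ 2 ≤ (3 / 2 * 2 ^ k) ^ 2 := by gcongr
      have h2 := phi_le_one hφ k ‖ξ‖
      have h3 := phi_nonneg hφ k (norm_nonneg ξ)
      nlinarith [sq_nonneg ‖ξ‖]
    · rw [phi_eq_zero_of_lt hφ h, mul_zero]; positivity

/-- The symbol of the `j`-th term of the paraproduct. -/
noncomputable def termSym (φ : ℝ → ℝ) (j : ℤ) (ξ η : Plane) : ℝ :=
  phiLE φ (j - 7) ‖ξ - η‖ * phi φ j ‖η‖

theorem termSym_nonneg (hφ : IsCutoff φ) (j : ℤ) (ξ η : Plane) : 0 ≤ termSym φ j ξ η :=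
  mul_nonneg (phiLE_nonneg hφ _ _) (phi_nonneg hφ j (norm_nonneg _))

theorem termSym_le (hφ : IsCutoff φ) (j : ℤ) (ξ η : Plane) : termSym φ j ξ η ≤ phi φ j ‖η‖ :=
  mul_le_of_le_one_left (phi_nonneg hφ j (norm_nonneg _)) (phiLE_le_one hφ _ _)

theorem hat_paraTerm (hφ : IsCutoff φ) {f : L2} (hf : Integrable (hat f) volume) (g : L2) (j : ℤ) :
    hat (paraTerm φ f g j) =ᵐ[volume]
      fun ξ => convC * bil (fun ξ η => (termSym φ j ξ η : ℂ)) (hat f) (hat g) ξ := by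
  filter_upwards [hat_prod (integrable_hat_PLE hφ (j - 7) hf) (integrable_hat_P hφ j g)] with ξ hξ
  rw [paraTerm, hξ, convC]
  congr 1
  refine integral_congr_ae ?_
  filter_upwards [ae_sub_left (hat_PLE hφ (j - 7) f) ξ, hat_P hφ j g] with η h1 h2
  rw [h1, h2, termSym]
  push_cast
  ring

theorem zero_symbol_bound {q : Plane → Plane → ℝ} {C : ℝ} (h : ∀ ξ η, |q ξ η| ≤ C) (ξ η : Plane) :
    jap ξ ^ (0 : ℝ) * ‖((q ξ η : ℝ) : ℂ)‖ ≤ C * (jap (ξ - η) ^ (0 : ℝ) * jap η ^ (0 : ℝ)) := by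
  simpa using h ξ η

theorem norm_convC_mul_enorm (F : Plane → ℂ) (c : ℂ) :
    eLpNorm (fun ξ => c * F ξ) 2 volume = ‖c‖ₑ * eLpNorm F 2 volume := eLpNorm_const_smul c F 2 volume

/-- Each omitted term is at most `φ_j(|η|)`, and all these sum to `1` for `η ≠ 0`. The bound depends
on `η` alone, so it can be absorbed into the transform of `g`. -/
theorem sum_termSym_sub_le (hφ : IsCutoff φ) (s : Finset ℤ) (ξ η : Plane) :
    |∑ j ∈ s, termSym φ j ξ η - paraSym φ ξ η| ≤ 1 - ∑ j ∈ s, phi φ j ‖η‖ := by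
  rcases eq_or_ne η 0 with rfl | hη
  · simp [termSym, phi_zero hφ, paraSym_zero_right hφ]
  obtain ⟨J, h1, h2⟩ := exists_dyadic (norm_pos_iff.2 hη)
  have hs : s ⊆ {J, J + 1} ∪ s := Finset.subset_union_right
  have e1 := paraSym_eq_sum hφ ξ h1 h2 (s := {J, J + 1} ∪ s) Finset.subset_union_left
  have e2 := sum_phi hφ h1 h2 (s := {J, J + 1} ∪ s) Finset.subset_union_left
  rw [e1, ← e2, ← Finset.sum_sdiff hs, ← Finset.sum_sdiff hs (f := fun j => phi φ j ‖η‖)]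
  change |∑ j ∈ s, termSym φ j ξ η - (∑ j ∈ _ \ s, termSym φ j ξ η + ∑ j ∈ s, termSym φ j ξ η)| ≤ _
  rw [sub_add_cancel_right, abs_neg, add_sub_cancel_right,
    abs_of_nonneg (Finset.sum_nonneg fun j _ => termSym_nonneg hφ j ξ η)]
  exact Finset.sum_le_sum fun j _ => termSym_le hφ j ξ η

theorem tendsto_high_part (hφ : IsCutoff φ) (g : L2) :
    Tendsto (fun s : Finset ℤ => eLpNorm
      (fun η : Plane => ((1 - ∑ j ∈ s, phi φ j ‖η‖ : ℝ) : ℂ) * hat g η) 2 volume) atTop (𝓝 0) := by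
  have hbd : ∀ (s : Finset ℤ) (η : Plane), ‖((1 - ∑ j ∈ s, phi φ j ‖η‖ : ℝ) : ℂ)‖ ≤ 1 := fun s η => by
    have h1 := sum_phi_le_one hφ (norm_nonneg η) s
    have h2 : 0 ≤ ∑ j ∈ s, phi φ j ‖η‖ := Finset.sum_nonneg fun j _ => phi_nonneg hφ j (norm_nonneg _)
    rw [Complex.norm_real, Real.norm_of_nonneg (by linarith)]
    linarith
  have hmeas : ∀ s : Finset ℤ, AEStronglyMeasurable
      (fun η : Plane => ((1 - ∑ j ∈ s, phi φ j ‖η‖ : ℝ) : ℂ) * hat g η) volume := fun s =>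
    (Complex.measurable_ofReal.comp (measurable_const.sub (Finset.measurable_fun_sum s fun j _ =>
      (measurable_phi hφ j).comp measurable_norm))).aestronglyMeasurable.mul (aesm_hat g)
  have h : Tendsto (fun s : Finset ℤ => ∫⁻ η : Plane,
      ‖((1 - ∑ j ∈ s, phi φ j ‖η‖ : ℝ) : ℂ) * hat g η‖ₑ ^ 2) atTop (𝓝 (∫⁻ _ : Plane, 0)) := by
    refine tendsto_lintegral_filter_of_dominated_convergence' (fun η => ‖hat g η‖ₑ ^ 2)
      (Eventually.of_forall fun s => (hmeas s).enorm.pow_const 2)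
      (Eventually.of_forall fun s => ae_of_all _ fun η => ?_) ?_ ?_
    · rw [enorm_mul]
      gcongr
      refine mul_le_of_le_one_left (by positivity) ?_
      rw [← ofReal_norm]
      exact ENNReal.ofReal_le_one.2 (hbd s η)
    · rw [← eLpNorm_two_sq]
      exact ENNReal.pow_ne_top (memLp_hat g).2.ne
    · have h0 : ∀ᵐ η : Plane, η ≠ 0 := by
        simp [ae_iff]
      filter_upwards [h0] with η hη
      obtain ⟨J, h1, h2⟩ := exists_dyadic (norm_pos_iff.2 hη)
      refine tendsto_const_nhds.congr' ?_
      filter_upwards [eventually_ge_atTop ({J, J + 1} : Finset ℤ)] with s hs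
      rw [sum_phi hφ h1 h2 hs]
      simp
  simp only [lintegral_zero] at h
  have h2 := (ENNReal.continuous_rpow_const (y := 1 / 2)).continuousAt.tendsto.comp h
  rw [ENNReal.zero_rpow_of_pos (by norm_num)] at h2
  refine h2.congr fun s => ?_
  simp only [Function.comp]
  rw [← eLpNorm_two_sq, ← ENNReal.rpow_natCast, ← ENNReal.rpow_mul]
  norm_num

/-- The error of a partial sum is dominated by the convolution of `|f̂| ∈ L¹` with the part of `|ĝ|`
not captured by the scales in `s`. Young's inequality and `tendsto_high_part` make it tend to zero
along all finite sets, which is unconditional convergence. -/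
theorem hasSum_paraTerm (hφ : IsCutoff φ) {f : L2} (hf : Integrable (hat f) volume) (g : L2) :
    ∃ h : L2, HasSum (paraTerm φ f g) h ∧ hat h =ᵐ[volume]
      fun ξ => convC * bil (fun ξ η => (paraSym φ ξ η : ℂ)) (hat f) (hat g) ξ := by
  have hq := measurable_ofReal_symbol (measurable_paraSym hφ)
  have hχ := zero_symbol_bound (abs_paraSym_le_one hφ)
  have hw := wNorm_zero_ne_top hf
  have hs := sNorm_zero_hat_ne_top g
  have hmem := (memLp_bil hq le_rfl hχ (aesm_hat f) (aesm_hat g) hw hs).const_mul convC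
  refine ⟨ofHat _ hmem, ?_, hat_ofHat hmem⟩
  set h := ofHat _ hmem with hh
  have hkey : ∀ s : Finset ℤ, ENNReal.ofReal (2 * Real.pi) * edist (∑ j ∈ s, paraTerm φ f g j) h
      ≤ (‖convC‖ₑ * wNorm 0 (hat f)) * eLpNorm
      (fun η : Plane => ((1 - ∑ j ∈ s, phi φ j ‖η‖ : ℝ) : ℂ) * hat g η) 2 volume := by
    intro s
    set G : Plane → ℂ := fun η : Plane => ((1 - ∑ j ∈ s, phi φ j ‖η‖ : ℝ) : ℂ) * hat g η with hG
    have hGm : AEStronglyMeasurable G volume :=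
      (Complex.measurable_ofReal.comp (measurable_const.sub (Finset.measurable_fun_sum s fun j _ =>
        (measurable_phi hφ j).comp measurable_norm))).aestronglyMeasurable.mul (aesm_hat g)
    have hterm : ∀ j, ∀ᵐ ξ : Plane, Integrable
        (fun η => (termSym φ j ξ η : ℂ) * hat f (ξ - η) * hat g η) volume := fun j =>
      integrable_bil (measurable_ofReal_symbol (measurable_paraTermSym hφ j))
        (zero_symbol_bound (C := 1) (fun ξ η => by
          rw [abs_of_nonneg (termSym_nonneg hφ j ξ η)]
          exact (termSym_le hφ j ξ η).trans (phi_le_one hφ _ _))) (aesm_hat f) (aesm_hat g) hw hs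
    rw [edist_eq_enorm_sub, enorm_eq_hat]
    have e : hat (∑ j ∈ s, paraTerm φ f g j - h) =ᵐ[volume] fun ξ => convC *
        bil (fun ξ η => ((∑ j ∈ s, termSym φ j ξ η - paraSym φ ξ η : ℝ) : ℂ)) (hat f) (hat g) ξ := by
      filter_upwards [hat_sub (∑ j ∈ s, paraTerm φ f g j) h, hat_sum s (paraTerm φ f g),
        hat_ofHat hmem, ae_all_iff.2 fun j => hat_paraTerm hφ hf g j, ae_all_iff.2 hterm,
        integrable_bil hq hχ (aesm_hat f) (aesm_hat g) hw hs] with ξ h1 h2 h3 h4 h5 h6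
      rw [h1, h2, hh, h3, Finset.sum_congr rfl fun j _ => h4 j, ← Finset.mul_sum, ← mul_sub]
      congr 1
      simp only [bil]
      rw [← integral_finsetSum s fun j _ => h5 j,
        ← integral_sub (integrable_finsetSum s fun j _ => h5 j) h6]
      refine integral_congr_ae (ae_of_all _ fun η => ?_)
      simp only
      push_cast
      rw [sub_mul, sub_mul, Finset.sum_mul, Finset.sum_mul]
    rw [eLpNorm_congr_ae e, norm_convC_mul_enorm, mul_assoc]
    gcongr
    refine (eLpNorm_mono_enorm fun ξ => (?_ : _ ≤ ‖conv (fun η => ‖hat f η‖ₑ) (fun η => ‖G η‖ₑ) ξ‖ₑ)).trans ?_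
    · rw [enorm_eq_self, bil, conv]
      refine (enorm_integral_le_lintegral_enorm _).trans (lintegral_mono fun η => ?_)
      simp only [hG, enorm_mul]
      rw [mul_comm ‖((∑ j ∈ s, termSym φ j ξ η - paraSym φ ξ η : ℝ) : ℂ)‖ₑ, mul_assoc]
      gcongr
      rw [← ofReal_norm, ← ofReal_norm, Complex.norm_real, Complex.norm_real, Real.norm_eq_abs,
        Real.norm_eq_abs]
      exact ENNReal.ofReal_le_ofReal ((sum_termSym_sub_le hφ s ξ η).trans (le_abs_self _))
    · refine (eLpNorm_conv_le (aesm_hat f).enorm hGm.enorm).trans (le_of_eq ?_)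
      rw [wNorm_zero]
      rw [eLpNorm_congr_enorm_ae (ae_of_all _ fun ξ => enorm_eq_self _)]
  have hlim := ENNReal.Tendsto.const_mul (a := ‖convC‖ₑ * wNorm 0 (hat f)) (tendsto_high_part hφ g)
    (Or.inr (ENNReal.mul_ne_top enorm_ne_top hw))
  rw [mul_zero] at hlim
  have h1 := tendsto_of_tendsto_of_tendsto_of_le_of_le tendsto_const_nhds hlim
    (fun _ => zero_le) hkey
  have h2 : (ENNReal.ofReal (2 * Real.pi)) ≠ 0 := by simpa using Real.pi_pos
  have h3 := ENNReal.Tendsto.const_mul (a := (ENNReal.ofReal (2 * Real.pi))⁻¹) h1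
    (Or.inr (ENNReal.inv_ne_top.2 h2))
  rw [HasSum, SummationFilter.unconditional_filter, tendsto_iff_edist_tendsto_0]
  rw [mul_zero] at h3
  refine h3.congr fun s => ?_
  rw [← mul_assoc, ENNReal.inv_mul_cancel h2 ENNReal.ofReal_ne_top, one_mul]

theorem summable_paraTerm (hφ : IsCutoff φ) {f : L2} (hf : Integrable (hat f) volume) (g : L2) :
    Summable (paraTerm φ f g) := (hasSum_paraTerm hφ hf g).choose_spec.1.summable

theorem hat_para (hφ : IsCutoff φ) {f : L2} (hf : Integrable (hat f) volume) (g : L2) :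
    hat (para φ f g) =ᵐ[volume]
      fun ξ => convC * bil (fun ξ η => (paraSym φ ξ η : ℂ)) (hat f) (hat g) ξ := by
  obtain ⟨h, h1, h2⟩ := hasSum_paraTerm hφ hf g
  rwa [para, h1.tsum_eq]

/-! ### The bilinear operator `B^ε` as a bounded bilinear map on `L²` -/

/-- The symbol of `T_f (1 + εΔ)⁻¹ φ_{≥6}(√ε|D|) g`. -/
noncomputable def bSym (φ : ℝ → ℝ) (ε : ℝ) (ξ η : Plane) : ℂ := ((paraSym φ ξ η * mHi φ ε η : ℝ) : ℂ)

theorem measurable_bSym (hφ : IsCutoff φ) (ε : ℝ) :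
    Measurable fun p : Plane × Plane => bSym φ ε p.1 p.2 :=
  measurable_ofReal_symbol (q := fun ξ η => paraSym φ ξ η * mHi φ ε η)
    ((measurable_paraSym hφ).mul ((measurable_mHi hφ ε).comp measurable_snd))

/-- The usual roles are exchanged: the high-frequency factor `g` carries the decay `⟨·⟩⁻²` and goes
into weighted `L¹`, which costs exactly these two derivatives. Thus no regularity beyond `L²` is
needed for either factor. -/
theorem bSym_swap_bound (hφ : IsCutoff φ) {ε : ℝ} (hε : 0 < ε) (hε1 : ε ≤ 1) (ξ η : Plane) :
    jap ξ ^ (0 : ℝ) * ‖bSym φ ε ξ (ξ - η)‖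
      ≤ 2 / ε * (jap (ξ - η) ^ (-2 : ℝ) * jap η ^ (0 : ℝ)) := by
  rw [Real.rpow_zero, one_mul, Real.rpow_zero, mul_one, bSym, Complex.norm_real, Real.norm_eq_abs,
    abs_mul]
  calc _ ≤ 1 * (2 / ε * jap (ξ - η) ^ (-2 : ℝ)) := by
        gcongr
        · exact abs_paraSym_le_one hφ _ _
        · exact abs_mHi_le_jap hφ hε hε1 _
    _ = _ := one_mul _

theorem measurable_swap {q : Plane → Plane → ℂ} (hq : Measurable fun p : Plane × Plane => q p.1 p.2) :
    Measurable fun p : Plane × Plane => q p.1 (p.1 - p.2) :=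
  hq.comp (measurable_fst.prodMk (measurable_fst.sub measurable_snd))

theorem wNorm_neg_two_ne_top (g : L2) : wNorm (-2) (hat g) ≠ ⊤ := by
  refine ne_top_of_le_ne_top ?_ (wNorm_le_sNorm (-2) (aesm_hat g))
  rw [neg_add_cancel]
  exact ENNReal.mul_ne_top ENNReal.ofReal_ne_top (sNorm_zero_hat_ne_top g)

theorem integrable_bSym (hφ : IsCutoff φ) {ε : ℝ} (hε : 0 < ε) (hε1 : ε ≤ 1) (f g : L2) :
    ∀ᵐ ξ : Plane, Integrable (fun η => bSym φ ε ξ η * hat f (ξ - η) * hat g η) volume := by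
  filter_upwards [integrable_bil (measurable_swap (measurable_bSym hφ ε)) (bSym_swap_bound hφ hε hε1)
    (aesm_hat g) (aesm_hat f) (wNorm_neg_two_ne_top g) (sNorm_zero_hat_ne_top f)] with ξ hξ
  refine (hξ.comp_sub_left ξ).congr (ae_of_all _ fun η => ?_)
  simp only [sub_sub_cancel]
  ring

theorem bil_bSym_swap (φ : ℝ → ℝ) (ε : ℝ) (f g : L2) :
    bil (bSym φ ε) (hat f) (hat g) = bil (fun ξ η => bSym φ ε ξ (ξ - η)) (hat g) (hat f) :=
  funext fun ξ => bil_swap _ _ _ ξ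

theorem memLp_bSym (hφ : IsCutoff φ) {ε : ℝ} (hε : 0 < ε) (hε1 : ε ≤ 1) (f g : L2) :
    MemLp (fun ξ => convC * bil (bSym φ ε) (hat f) (hat g) ξ) 2 volume := by
  rw [bil_bSym_swap]
  exact (memLp_bil (measurable_swap (measurable_bSym hφ ε)) le_rfl (bSym_swap_bound hφ hε hε1)
    (aesm_hat g) (aesm_hat f) (wNorm_neg_two_ne_top g) (sNorm_zero_hat_ne_top f)).const_mul convC

/-- The bounded bilinear map `T_f (1 + εΔ)⁻¹ φ_{≥6}(√ε|D|) g` on `L² × L²`. -/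
noncomputable def highPara (hφ : IsCutoff φ) {ε : ℝ} (hε : 0 < ε) (hε1 : ε ≤ 1) (f g : L2) : L2 :=
  ofHat _ (memLp_bSym hφ hε hε1 f g)

theorem hat_highPara (hφ : IsCutoff φ) {ε : ℝ} (hε : 0 < ε) (hε1 : ε ≤ 1) (f g : L2) :
    hat (highPara hφ hε hε1 f g) =ᵐ[volume] fun ξ => convC * bil (bSym φ ε) (hat f) (hat g) ξ :=
  hat_ofHat _

theorem norm_highPara_le (hφ : IsCutoff φ) {ε : ℝ} (hε : 0 < ε) (hε1 : ε ≤ 1) (f g : L2) :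
    ‖highPara hφ hε hε1 f g‖ ≤ ‖convC‖ * (2 / ε) * embC * (2 * Real.pi) * ‖f‖ * ‖g‖ := by
  have h1 : eLpNorm (hat (highPara hφ hε hε1 f g)) 2 volume
      ≤ ENNReal.ofReal (‖convC‖ * (2 / ε) * embC) * (eLpNorm (hat g) 2 volume * eLpNorm (hat f) 2 volume) := by
    rw [eLpNorm_congr_ae (hat_highPara hφ hε hε1 f g), norm_convC_mul_enorm, bil_bSym_swap, ← sNorm_zero,
      ENNReal.ofReal_mul (by positivity), ENNReal.ofReal_mul (by positivity), ofReal_norm]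
    have h2 := sNorm_bil_le (bSym_swap_bound hφ hε hε1) (aesm_hat g) (aesm_hat f)
    have h3 := wNorm_le_sNorm (-2) (aesm_hat g)
    rw [neg_add_cancel] at h3
    simp only [← sNorm_zero]
    calc _ ≤ ‖convC‖ₑ * (ENNReal.ofReal (2 / ε) * ((ENNReal.ofReal embC * sNorm 0 (hat g)) * sNorm 0 (hat f))) := by
          gcongr
          exact h2.trans (by gcongr)
      _ = _ := by ring
  have h2 := ENNReal.toReal_mono (by
    have := (memLp_hat f).2.ne
    have := (memLp_hat g).2.ne
    finiteness) h1
  have hc := embC_nonneg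
  rw [ENNReal.toReal_mul, ENNReal.toReal_mul, ENNReal.toReal_ofReal (by positivity), ← norm_eq_hat,
    ← norm_eq_hat, ← norm_eq_hat] at h2
  have := two_pi_pos
  refine le_of_mul_le_mul_left (h2.trans (le_of_eq ?_)) two_pi_pos
  ring

theorem highPara_add_left (hφ : IsCutoff φ) {ε : ℝ} (hε : 0 < ε) (hε1 : ε ≤ 1) (f f' g : L2) :
    highPara hφ hε hε1 (f + f') g = highPara hφ hε hε1 f g + highPara hφ hε hε1 f' g := by
  refine hat_ext ?_
  filter_upwards [hat_highPara hφ hε hε1 (f + f') g, hat_highPara hφ hε hε1 f g,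
    hat_highPara hφ hε hε1 f' g, hat_add (highPara hφ hε hε1 f g) (highPara hφ hε hε1 f' g),
    integrable_bSym hφ hε hε1 f g, integrable_bSym hφ hε hε1 f' g] with ξ h1 h2 h3 h4 h5 h6
  rw [h1, h4, h2, h3, bil_congr_ae (hat_add f f') (ae_eq_refl _), ← mul_add]
  simp only [bil]
  rw [← integral_add h5 h6]
  congr 2; ext η; ring

theorem highPara_add_right (hφ : IsCutoff φ) {ε : ℝ} (hε : 0 < ε) (hε1 : ε ≤ 1) (f g g' : L2) :
    highPara hφ hε hε1 f (g + g') = highPara hφ hε hε1 f g + highPara hφ hε hε1 f g' := by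
  refine hat_ext ?_
  filter_upwards [hat_highPara hφ hε hε1 f (g + g'), hat_highPara hφ hε hε1 f g,
    hat_highPara hφ hε hε1 f g', hat_add (highPara hφ hε hε1 f g) (highPara hφ hε hε1 f g'),
    integrable_bSym hφ hε hε1 f g, integrable_bSym hφ hε hε1 f g'] with ξ h1 h2 h3 h4 h5 h6
  rw [h1, h4, h2, h3, bil_congr_ae (ae_eq_refl _) (hat_add g g'), ← mul_add]
  simp only [bil]
  rw [← integral_add h5 h6]
  congr 2; ext η; ring

theorem highPara_smul_left (hφ : IsCutoff φ) {ε : ℝ} (hε : 0 < ε) (hε1 : ε ≤ 1) (c : ℂ) (f g : L2) :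
    highPara hφ hε hε1 (c • f) g = c • highPara hφ hε hε1 f g := by
  refine hat_ext ?_
  filter_upwards [hat_highPara hφ hε hε1 (c • f) g, hat_highPara hφ hε hε1 f g,
    hat_smul c (highPara hφ hε hε1 f g)] with ξ h1 h2 h3
  rw [h1, h3, h2, bil_congr_ae (hat_smul c f) (ae_eq_refl _), mul_left_comm]
  simp only [bil]
  rw [← integral_const_mul c]
  congr 1
  refine integral_congr_ae (ae_of_all _ fun η => ?_)
  simp only
  ring

theorem highPara_smul_right (hφ : IsCutoff φ) {ε : ℝ} (hε : 0 < ε) (hε1 : ε ≤ 1) (c : ℂ) (f g : L2) :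
    highPara hφ hε hε1 f (c • g) = c • highPara hφ hε hε1 f g := by
  refine hat_ext ?_
  filter_upwards [hat_highPara hφ hε hε1 f (c • g), hat_highPara hφ hε hε1 f g,
    hat_smul c (highPara hφ hε hε1 f g)] with ξ h1 h2 h3
  rw [h1, h3, h2, bil_congr_ae (ae_eq_refl _) (hat_smul c g), mul_left_comm]
  simp only [bil]
  rw [← integral_const_mul c]
  congr 1
  refine integral_congr_ae (ae_of_all _ fun η => ?_)
  simp only
  ring

theorem isBoundedBilinearMap_highPara (hφ : IsCutoff φ) {ε : ℝ} (hε : 0 < ε) (hε1 : ε ≤ 1) :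
    IsBoundedBilinearMap ℝ fun p : L2 × L2 => highPara hφ hε hε1 p.1 p.2 where
  add_left := highPara_add_left hφ hε hε1
  add_right := highPara_add_right hφ hε hε1
  smul_left c f g := by
    have := highPara_smul_left hφ hε hε1 (c : ℂ) f g
    rwa [Complex.coe_smul, Complex.coe_smul] at this
  smul_right c f g := by
    have := highPara_smul_right hφ hε hε1 (c : ℂ) f g
    rwa [Complex.coe_smul, Complex.coe_smul] at this
  bound := by
    have h0 : 0 ≤ ‖convC‖ * (2 / ε) * embC * (2 * Real.pi) := by
      have := embC_nonneg
      have := Real.pi_pos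
      positivity
    -- The added `1` only secures strict positivity of the constant.
    refine ⟨‖convC‖ * (2 / ε) * embC * (2 * Real.pi) + 1, by linarith, fun f g => ?_⟩
    refine (norm_highPara_le hφ hε hε1 f g).trans ?_
    gcongr
    linarith

theorem memLp_mHi (hφ : IsCutoff φ) {ε : ℝ} (hε : 0 < ε) (g : L2) :
    MemLp (fun ξ => ((mHi φ ε ξ : ℝ) : ℂ) * hat g ξ) 2 volume :=
  memLp_mult (Complex.measurable_ofReal.comp (measurable_mHi hφ ε)) (C := 2) (fun ξ => by
    rw [Function.comp, Complex.norm_real, Real.norm_eq_abs]; exact abs_mHi_le_two hφ hε ξ) g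

theorem hat_highInv (hφ : IsCutoff φ) {ε : ℝ} (hε : 0 < ε) (g : Fin 2 → L2) (k : Fin 2) :
    hat (highInv φ ε g k) =ᵐ[volume] fun ξ => ((mHi φ ε ξ : ℝ) : ℂ) * hat (g k) ξ := by
  have h := hat_mult (memLp_mHi hφ hε (g k))
  simpa only [highInv, ofReal_mHi] using h

theorem para_highInv (hφ : IsCutoff φ) {ε : ℝ} (hε : 0 < ε) (hε1 : ε ≤ 1) {f : L2}
    (hf : Integrable (hat f) volume) (g : Fin 2 → L2) (k : Fin 2) :
    para φ f (highInv φ ε g k) = highPara hφ hε hε1 f (g k) := by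
  refine hat_ext ?_
  filter_upwards [hat_para hφ hf (highInv φ ε g k), hat_highPara hφ hε hε1 f (g k)] with ξ h1 h2
  rw [h1, h2]
  congr 1
  refine integral_congr_ae ?_
  filter_upwards [hat_highInv hφ hε g k] with η h3
  rw [h3, bSym]
  push_cast
  ring

end Para

/-! ### The unknowns at a fixed time -/

/-- The values of a solution at a fixed time: real-valued, in `H^N`, with a curl-free velocity. -/
structure IsProfile (φ : ℝ → ℝ) (ε N : ℝ) (ζ : L2) (v : Fin 2 → L2) : Prop where
  cutoff : IsCutoff φ
  pos : 0 < ε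
  le_one : ε ≤ 1
  five_le : 5 ≤ N
  mem_zeta : MemH N ζ
  mem_v : ∀ k, MemH N (v k)
  real_zeta : IsRealValued ζ
  real_v : ∀ k, IsRealValued (v k)
  curl_free : deriv 0 (v 1) = deriv 1 (v 0)

/-- The Fourier transform `F` is that of a real-valued function. -/
def HatReal (F : Plane → ℂ) : Prop := ∀ᵐ ξ : Plane, F (-ξ) = (starRingEnd ℂ) (F ξ)

theorem wNorm_ne_top {a s : ℝ} (h : a + 2 ≤ s) {F : Plane → ℂ} (hF : AEStronglyMeasurable F volume)
    (hs : sNorm s F ≠ ⊤) : wNorm a F ≠ ⊤ :=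
  ne_top_of_le_ne_top (ENNReal.mul_ne_top ENNReal.ofReal_ne_top
    (ne_top_of_le_ne_top hs (sNorm_mono h F))) (wNorm_le_sNorm a hF)

theorem MemH.sNorm_ne_top {s r : ℝ} {f : L2} (h : MemH s f) (hr : r ≤ s) : sNorm r (hat f) ≠ ⊤ :=
  ne_top_of_le_ne_top (memH_iff.1 h) (sNorm_mono hr _)

theorem MemH.mono {s r : ℝ} {f : L2} (h : MemH s f) (hr : r ≤ s) : MemH r f :=
  memH_iff.2 (h.sNorm_ne_top hr)

theorem MemH.wNorm_ne_top {a s : ℝ} {f : L2} (h : MemH s f) (hr : a + 2 ≤ s) :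
    wNorm a (hat f) ≠ ⊤ := Bsq.wNorm_ne_top hr (aesm_hat f) (memH_iff.1 h)

theorem MemH.integrable {s : ℝ} {f : L2} (h : MemH s f) (hs : 2 ≤ s) : Integrable (hat f) volume :=
  integrable_of_sNorm_two (aesm_hat f) (h.sNorm_ne_top hs)

theorem MemH.of_hat {s r C : ℝ} {f g : L2} {m : Plane → ℂ} (hg : MemH r g)
    (h : hat f =ᵐ[volume] fun ξ => m ξ * hat g ξ) (hm : ∀ ξ, jap ξ ^ s * ‖m ξ‖ ≤ C * jap ξ ^ r) :
    MemH s f := by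
  rw [memH_iff, sNorm_congr h]
  exact ne_top_of_le_ne_top (ENNReal.mul_ne_top ENNReal.ofReal_ne_top (memH_iff.1 hg))
    (sNorm_mul_le hm)

theorem MemH.add {s : ℝ} {f g : L2} (hf : MemH s f) (hg : MemH s g) : MemH s (f + g) := by
  rw [memH_iff, sNorm_congr (hat_add f g)]
  exact ne_top_of_le_ne_top (ENNReal.add_ne_top.2 ⟨memH_iff.1 hf, memH_iff.1 hg⟩)
    (sNorm_add_le s (aesm_hat f) (aesm_hat g))

theorem MemH.smul {s : ℝ} {f : L2} (hf : MemH s f) (c : ℂ) : MemH s (c • f) :=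
  hf.of_hat (m := fun _ => c) (C := ‖c‖) (hat_smul c f) fun ξ => by rw [mul_comm]

theorem MemH.sum {ι : Type*} {s : ℝ} {t : Finset ι} {f : ι → L2} (hf : ∀ i, MemH s (f i)) :
    MemH s (∑ i ∈ t, f i) := by
  rw [memH_iff, sNorm_congr (hat_sum t f)]
  exact ne_top_of_le_ne_top (ENNReal.sum_ne_top.2 fun i _ => memH_iff.1 (hf i))
    (sNorm_sum_le t s fun i => aesm_hat (f i))

/-- Multipliers of polynomial growth act on `H^s`. -/
theorem MemH.memLp_mult {s C : ℝ} {f : L2} (hf : MemH s f) {m : Plane → ℂ} (hm : Measurable m)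
    (h : ∀ ξ, ‖m ξ‖ ≤ C * jap ξ ^ s) : MemLp (fun ξ => m ξ * hat f ξ) 2 volume := by
  refine memLp_of_sNorm le_rfl (hm.aestronglyMeasurable.mul (aesm_hat f)) ?_
  refine ne_top_of_le_ne_top (ENNReal.mul_ne_top ENNReal.ofReal_ne_top (memH_iff.1 hf))
    (sNorm_mul_le (C := C) fun ξ => ?_)
  rw [Real.rpow_zero, one_mul]
  exact h ξ

theorem norm_dSym_le (k : Fin 2) (ξ : Plane) : ‖dSym k ξ‖ ≤ ‖ξ‖ := by
  rw [dSym, norm_I_mul_ofReal]; exact abs_apply_le ξ k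

theorem measurable_dSym (k : Fin 2) : Measurable (dSym k) := by
  unfold dSym; fun_prop

theorem measurable_riesz (k : Fin 2) : Measurable fun ξ : Plane => dSym k ξ / (‖ξ‖ : ℂ) :=
  (measurable_dSym k).div (Complex.measurable_ofReal.comp measurable_norm)

theorem norm_riesz_le (k : Fin 2) (ξ : Plane) : ‖dSym k ξ / (‖ξ‖ : ℂ)‖ ≤ 1 := by
  rw [norm_div, Complex.norm_real, norm_norm]
  exact div_le_one_of_le₀ (norm_dSym_le k ξ) (norm_nonneg _)

theorem measurable_gradSym (k l : Fin 2) :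
    Measurable fun ξ : Plane => ((ξ k * ξ l / ‖ξ‖ ^ 2 : ℝ) : ℂ) := by
  fun_prop

theorem norm_gradSym_le (k l : Fin 2) (ξ : Plane) : ‖((ξ k * ξ l / ‖ξ‖ ^ 2 : ℝ) : ℂ)‖ ≤ 1 := by
  rw [Complex.norm_real, Real.norm_eq_abs, abs_div, abs_mul, abs_of_nonneg (sq_nonneg ‖ξ‖), sq]
  refine div_le_one_of_le₀ ?_ (by positivity)
  gcongr <;> exact abs_apply_le ξ _

theorem hat_rieszDiv (F : Fin 2 → L2) :
    hat (rieszDiv F) =ᵐ[volume] fun ξ => ∑ k, dSym k ξ / (‖ξ‖ : ℂ) * hat (F k) ξ := by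
  filter_upwards [hat_sum Finset.univ fun k => mult (fun ξ => dSym k ξ / (‖ξ‖ : ℂ)) (F k),
    ae_all_iff.2 fun k => hat_mult (memLp_mult (measurable_riesz k) (norm_riesz_le k) (F k))]
    with ξ h1 h2
  rw [rieszDiv, h1]
  exact Finset.sum_congr rfl fun k _ => h2 k

theorem hat_gradPart (F : Fin 2 → L2) (k : Fin 2) :
    hat (gradPart F k) =ᵐ[volume] fun ξ => ∑ l, ((ξ k * ξ l / ‖ξ‖ ^ 2 : ℝ) : ℂ) * hat (F l) ξ := by
  filter_upwards [hat_sum Finset.univ fun l => mult (fun ξ => ((ξ k * ξ l / ‖ξ‖ ^ 2 : ℝ) : ℂ)) (F l),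
    ae_all_iff.2 fun l => hat_mult (memLp_mult (measurable_gradSym k l) (norm_gradSym_le k l) (F l))]
    with ξ h1 h2
  rw [gradPart, h1]
  exact Finset.sum_congr rfl fun l _ => h2 l

theorem sNorm_sum_mul_le {s : ℝ} {m : Fin 2 → Plane → ℂ} (hm : ∀ k, Measurable (m k))
    (h1 : ∀ k ξ, ‖m k ξ‖ ≤ 1) (F : Fin 2 → L2) :
    sNorm s (fun ξ => ∑ k, m k ξ * hat (F k) ξ) ≤ ∑ k, sNorm s (hat (F k)) := by
  refine (sNorm_sum_le _ s fun k => (hm k).aestronglyMeasurable.mul (aesm_hat (F k))).trans ?_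
  refine Finset.sum_le_sum fun k _ => ?_
  have h := sNorm_mul_le (s := s) (r := s) (C := 1) (m := m k) (F := hat (F k)) fun ξ => by
    have := jap_rpow_pos s ξ
    have := h1 k ξ
    nlinarith
  rwa [ENNReal.ofReal_one, one_mul] at h

theorem sNorm_rieszDiv_le (s : ℝ) (F : Fin 2 → L2) :
    sNorm s (hat (rieszDiv F)) ≤ ∑ k, sNorm s (hat (F k)) := by
  rw [sNorm_congr (hat_rieszDiv F)]
  exact sNorm_sum_mul_le measurable_riesz norm_riesz_le F

theorem sNorm_gradPart_le (s : ℝ) (F : Fin 2 → L2) (k : Fin 2) :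
    sNorm s (hat (gradPart F k)) ≤ ∑ l, sNorm s (hat (F l)) := by
  rw [sNorm_congr (hat_gradPart F k)]
  exact sNorm_sum_mul_le (measurable_gradSym k) (norm_gradSym_le k) F

theorem HatReal.of_real {f : L2} (hf : IsRealValued f) (hi : Integrable (hat f) volume) :
    HatReal (hat f) := by
  have h := hat_star hi
  rw [isRealValued_iff_star.1 hf] at h
  filter_upwards [ae_neg h] with ξ hξ
  rw [hξ, neg_neg]

theorem HatReal.congr {F G : Plane → ℂ} (hF : HatReal F) (h : G =ᵐ[volume] F) : HatReal G := by
  filter_upwards [hF, h, ae_neg h] with ξ h1 h2 h3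
  rw [h3, h1, h2]

theorem HatReal.mul {m F : Plane → ℂ} (hF : HatReal F) (hm : ∀ ξ, m (-ξ) = (starRingEnd ℂ) (m ξ)) :
    HatReal fun ξ => m ξ * F ξ := by
  filter_upwards [hF] with ξ h1
  rw [h1, hm, map_mul]

theorem HatReal.add {F G : Plane → ℂ} (hF : HatReal F) (hG : HatReal G) :
    HatReal fun ξ => F ξ + G ξ := by
  filter_upwards [hF, hG] with ξ h1 h2
  rw [h1, h2, map_add]

theorem HatReal.sum {ι : Type*} (t : Finset ι) {F : ι → Plane → ℂ} [Countable ι]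
    (hF : ∀ i, HatReal (F i)) : HatReal fun ξ => ∑ i ∈ t, F i ξ := by
  filter_upwards [ae_all_iff.2 hF] with ξ h1
  rw [map_sum]
  exact Finset.sum_congr rfl fun i _ => h1 i

theorem HatReal.bil {q : Plane → Plane → ℂ} {F G : Plane → ℂ} (hF : HatReal F) (hG : HatReal G)
    (hq : ∀ ξ η, q (-ξ) (-η) = (starRingEnd ℂ) (q ξ η)) : HatReal (bil q F G) := by
  refine ae_of_all _ fun ξ => ?_
  rw [Bsq.bil, Bsq.bil, ← integral_conj, ← integral_neg_eq_self]
  refine integral_congr_ae ?_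
  filter_upwards [ae_sub_left hF ξ, hG] with η h1 h2
  rw [hq, h2, map_mul, map_mul, ← h1]
  congr 3
  abel

theorem paraSym_neg (φ : ℝ → ℝ) (ξ η : Plane) : paraSym φ (-ξ) (-η) = paraSym φ ξ η := by
  rw [paraSym, paraSym, norm_neg, show -ξ - -η = -(ξ - η) by abel, norm_neg]

theorem conj_riesz (k : Fin 2) (ξ : Plane) :
    dSym k (-ξ) / (‖-ξ‖ : ℂ) = (starRingEnd ℂ) (dSym k ξ / (‖ξ‖ : ℂ)) := by
  simp [dSym]

theorem ae_ne_zero : ∀ᵐ ξ : Plane, ξ ≠ 0 := by simp [ae_iff]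

theorem norm_sq_eq (ξ : Plane) : ‖ξ‖ ^ 2 = ξ 0 ^ 2 + ξ 1 ^ 2 := by
  rw [EuclideanSpace.real_norm_sq_eq, Fin.sum_univ_two]

section Profile

variable {φ : ℝ → ℝ} {ε N : ℝ} {ζ : L2} {v : Fin 2 → L2}

/-- The real function `w = |D|⁻¹ div u`, so that `V = ζ + i w`. -/
noncomputable def wave (φ : ℝ → ℝ) (ε : ℝ) (ζ : L2) (v : Fin 2 → L2) : L2 := rieszDiv (goodU φ ε ζ v)

/-- The gain of one derivative for `B^ε`, from `|mHi| ≤ (4/ε)⟨η⟩⁻¹`. The loss `1/ε` is affordable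
because these terms later come with an additional factor `ε`. -/
theorem bSym_bound (hφ : IsCutoff φ) (hε : 0 < ε) (hε1 : ε ≤ 1) (hN : 0 ≤ N) (ξ η : Plane) :
    jap ξ ^ (N + 1) * ‖bSym φ ε ξ η‖
      ≤ 2 ^ (N + 1) * (4 / ε) * (jap (ξ - η) ^ (0 : ℝ) * jap η ^ N) := by
  have h := paraSym_mul_bound hφ (N := N + 1) (by linarith) (a := 0) (r := -1) (c := 4 / ε)
    (by positivity) (t := fun _ η => mHi φ ε η) (fun ξ η _ _ _ => ?_) ξ η
  · rw [add_neg_cancel_right] at h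
    rwa [bSym, Complex.norm_real, Real.norm_eq_abs, mul_comm (paraSym φ ξ η)]
  · rw [Real.rpow_zero, one_mul, Real.rpow_neg_one, ← div_eq_mul_inv, le_div_iff₀ (jap_pos η),
      le_div_iff₀ hε]
    have h1 := abs_mHi_le_two hφ hε η
    have h2 := abs_mHi_mul_le hφ hε hε1 η
    have h3 : jap η ≤ 1 + ‖η‖ := by
      refine jap_add_le.le_of_sq_le_sq ?_ (by positivity)
      rw [jap_sq]
      nlinarith [norm_nonneg η]
    have h4 := abs_nonneg (mHi φ ε η)
    nlinarith [mul_le_mul_of_nonneg_left h3 (mul_nonneg h4 hε.le)]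

namespace IsProfile

variable (h : IsProfile φ ε N ζ v)
include h

theorem nonneg : 0 ≤ N := by linarith [h.five_le]

theorem int_zeta : Integrable (hat ζ) volume := h.mem_zeta.integrable (by linarith [h.five_le])

theorem int_v (k : Fin 2) : Integrable (hat (v k)) volume :=
  (h.mem_v k).integrable (by linarith [h.five_le])

theorem Bop_eq (k : Fin 2) :
    Bop φ ε ζ v k = (1 / 2 : ℂ) • highPara h.cutoff h.pos h.le_one ζ (v k) := by
  rw [Bop, para_highInv h.cutoff h.pos h.le_one h.int_zeta]

theorem hat_Bop (k : Fin 2) :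
    hat (Bop φ ε ζ v k) =ᵐ[volume]
      fun ξ => (1 / 2 * convC) * bil (bSym φ ε) (hat ζ) (hat (v k)) ξ := by
  rw [h.Bop_eq]
  filter_upwards [hat_smul (1 / 2) (highPara h.cutoff h.pos h.le_one ζ (v k)),
    hat_highPara h.cutoff h.pos h.le_one ζ (v k)] with ξ h1 h2
  rw [h1, h2, mul_assoc]

theorem sNorm_Bop_le (k : Fin 2) :
    sNorm (N + 1) (hat (Bop φ ε ζ v k)) ≤ ENNReal.ofReal (‖(1 / 2 * convC : ℂ)‖ * (2 ^ (N + 1) * (4 / ε)))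
      * (wNorm 0 (hat ζ) * sNorm N (hat (v k))) := by
  have hε := h.pos
  rw [sNorm_congr (h.hat_Bop k), ENNReal.ofReal_mul (norm_nonneg _)]
  refine (sNorm_mul_le (r := N + 1) (C := ‖(1 / 2 * convC : ℂ)‖) fun ξ => (mul_comm _ _).le).trans ?_
  rw [mul_assoc]
  gcongr
  exact sNorm_bil_le (bSym_bound h.cutoff h.pos h.le_one h.nonneg) (aesm_hat _) (aesm_hat _)

theorem memH_Bop (k : Fin 2) : MemH (N + 1) (Bop φ ε ζ v k) := by
  refine memH_iff.2 (ne_top_of_le_ne_top ?_ (h.sNorm_Bop_le k))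
  have h1 := h.mem_zeta.wNorm_ne_top (a := 0) (by linarith [h.five_le])
  have h2 := memH_iff.1 (h.mem_v k)
  finiteness

theorem hat_goodU (k : Fin 2) :
    hat (goodU φ ε ζ v k) =ᵐ[volume] fun ξ => hat (v k) ξ + ε * hat (Bop φ ε ζ v k) ξ := by
  filter_upwards [hat_add (v k) ((ε : ℂ) • Bop φ ε ζ v k), hat_smul ε (Bop φ ε ζ v k)] with ξ h1 h2
  rw [goodU, h1, h2]

theorem memH_goodU (k : Fin 2) : MemH N (goodU φ ε ζ v k) :=
  (h.mem_v k).add (((h.memH_Bop k).mono (by linarith)).smul _)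

theorem memH_gradB (k : Fin 2) : MemH (N + 1) (gradB φ ε ζ v k) :=
  memH_iff.2 (ne_top_of_le_ne_top (ENNReal.sum_ne_top.2 fun l _ => memH_iff.1 (h.memH_Bop l))
    (sNorm_gradPart_le (N + 1) _ k))

theorem memH_wave : MemH N (wave φ ε ζ v) :=
  memH_iff.2 (ne_top_of_le_ne_top (ENNReal.sum_ne_top.2 fun l _ => memH_iff.1 (h.memH_goodU l))
    (sNorm_rieszDiv_le N _))

theorem hat_goodV : hat (goodV φ ε ζ v) =ᵐ[volume]
    fun ξ => hat ζ ξ + Complex.I * hat (wave φ ε ζ v) ξ := by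
  filter_upwards [hat_add ζ (Complex.I • rieszDiv (goodU φ ε ζ v)),
    hat_smul Complex.I (rieszDiv (goodU φ ε ζ v))] with ξ h1 h2
  rw [goodV, h1, h2, wave]

theorem memH_goodV : MemH N (goodV φ ε ζ v) := h.mem_zeta.add (h.memH_wave.smul _)

theorem int_goodV : Integrable (hat (goodV φ ε ζ v)) volume :=
  h.memH_goodV.integrable (by linarith [h.five_le])

theorem int_gradB (k : Fin 2) : Integrable (hat (gradB φ ε ζ v k)) volume :=
  (h.memH_gradB k).integrable (by linarith [h.five_le])

theorem hatReal_zeta : HatReal (hat ζ) := HatReal.of_real h.real_zeta h.int_zeta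

theorem hatReal_v (k : Fin 2) : HatReal (hat (v k)) := HatReal.of_real (h.real_v k) (h.int_v k)

theorem hatReal_Bop (k : Fin 2) : HatReal (hat (Bop φ ε ζ v k)) := by
  refine HatReal.congr (HatReal.mul (HatReal.bil h.hatReal_zeta (h.hatReal_v k) fun ξ η => ?_)
    fun ξ => ?_) (h.hat_Bop k)
  · rw [bSym, bSym, Complex.conj_ofReal, paraSym_neg, mHi, mHi, norm_neg]
  · have e : (1 / 2 * convC : ℂ) = ((1 / 2 * (1 / (4 * Real.pi ^ 2)) : ℝ) : ℂ) := by
      rw [convC]; push_cast; rfl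
    rw [e, Complex.conj_ofReal]

theorem hatReal_gradB (k : Fin 2) : HatReal (hat (gradB φ ε ζ v k)) :=
  HatReal.congr (HatReal.sum _ fun l => (h.hatReal_Bop l).mul fun ξ => by
    simp) (hat_gradPart _ k)

theorem hatReal_goodU (k : Fin 2) : HatReal (hat (goodU φ ε ζ v k)) :=
  HatReal.congr ((h.hatReal_v k).add ((h.hatReal_Bop k).mul fun _ => by simp)) (h.hat_goodU k)

theorem hatReal_wave : HatReal (hat (wave φ ε ζ v)) :=
  HatReal.congr (HatReal.sum _ fun l => (h.hatReal_goodU l).mul (conj_riesz l)) (hat_rieszDiv _)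

theorem hat_star_goodV : hat (star (goodV φ ε ζ v)) =ᵐ[volume]
    fun ξ => hat ζ ξ - Complex.I * hat (wave φ ε ζ v) ξ := by
  filter_upwards [hat_star h.int_goodV, ae_neg h.hat_goodV, h.hatReal_zeta, h.hatReal_wave]
    with ξ h1 h2 h3 h4
  rw [h1, h2, h3, h4]
  simp [sub_eq_add_neg]

theorem hat_pm (μ : ℤˣ) : hat (pm μ (goodV φ ε ζ v)) =ᵐ[volume]
    fun ξ => hat ζ ξ + ((μ : ℤ) : ℂ) * (Complex.I * hat (wave φ ε ζ v) ξ) := by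
  rcases Int.units_eq_one_or μ with rfl | rfl
  · simpa [pm] using h.hat_goodV
  · have : (-1 : ℤˣ) ≠ 1 := by decide
    simpa [pm, this, sub_eq_add_neg] using h.hat_star_goodV

theorem memLp_dSym {f : L2} (hf : MemH 1 f) (k : Fin 2) : MemLp (fun ξ => dSym k ξ * hat f ξ) 2 volume :=
  hf.memLp_mult (measurable_dSym k) (C := 1) fun ξ => by
    rw [Real.rpow_one, one_mul]; exact (norm_dSym_le k ξ).trans (norm_le_jap ξ)

theorem curl_hat : ∀ᵐ ξ : Plane, (ξ 0 : ℂ) * hat (v 1) ξ = (ξ 1 : ℂ) * hat (v 0) ξ := by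
  have m : ∀ k, MemH 1 (v k) := fun k => (h.mem_v k).mono (by linarith [h.five_le])
  have e : hat (deriv 0 (v 1)) = hat (deriv 1 (v 0)) := by rw [h.curl_free]
  filter_upwards [hat_mult (h.memLp_dSym (m 1) 0), hat_mult (h.memLp_dSym (m 0) 1)] with ξ h1 h2
  have h3 : hat (deriv 0 (v 1)) ξ = hat (deriv 1 (v 0)) ξ := by rw [e]
  rw [deriv, deriv, h1, h2, dSym, dSym, mul_assoc, mul_assoc] at h3
  exact mul_left_cancel₀ Complex.I_ne_zero h3

/-- A curl-free field equals its own projection `Δ⁻¹∇div`. Applying this projection to `u = v +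
εB^ε` and writing `Δ⁻¹∇div u = -∇|D|⁻¹w` gives the formula, which is how `v` is eliminated in favour
of `V`. -/
theorem hat_v_eq (k : Fin 2) : ∀ᵐ ξ : Plane, hat (v k) ξ
    = -(dSym k ξ / (‖ξ‖ : ℂ)) * hat (wave φ ε ζ v) ξ - ε * hat (gradB φ ε ζ v k) ξ := by
  filter_upwards [h.curl_hat, hat_rieszDiv (goodU φ ε ζ v), hat_gradPart (Bop φ ε ζ v) k,
    h.hat_goodU 0, h.hat_goodU 1, ae_ne_zero] with ξ h1 h2 h3 h4 h5 h6
  have hn : (‖ξ‖ : ℂ) ≠ 0 := by exact_mod_cast norm_ne_zero_iff.2 h6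
  have hsq : (‖ξ‖ : ℂ) ^ 2 = (ξ 0 : ℂ) ^ 2 + (ξ 1 : ℂ) ^ 2 := by exact_mod_cast norm_sq_eq ξ
  rw [wave, h2, gradB, h3, Fin.sum_univ_two, Fin.sum_univ_two, h4, h5]
  simp only [dSym]
  push_cast
  field_simp
  rw [Complex.I_sq, hsq]
  fin_cases k <;> simp only [Fin.zero_eta, Fin.mk_one, Fin.isValue]
  · linear_combination (ξ 1 : ℂ) * h1 * (-1)
  · linear_combination (ξ 0 : ℂ) * h1

end IsProfile

end Profile

/-! ### Products and time derivatives -/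

theorem hat_prod_eq_bil {f g : L2} (hf : Integrable (hat f) volume) (hg : Integrable (hat g) volume) :
    hat (prod f g) =ᵐ[volume] fun ξ => convC * bil (fun _ _ => 1) (hat f) (hat g) ξ := by
  filter_upwards [hat_prod hf hg] with ξ h
  simp only [h, convC, bil, one_mul]

/-- The constant of the algebra property of `H^s`. -/
noncomputable def prodC (s : ℝ) : ℝ := ‖convC‖ * (2 ^ s * (2 * embC))

theorem prodC_nonneg (s : ℝ) : 0 ≤ prodC s := by
  have := embC_nonneg
  unfold prodC
  positivity

theorem wNorm_zero_le_sNorm {s : ℝ} (hs : 2 ≤ s) (f : L2) :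
    wNorm 0 (hat f) ≤ ENNReal.ofReal embC * sNorm s (hat f) := by
  refine (wNorm_le_sNorm 0 (aesm_hat f)).trans ?_
  gcongr
  exact sNorm_mono (by linarith) _

theorem wNorm_hat_le {a s : ℝ} (hs : a + 2 ≤ s) (f : L2) :
    wNorm a (hat f) ≤ ENNReal.ofReal embC * sNorm s (hat f) := by
  refine (wNorm_le_sNorm a (aesm_hat f)).trans ?_
  gcongr
  exact sNorm_mono hs _

theorem sNorm_const_mul_le (s : ℝ) (c : ℂ) (F : Plane → ℂ) :
    sNorm s (fun ξ => c * F ξ) ≤ ENNReal.ofReal ‖c‖ * sNorm s F :=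
  sNorm_mul_le (m := fun _ => c) fun _ => (mul_comm _ _).le

theorem wNorm_const_mul_le (s : ℝ) (c : ℂ) (F : Plane → ℂ) :
    wNorm s (fun ξ => c * F ξ) ≤ ENNReal.ofReal ‖c‖ * wNorm s F :=
  wNorm_mul_le (m := fun _ => c) fun _ => (mul_comm _ _).le

theorem sNorm_prod_le {s : ℝ} (hs : 2 ≤ s) {f g : L2} (hf : Integrable (hat f) volume)
    (hg : Integrable (hat g) volume) :
    sNorm s (hat (prod f g)) ≤ ENNReal.ofReal (prodC s) * (sNorm s (hat f) * sNorm s (hat g)) := by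
  have h0 := embC_nonneg
  rw [sNorm_congr (hat_prod_eq_bil hf hg)]
  refine (sNorm_const_mul_le s convC _).trans ?_
  rw [prodC, ENNReal.ofReal_mul (norm_nonneg _), mul_assoc]
  gcongr
  refine (sNorm_conv_le (by linarith) (aesm_hat f) (aesm_hat g)).trans ?_
  rw [ENNReal.ofReal_mul (by positivity), mul_assoc]
  gcongr
  rw [ENNReal.ofReal_mul (by norm_num), ENNReal.ofReal_ofNat]
  calc _ ≤ sNorm s (hat f) * (ENNReal.ofReal embC * sNorm s (hat g))
        + (ENNReal.ofReal embC * sNorm s (hat f)) * sNorm s (hat g) := by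
        gcongr <;> exact wNorm_zero_le_sNorm hs _
    _ = _ := by ring

theorem MemH.prod {s : ℝ} (hs : 2 ≤ s) {f g : L2} (hf : MemH s f) (hg : MemH s g) :
    MemH s (prod f g) := by
  refine memH_iff.2 (ne_top_of_le_ne_top ?_ (sNorm_prod_le hs (hf.integrable hs) (hg.integrable hs)))
  have := memH_iff.1 hf
  have := memH_iff.1 hg
  finiteness

theorem wNorm_prod_le {f g : L2} (hf : Integrable (hat f) volume)
    (hg : Integrable (hat g) volume) :
    wNorm 1 (hat (prod f g)) ≤ ENNReal.ofReal (‖convC‖ * 2) * (wNorm 1 (hat f) * wNorm 1 (hat g)) := by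
  rw [wNorm_congr (hat_prod_eq_bil hf hg), ENNReal.ofReal_mul (norm_nonneg _), mul_assoc]
  refine (wNorm_const_mul_le 1 convC _).trans ?_
  gcongr
  refine wNorm_bil_le (fun ξ η => ?_) (aesm_hat f) (aesm_hat g)
  simpa using jap_le_mul ξ η

theorem norm_lapSym_mul_dSym_le {ε : ℝ} (hε : 0 < ε) (hε1 : ε ≤ 1) (k : Fin 2) (ξ : Plane) :
    ‖lapSym ε ξ * dSym k ξ‖ ≤ 1 * jap ξ ^ (3 : ℝ) := by
  have h1 : ‖lapSym ε ξ‖ ≤ jap ξ ^ 2 := by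
    rw [lapSym, Complex.norm_real, Real.norm_eq_abs, jap_sq, abs_le]
    constructor <;> nlinarith [sq_nonneg ‖ξ‖]
  have h2 := (norm_dSym_le k ξ).trans (norm_le_jap ξ)
  have h3 : jap ξ ^ (3 : ℝ) = jap ξ ^ 2 * jap ξ := by norm_cast
  rw [norm_mul, h3, one_mul]
  have := jap_pos ξ
  gcongr

theorem measurable_lapSym (ε : ℝ) : Measurable (lapSym ε) := by
  unfold lapSym; fun_prop

/-- The right-hand side `-(1 + εΔ)∇·v - ε∇·(ζ v)` of the equation of `ζ`. -/
noncomputable def rhsZeta (ε : ℝ) (ζ : L2) (v : Fin 2 → L2) : L2 :=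
  -(∑ k, mult (fun ξ => lapSym ε ξ * dSym k ξ) (v k)) - (ε : ℂ) • divg (fun k => prod ζ (v k))

/-- The right-hand side `-(1 + εΔ)∇ζ - (ε/2)∇|v|²` of the equation of `v`. -/
noncomputable def rhsV (ε : ℝ) (ζ : L2) (v : Fin 2 → L2) (k : Fin 2) : L2 :=
  -(mult (fun ξ => lapSym ε ξ * dSym k ξ) ζ)
    - ((ε / 2 : ℝ) : ℂ) • deriv k (∑ l, prod (v l) (v l))

theorem IsSolution.isProfile {φ : ℝ → ℝ} (hφ : IsCutoff φ) {ε N T : ℝ} (hε : 0 < ε) (hε1 : ε ≤ 1)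
    (hN : 5 ≤ N) {ζ : ℝ → L2} {v : ℝ → Fin 2 → L2} (h : IsSolution ε N T ζ v) {t : ℝ}
    (ht : t ∈ Set.Icc 0 T) : IsProfile φ ε N (ζ t) (v t) :=
  ⟨hφ, hε, hε1, hN, h.mem_zeta t ht, h.mem_v t ht, h.real_zeta t ht, h.real_v t ht, h.curl_free t ht⟩

section Profile

variable {φ : ℝ → ℝ} {ε N : ℝ} {ζ : L2} {v : Fin 2 → L2}

/-- The time derivative of `V`. -/
noncomputable def IsProfile.dV (h : IsProfile φ ε N ζ v) : L2 :=
  rhsZeta ε ζ v + Complex.I • rieszDiv (fun k => rhsV ε ζ v k + ((ε / 2 : ℝ) : ℂ) •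
    (highPara h.cutoff h.pos h.le_one (rhsZeta ε ζ v) (v k)
      + highPara h.cutoff h.pos h.le_one ζ (rhsV ε ζ v k)))

/-- With derivatives available only in `L²`, `V` is written as a composition of maps continuous on
`L²`, namely the bilinear `highPara` and the bounded Riesz multipliers. The product and chain rules
then apply. -/
theorem hasDerivWithinAt_goodV {T : ℝ} (hφ : IsCutoff φ) (hε : 0 < ε) (hε1 : ε ≤ 1)
    (hN : 5 ≤ N) {ζ : ℝ → L2} {v : ℝ → Fin 2 → L2} (h : IsSolution ε N T ζ v) {t : ℝ}
    (ht : t ∈ Set.Icc 0 T) :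
    HasDerivWithinAt (fun τ => goodV φ ε (ζ τ) (v τ)) (h.isProfile hφ hε hε1 hN ht).dV
      (Set.Icc 0 T) t := by
  have hB : ∀ k, HasDerivWithinAt (fun τ => highPara hφ hε hε1 (ζ τ) (v τ k))
      (highPara hφ hε hε1 (rhsZeta ε (ζ t) (v t)) (v t k)
        + highPara hφ hε hε1 (ζ t) (rhsV ε (ζ t) (v t) k)) (Set.Icc 0 T) t := fun k => by
    have h1 := ((isBoundedBilinearMap_highPara hφ hε hε1).hasFDerivAt (ζ t, v t k)).comp_hasDerivWithinAt
      t ((h.eq_zeta t ht).prodMk (h.eq_v t ht k))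
    rw [IsBoundedBilinearMap.deriv_apply, add_comm] at h1
    exact h1
  have hu : ∀ k, HasDerivWithinAt (fun τ => v τ k + ((ε / 2 : ℝ) : ℂ) • highPara hφ hε hε1 (ζ τ) (v τ k))
      (rhsV ε (ζ t) (v t) k + ((ε / 2 : ℝ) : ℂ) •
        (highPara hφ hε hε1 (rhsZeta ε (ζ t) (v t)) (v t k)
        + highPara hφ hε hε1 (ζ t) (rhsV ε (ζ t) (v t) k))) (Set.Icc 0 T) t := fun k =>
    (h.eq_v t ht k).add ((hB k).const_smul ((ε / 2 : ℝ) : ℂ))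
  have hr : ∀ k, HasDerivWithinAt (fun τ => mult (fun ξ => dSym k ξ / (‖ξ‖ : ℂ))
      (v τ k + ((ε / 2 : ℝ) : ℂ) • highPara hφ hε hε1 (ζ τ) (v τ k)))
      (mult (fun ξ => dSym k ξ / (‖ξ‖ : ℂ)) (rhsV ε (ζ t) (v t) k + ((ε / 2 : ℝ) : ℂ) •
        (highPara hφ hε hε1 (rhsZeta ε (ζ t) (v t)) (v t k)
        + highPara hφ hε hε1 (ζ t) (rhsV ε (ζ t) (v t) k)))) (Set.Icc 0 T) t := fun k =>
    ((multCLM _ 1 (measurable_riesz k) (norm_riesz_le k)).restrictScalars ℝ).hasFDerivAt.comp_hasDerivWithinAt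
      t (hu k)
  have hs := HasDerivWithinAt.fun_sum (u := Finset.univ) fun k _ => hr k
  have hfin := (h.eq_zeta t ht).add (hs.const_smul Complex.I)
  -- The series defining `B^ε` is identified with `highPara` only at the times of `[0, T]`, where
  -- the transform of `ζ` is integrable; this suffices for a derivative within the interval.
  refine HasDerivWithinAt.congr_of_mem (f := fun τ => ζ τ + Complex.I • ∑ k,
    mult (fun ξ => dSym k ξ / (‖ξ‖ : ℂ))
      (v τ k + ((ε / 2 : ℝ) : ℂ) • highPara hφ hε hε1 (ζ τ) (v τ k))) hfin (fun τ hτ => ?_) ht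
  rw [goodV, rieszDiv]
  congr 3
  funext k
  rw [goodU, (h.isProfile hφ hε hε1 hN hτ).Bop_eq, smul_smul]
  congr 3
  push_cast
  ring

namespace IsProfile

variable (h : IsProfile φ ε N ζ v)
include h

theorem hat_rhsZeta : hat (rhsZeta ε ζ v) =ᵐ[volume] fun ξ =>
    ∑ k, (-(lapSym ε ξ * dSym k ξ) * hat (v k) ξ + -(ε * dSym k ξ) * hat (prod ζ (v k)) ξ) := by
  have hN := h.five_le
  have m1 : ∀ k, MemLp (fun ξ => (lapSym ε ξ * dSym k ξ) * hat (v k) ξ) 2 volume := fun k =>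
    ((h.mem_v k).mono (r := 3) (by linarith)).memLp_mult ((measurable_lapSym ε).mul (measurable_dSym k))
      (norm_lapSym_mul_dSym_le h.pos h.le_one k)
  have m2 : ∀ k, MemLp (fun ξ => dSym k ξ * hat (prod ζ (v k)) ξ) 2 volume := fun k =>
    h.memLp_dSym (((h.mem_zeta.prod (by linarith) (h.mem_v k))).mono (by linarith)) k
  filter_upwards [hat_sub (-(∑ k, mult (fun ξ => lapSym ε ξ * dSym k ξ) (v k)))
      ((ε : ℂ) • divg (fun k => prod ζ (v k))),
    hat_neg (∑ k, mult (fun ξ => lapSym ε ξ * dSym k ξ) (v k)),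
    hat_sum Finset.univ fun k => mult (fun ξ => lapSym ε ξ * dSym k ξ) (v k),
    hat_smul ε (divg (fun k => prod ζ (v k))),
    hat_sum Finset.univ fun k => deriv k (prod ζ (v k)),
    ae_all_iff.2 fun k => hat_mult (m1 k), ae_all_iff.2 fun k => hat_mult (m2 k)]
    with ξ h1 h2 h3 h4 h5 h6 h7
  rw [rhsZeta, h1, h2, h3, h4, divg, h5]
  simp only [deriv, Fin.sum_univ_two, h6, h7]
  ring

theorem hat_sum_sq : hat (∑ l, prod (v l) (v l)) =ᵐ[volume] fun ξ => ∑ l, hat (prod (v l) (v l)) ξ :=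
  hat_sum _ _

theorem memH_sum_sq : MemH N (∑ l, prod (v l) (v l)) :=
  MemH.sum fun l => (h.mem_v l).prod (by linarith [h.five_le]) (h.mem_v l)

theorem hat_rhsV (k : Fin 2) : hat (rhsV ε ζ v k) =ᵐ[volume] fun ξ =>
    -(lapSym ε ξ * dSym k ξ) * hat ζ ξ + -(((ε / 2 : ℝ) : ℂ) * dSym k ξ) * hat (∑ l, prod (v l) (v l)) ξ := by
  have hN := h.five_le
  have m1 : MemLp (fun ξ => (lapSym ε ξ * dSym k ξ) * hat ζ ξ) 2 volume :=
    (h.mem_zeta.mono (r := 3) (by linarith)).memLp_mult ((measurable_lapSym ε).mul (measurable_dSym k))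
      (norm_lapSym_mul_dSym_le h.pos h.le_one k)
  filter_upwards [hat_sub (-(mult (fun ξ => lapSym ε ξ * dSym k ξ) ζ))
      (((ε / 2 : ℝ) : ℂ) • deriv k (∑ l, prod (v l) (v l))),
    hat_neg (mult (fun ξ => lapSym ε ξ * dSym k ξ) ζ),
    hat_smul ((ε / 2 : ℝ) : ℂ) (deriv k (∑ l, prod (v l) (v l))),
    hat_mult m1, hat_mult (h.memLp_dSym (h.memH_sum_sq.mono (by linarith)) k)]
    with ξ h1 h2 h3 h4 h5
  rw [rhsV, h1, h2, h3, h4, deriv, h5]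
  ring

/-- This is where `N ≥ 5` is needed: `(1 + εΔ)∇·v` takes three derivatives, and placing it in `L¹`
takes two more. The product `ζv` contributes the part of the bound that is linear in the norm of
`ζ`. -/
theorem wNorm_rhsZeta_le : wNorm 0 (hat (rhsZeta ε ζ v))
    ≤ ENNReal.ofReal (embC + ‖convC‖ * 2 * embC ^ 2) *
      ((1 + sNorm N (hat ζ)) * ∑ k, sNorm N (hat (v k))) := by
  have hN := h.five_le
  have hc := embC_nonneg
  have hterm : ∀ k, wNorm 0 (fun ξ => -(lapSym ε ξ * dSym k ξ) * hat (v k) ξ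
      + -(ε * dSym k ξ) * hat (prod ζ (v k)) ξ)
      ≤ ENNReal.ofReal (embC + ‖convC‖ * 2 * embC ^ 2) * ((1 + sNorm N (hat ζ)) * sNorm N (hat (v k))) := by
    intro k
    refine (wNorm_add_le 0 (((((measurable_lapSym ε).mul (measurable_dSym k)).neg).aestronglyMeasurable).mul
      (aesm_hat (v k)))).trans ?_
    have e1 : wNorm 0 (fun ξ => -(lapSym ε ξ * dSym k ξ) * hat (v k) ξ)
        ≤ ENNReal.ofReal embC * sNorm N (hat (v k)) := by
      refine (wNorm_mul_le (r := 3) (C := 1) fun ξ => ?_).trans ?_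
      · rw [Real.rpow_zero, one_mul, norm_neg]
        exact norm_lapSym_mul_dSym_le h.pos h.le_one k ξ
      · rw [ENNReal.ofReal_one, one_mul]
        exact wNorm_hat_le (by linarith) _
    have e2 : wNorm 0 (fun ξ => -(ε * dSym k ξ) * hat (prod ζ (v k)) ξ)
        ≤ ENNReal.ofReal (‖convC‖ * 2 * embC ^ 2) * (sNorm N (hat ζ) * sNorm N (hat (v k))) := by
      refine (wNorm_mul_le (r := 1) (C := 1) fun ξ => ?_).trans ?_
      · rw [Real.rpow_zero, one_mul, Real.rpow_one, norm_neg, norm_mul, Complex.norm_real,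
          Real.norm_of_nonneg h.pos.le]
        have h1 := (norm_dSym_le k ξ).trans (norm_le_jap ξ)
        have := h.le_one
        gcongr
      · rw [ENNReal.ofReal_one, one_mul]
        refine (wNorm_prod_le h.int_zeta (h.int_v k)).trans ?_
        rw [ENNReal.ofReal_mul (by positivity) (q := embC ^ 2), ENNReal.ofReal_pow hc]
        calc _ ≤ ENNReal.ofReal (‖convC‖ * 2) * ((ENNReal.ofReal embC * sNorm N (hat ζ)) *
              (ENNReal.ofReal embC * sNorm N (hat (v k)))) := by
              gcongr <;> exact wNorm_hat_le (by linarith) _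
          _ = _ := by ring
    refine (add_le_add e1 e2).trans ?_
    rw [ENNReal.ofReal_add hc (by positivity)]
    calc _ ≤ ENNReal.ofReal embC * sNorm N (hat (v k))
          + ENNReal.ofReal (‖convC‖ * 2 * embC ^ 2) * (sNorm N (hat ζ) * sNorm N (hat (v k)))
          + (ENNReal.ofReal embC * (sNorm N (hat ζ) * sNorm N (hat (v k)))
          + ENNReal.ofReal (‖convC‖ * 2 * embC ^ 2) * sNorm N (hat (v k))) := le_self_add
      _ = _ := by ring
  rw [wNorm_congr h.hat_rhsZeta]
  simp only [Fin.sum_univ_two, mul_add]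
  refine (wNorm_add_le 0 ?_).trans (by
    have := add_le_add (hterm 0) (hterm 1)
    simpa only [mul_add] using this)
  exact (((((measurable_lapSym ε).mul (measurable_dSym 0)).neg).aestronglyMeasurable).mul
      (aesm_hat (v 0))).add ((((measurable_const.mul (measurable_dSym 0)).neg).aestronglyMeasurable).mul
      (aesm_hat _))

theorem sNorm_sum_sq_le : sNorm N (hat (∑ l, prod (v l) (v l)))
    ≤ ENNReal.ofReal (prodC N) * ∑ l, sNorm N (hat (v l)) ^ 2 := by
  rw [sNorm_congr h.hat_sum_sq, Finset.mul_sum]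
  refine (sNorm_sum_le _ N fun l => aesm_hat _).trans (Finset.sum_le_sum fun l _ => ?_)
  rw [sq]
  exact sNorm_prod_le (by linarith [h.five_le]) (h.int_v l) (h.int_v l)

end IsProfile

end Profile

/-! ### The quadratic terms as elements of `L²` -/

section Quadratic

variable {φ : ℝ → ℝ} {ε N : ℝ}

theorem measurable_sSym (hφ : IsCutoff φ) (ε : ℝ) (μ : ℤˣ) :
    Measurable fun p : Plane × Plane => sSym φ ε μ p.1 p.2 := by
  have := measurable_paraSym hφ
  unfold sSym
  refine measurable_const.mul (Complex.measurable_ofReal.comp (Measurable.mul ?_ this))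
  fun_prop

theorem measurable_qSym (hφ : IsCutoff φ) (ε : ℝ) (μ ν : ℤˣ) :
    Measurable fun p : Plane × Plane => qSym φ ε μ ν p.1 p.2 := by
  have h1 := measurable_paraSym hφ
  have h2 : Measurable fun p : Plane × Plane => phiLE φ 5 (Real.sqrt ε * ‖p.2‖) :=
    (measurable_phiLE hφ 5).comp (by fun_prop)
  unfold qSym
  refine measurable_const.mul (Complex.measurable_ofReal.comp (Measurable.mul (Measurable.mul ?_ h2) h1))
  fun_prop

theorem paraSym_mul_bound_zero (hφ : IsCutoff φ) {c : ℝ} (hc : 0 ≤ c) {t : Plane → Plane → ℝ}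
    (h : ∀ ξ η, |t ξ η| ≤ c * ‖ξ‖) (ξ η : Plane) :
    jap ξ ^ (0 : ℝ) * |t ξ η * paraSym φ ξ η|
      ≤ 2 * c * (jap (ξ - η) ^ (0 : ℝ) * jap η ^ (1 : ℝ)) := by
  have := paraSym_mul_bound hφ (N := 0) le_rfl (a := 0) (r := 1) (c := 2 * c) (by positivity) (t := t)
    (fun ξ η hn _ _ => (h ξ η).trans (by
      rw [Real.rpow_zero, Real.rpow_one, one_mul, mul_comm 2 c, mul_assoc]
      gcongr
      exact hn.1.trans (by linarith [norm_le_jap η]))) ξ η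
  rwa [zero_add, Real.rpow_zero (2 : ℝ), one_mul] at this

theorem sSym_bound (hφ : IsCutoff φ) (hε : 0 < ε) (hε1 : ε ≤ 1) (μ : ℤˣ) (ξ η : Plane) :
    jap ξ ^ (0 : ℝ) * ‖sSym φ ε μ ξ η‖ ≤ 2 * 1 * (jap (ξ - η) ^ (0 : ℝ) * jap η ^ (1 : ℝ)) := by
  rw [sSym, norm_I_mul_ofReal]
  refine paraSym_mul_bound_zero hφ zero_le_one (t := fun ξ η => ε * (((μ : ℤ) : ℝ) * (1 / 2) *
    (inner ℝ ξ (ξ - η) / ‖ξ - η‖) + 1 / 4 * ‖ξ‖)) (fun ξ η => ?_) ξ η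
  have hμ : |((μ : ℤ) : ℝ)| = 1 := by rcases units_int_cases μ with h | h <;> simp [h]
  rw [abs_mul, abs_of_pos hε]
  gcongr
  refine (abs_add_le _ _).trans ?_
  rw [abs_mul, abs_mul, hμ, abs_mul, abs_norm]
  norm_num
  linarith [abs_inner_div_norm_le ξ (ξ - η), norm_nonneg ξ]

theorem qSym_bound_zero (hφ : IsCutoff φ) (hε : 0 < ε) (hε1 : ε ≤ 1) (μ ν : ℤˣ) (ξ η : Plane) :
    jap ξ ^ (0 : ℝ) * ‖qSym φ ε μ ν ξ η‖ ≤ 2 * 1 * (jap (ξ - η) ^ (0 : ℝ) * jap η ^ (1 : ℝ)) := by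
  rw [norm_qSym]
  refine paraSym_mul_bound_zero hφ zero_le_one (t := fun ξ η => ε / 8 *
    inner ℝ ξ (((ν : ℤ) : ℝ) • (‖η‖⁻¹ • η) - ‖ξ‖⁻¹ • ξ) * phiLE φ 5 (Real.sqrt ε * ‖η‖))
    (fun ξ η => ?_) ξ η
  rw [abs_mul, abs_mul, abs_of_nonneg (phiLE_nonneg hφ _ _), abs_of_pos (by positivity : 0 < ε / 8)]
  have h1 := abs_inner_unit_le ν ξ η
  have h2 := phiLE_le_one hφ 5 (Real.sqrt ε * ‖η‖)
  have h3 := phiLE_nonneg hφ 5 (Real.sqrt ε * ‖η‖)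
  calc _ ≤ 1 / 8 * (2 * ‖ξ‖) * 1 := by gcongr
    _ ≤ _ := by linarith [norm_nonneg ξ]

theorem exists_isBilinear {q : Plane → Plane → ℂ} (hq : Measurable fun p : Plane × Plane => q p.1 p.2)
    {C : ℝ} (hb : ∀ ξ η, jap ξ ^ (0 : ℝ) * ‖q ξ η‖ ≤ C * (jap (ξ - η) ^ (0 : ℝ) * jap η ^ (1 : ℝ)))
    {f g : L2} (hf : Integrable (hat f) volume) (hg : MemH 1 g) : ∃ h : L2, IsBilinear q f g h := by
  have h1 := integrable_bil hq hb (aesm_hat f) (aesm_hat g) (wNorm_zero_ne_top hf) (memH_iff.1 hg)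
  have h2 := (memLp_bil hq le_rfl hb (aesm_hat f) (aesm_hat g) (wNorm_zero_ne_top hf)
    (memH_iff.1 hg)).const_mul (1 / (4 * Real.pi ^ 2) : ℂ)
  exact ⟨ofHat _ h2, h1, hat_ofHat h2⟩

theorem memH_star {s : ℝ} {f : L2} (hs : 2 ≤ s) (hf : MemH s f) : MemH s (star f) := by
  have h1 := hat_star (hf.integrable hs)
  have hmp := Measure.measurePreserving_neg (volume : Measure Plane)
  rw [memH_iff, sNorm_congr h1]
  have e : (fun ξ => ENNReal.ofReal (jap ξ ^ s) * ‖(starRingEnd ℂ) (hat f (-ξ))‖ₑ)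
      = (fun ξ => ENNReal.ofReal (jap ξ ^ s) * ‖hat f ξ‖ₑ) ∘ Neg.neg := by
    funext ξ
    have : jap (-ξ) = jap ξ := by rw [jap, jap, norm_neg]
    simp [this]
  rw [sNorm, e, eLpNorm_comp_measurePreserving (aem_weight s (aesm_hat f)).aestronglyMeasurable hmp]
  exact memH_iff.1 hf

theorem memH_pm {s : ℝ} {f : L2} (hs : 2 ≤ s) (hf : MemH s f) (μ : ℤˣ) : MemH s (pm μ f) := by
  rw [pm]
  split_ifs
  exacts [hf, memH_star hs hf]

theorem paraSym_bound (hφ : IsCutoff φ) {s : ℝ} (hs : 0 ≤ s) (ξ η : Plane) :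
    jap ξ ^ s * ‖((paraSym φ ξ η : ℝ) : ℂ)‖ ≤ 2 ^ s * 1 * (jap (ξ - η) ^ (0 : ℝ) * jap η ^ s) := by
  have := paraSym_mul_bound hφ hs (a := 0) (r := 0) zero_le_one (t := fun _ _ => 1)
    (fun _ _ _ _ _ => by simp) ξ η
  rwa [add_zero, one_mul, ← Real.norm_eq_abs, ← Complex.norm_real] at this

theorem memH_para (hφ : IsCutoff φ) {s : ℝ} (hs : 0 ≤ s) {f g : L2} (hf : Integrable (hat f) volume)
    (hg : MemH s g) : MemH s (para φ f g) := by
  rw [memH_iff, sNorm_congr (hat_para hφ hf g)]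
  refine ne_top_of_le_ne_top ?_ ((sNorm_const_mul_le s convC _).trans
    (mul_le_mul_right (sNorm_bil_le (paraSym_bound hφ hs) (aesm_hat f) (aesm_hat g)) _))
  have := wNorm_zero_ne_top hf
  have := memH_iff.1 hg
  finiteness

/-! ### The symbols of the remainder -/

/-- The symbol of the remainder acting on `(ζ, v_k)`. -/
noncomputable def remSymA (φ : ℝ → ℝ) (ε : ℝ) (k : Fin 2) (ξ η : Plane) : ℝ :=
  -(ξ k * rhoSym φ ξ η) + (1 / 2 * (ε * (‖η‖ ^ 2 - ‖ξ‖ ^ 2) * mHi φ ε η * ξ k)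
    + 1 / 2 * (‖ξ‖ * η k / ‖η‖ - ξ k)) * paraSym φ ξ η

/-- The symbol of the remainder acting on `(ζ, b_k)`. -/
noncomputable def remSymB (φ : ℝ → ℝ) (ε : ℝ) (k : Fin 2) (ξ η : Plane) : ℝ :=
  1 / 2 * (ε * (‖ξ‖ * η k / ‖η‖ + phiLE φ 5 (Real.sqrt ε * ‖η‖) * ξ k)) * paraSym φ ξ η

/-- The symbol of the remainder acting on `(v_k, v_k)`. -/
noncomputable def remSymC (φ : ℝ → ℝ) (ξ η : Plane) : ℝ := 1 / 2 * (‖ξ‖ * rhoSym φ ξ η)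

/-- The symbol of the remainder acting on `(∂_t ζ, v_k)`. -/
noncomputable def remSymD (φ : ℝ → ℝ) (ε : ℝ) (k : Fin 2) (ξ η : Plane) : ℝ :=
  1 / 2 * (ξ k / ‖ξ‖ * mHi φ ε η) * paraSym φ ξ η

/-- The symbol of the remainder acting on `(ζ, |v|²)`. -/
noncomputable def remSymE (φ : ℝ → ℝ) (ε : ℝ) (k : Fin 2) (ξ η : Plane) : ℝ :=
  1 / 4 * (ξ k / ‖ξ‖ * (mHi φ ε η * (ε * η k))) * paraSym φ ξ η

/-- The symbol of the remainder acting on `(ζ, ζ)`. -/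
noncomputable def remSymF (φ : ℝ → ℝ) (ε : ℝ) (k : Fin 2) (ξ η : Plane) : ℝ :=
  -(1 / 2) * ((1 - phiLE φ 5 (Real.sqrt ε * ‖η‖)) * (ξ k / ‖ξ‖ * (ξ k - η k))) * paraSym φ ξ η

/-- The symbol of the remainder acting on `(v_k, w)`. -/
noncomputable def remSymG (φ : ℝ → ℝ) (k : Fin 2) (ξ η : Plane) : ℝ :=
  (‖ξ‖ * η k / ‖η‖ - ξ k) * paraSym φ ξ η

/-- The symbol of the remainder acting on `(v_k, b_k)`. -/
noncomputable def remSymH (φ : ℝ → ℝ) (ε : ℝ) (ξ η : Plane) : ℝ := -(ε * ‖ξ‖) * paraSym φ ξ η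

theorem measurable_comp_sub {q : Plane → Plane → ℝ} (hq : Measurable fun p : Plane × Plane => q p.1 p.2) :
    Measurable fun p : Plane × Plane => q p.1 (p.1 - p.2) :=
  hq.comp (measurable_fst.prodMk (measurable_fst.sub measurable_snd))

theorem measurable_rhoSym (hφ : IsCutoff φ) :
    Measurable fun p : Plane × Plane => rhoSym φ p.1 p.2 := by
  have h1 := measurable_paraSym hφ
  have h2 : Measurable fun p : Plane × Plane => paraSym φ p.1 (p.1 - p.2) :=
    measurable_comp_sub h1
  unfold rhoSym
  generalize paraSym φ = c at *
  fun_prop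

theorem measurable_mHi_snd (hφ : IsCutoff φ) (ε : ℝ) :
    Measurable fun p : Plane × Plane => mHi φ ε p.2 := (measurable_mHi hφ ε).comp measurable_snd

theorem measurable_low_snd (hφ : IsCutoff φ) (ε : ℝ) :
    Measurable fun p : Plane × Plane => phiLE φ 5 (Real.sqrt ε * ‖p.2‖) :=
  (measurable_phiLE hφ 5).comp (by fun_prop)

theorem measurable_remSymA (hφ : IsCutoff φ) (ε : ℝ) (k : Fin 2) :
    Measurable fun p : Plane × Plane => remSymA φ ε k p.1 p.2 := by
  have h1 := measurable_paraSym hφ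
  have h2 := measurable_rhoSym hφ
  have h3 := measurable_mHi_snd hφ ε
  unfold remSymA
  fun_prop

theorem measurable_remSymB (hφ : IsCutoff φ) (ε : ℝ) (k : Fin 2) :
    Measurable fun p : Plane × Plane => remSymB φ ε k p.1 p.2 := by
  have h1 := measurable_paraSym hφ
  have h2 := measurable_low_snd hφ ε
  unfold remSymB
  fun_prop

theorem measurable_remSymC (hφ : IsCutoff φ) :
    Measurable fun p : Plane × Plane => remSymC φ p.1 p.2 := by
  have h2 := measurable_rhoSym hφ
  unfold remSymC
  fun_prop

theorem measurable_remSymD (hφ : IsCutoff φ) (ε : ℝ) (k : Fin 2) :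
    Measurable fun p : Plane × Plane => remSymD φ ε k p.1 p.2 := by
  have h1 := measurable_paraSym hφ
  have h3 := measurable_mHi_snd hφ ε
  unfold remSymD
  fun_prop

theorem measurable_remSymE (hφ : IsCutoff φ) (ε : ℝ) (k : Fin 2) :
    Measurable fun p : Plane × Plane => remSymE φ ε k p.1 p.2 := by
  have h1 := measurable_paraSym hφ
  have h3 := measurable_mHi_snd hφ ε
  unfold remSymE
  fun_prop

theorem measurable_remSymF (hφ : IsCutoff φ) (ε : ℝ) (k : Fin 2) :
    Measurable fun p : Plane × Plane => remSymF φ ε k p.1 p.2 := by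
  have h1 := measurable_paraSym hφ
  have h2 := measurable_low_snd hφ ε
  unfold remSymF
  fun_prop

theorem measurable_remSymG (hφ : IsCutoff φ) (k : Fin 2) :
    Measurable fun p : Plane × Plane => remSymG φ k p.1 p.2 := by
  have h1 := measurable_paraSym hφ
  unfold remSymG
  fun_prop

theorem measurable_remSymH (hφ : IsCutoff φ) (ε : ℝ) :
    Measurable fun p : Plane × Plane => remSymH φ ε p.1 p.2 := by
  have h1 := measurable_paraSym hφ
  unfold remSymH
  fun_prop

theorem norm_sub_le_jap (ξ η : Plane) : ‖ξ - η‖ ≤ jap (ξ - η) ^ (1 : ℝ) := by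
  rw [Real.rpow_one]; exact norm_le_jap _

/-- The commutator of `1 + εΔ` with `T_ζ`. The factor `|η|² - |ξ|²` gains `|ξ - η|`; the two
remaining powers of frequency are absorbed by `ε|η|²|mHi| ≤ 2`, and `12 = 3·2·2`. -/
theorem abs_sub_sq_mul_le (hφ : IsCutoff φ) (hε : 0 < ε) {ξ η : Plane} (hn : Near ξ η)
    (k : Fin 2) : |ε * (‖η‖ ^ 2 - ‖ξ‖ ^ 2) * mHi φ ε η * ξ k| ≤ 12 * ‖ξ - η‖ := by
  have h1 := abs_mHi_mul_sq_le hφ hε η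
  have h2 := abs_norm_sub ξ η
  have h3 := (abs_apply_le ξ k).trans hn.1
  have e : ‖η‖ ^ 2 - ‖ξ‖ ^ 2 = (‖η‖ - ‖ξ‖) * (‖η‖ + ‖ξ‖) := by ring
  have h4 : ‖η‖ + ‖ξ‖ ≤ 3 * ‖η‖ := by linarith [hn.1]
  rw [e, abs_mul, abs_mul, abs_mul, abs_mul, abs_of_pos hε,
    abs_of_nonneg (by positivity : 0 ≤ ‖η‖ + ‖ξ‖)]
  calc _ ≤ ε * (‖ξ - η‖ * (3 * ‖η‖)) * |mHi φ ε η| * (2 * ‖η‖) := by gcongr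
    _ = 6 * ‖ξ - η‖ * (|mHi φ ε η| * (ε * ‖η‖ ^ 2)) := by ring
    _ ≤ 6 * ‖ξ - η‖ * 2 := by gcongr
    _ = _ := by ring

theorem remSymA_bound (hφ : IsCutoff φ) (hN : 0 ≤ N) (hε : 0 < ε) (k : Fin 2) (ξ η : Plane) :
    jap ξ ^ N * ‖((remSymA φ ε k ξ η : ℝ) : ℂ)‖
      ≤ (155 ^ N * 155 + 2 ^ N * 7) * (jap (ξ - η) ^ (1 : ℝ) * jap η ^ N) := by
  have h1 := rhoSym_bound hφ hN ξ η
  -- Here `7 = 12/2 + 2/2`, from the commutator and from the difference of directions.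
  have h2 := paraSym_mul_bound hφ hN (a := 1) (r := 0) (c := 7) (by norm_num)
    (t := fun ξ η => 1 / 2 * (ε * (‖η‖ ^ 2 - ‖ξ‖ ^ 2) * mHi φ ε η * ξ k)
      + 1 / 2 * (‖ξ‖ * η k / ‖η‖ - ξ k)) (fun ξ η hn hη _ => by
        have e1 := abs_sub_sq_mul_le hφ hε hn k
        have e2 := abs_unit_sub_le (ξ := ξ) hη k
        have e3 := norm_sub_le_jap ξ η
        rw [Real.rpow_zero, mul_one]
        refine (abs_add_le _ _).trans ?_
        rw [abs_mul (1 / 2), abs_mul (1 / 2), abs_of_pos (by norm_num : (0 : ℝ) < 1 / 2)]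
        linarith) ξ η
  rw [add_zero] at h2
  rw [Complex.norm_real, Real.norm_eq_abs, remSymA, add_mul (155 ^ N * 155)]
  have h3 := jap_rpow_pos N ξ
  refine (mul_le_mul_of_nonneg_left (abs_add_le _ _) h3.le).trans ?_
  rw [mul_add]
  refine add_le_add (le_trans ?_ h1) h2
  rw [abs_neg, abs_mul]
  gcongr
  exact abs_apply_le ξ k

theorem unit_ratio_le (ξ η : Plane) (k : Fin 2) : |‖ξ‖ * η k / ‖η‖| ≤ ‖ξ‖ := by
  rw [abs_div, abs_mul, abs_norm, abs_norm]
  refine div_le_of_le_mul₀ (norm_nonneg _) (norm_nonneg _) ?_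
  gcongr
  exact abs_apply_le η k

theorem abs_coord_div_le (ξ : Plane) (k : Fin 2) : |ξ k / ‖ξ‖| ≤ 1 := by
  rw [abs_div, abs_norm]
  exact div_le_one_of_le₀ (abs_apply_le ξ k) (norm_nonneg _)

/-- One derivative is lost, but with a factor `ε`; both are repaid by the `H^{N+1}` norm of `b`,
which is of order `1/ε`. -/
theorem remSymB_bound (hφ : IsCutoff φ) (hN : 0 ≤ N) (hε : 0 < ε) (k : Fin 2) (ξ η : Plane) :
    jap ξ ^ N * ‖((remSymB φ ε k ξ η : ℝ) : ℂ)‖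
      ≤ 2 ^ N * (2 * ε) * (jap (ξ - η) ^ (0 : ℝ) * jap η ^ (N + 1)) := by
  rw [Complex.norm_real, Real.norm_eq_abs, remSymB]
  refine paraSym_mul_bound hφ hN (a := 0) (r := 1) (c := 2 * ε) (by positivity)
    (t := fun ξ η => 1 / 2 * (ε * (‖ξ‖ * η k / ‖η‖ + phiLE φ 5 (Real.sqrt ε * ‖η‖) * ξ k)))
    (fun ξ η hn hη _ => ?_) ξ η
  have e1 := unit_ratio_le ξ η k
  have e2 : |phiLE φ 5 (Real.sqrt ε * ‖η‖) * ξ k| ≤ ‖ξ‖ := by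
    rw [abs_mul, abs_of_nonneg (phiLE_nonneg hφ _ _)]
    exact (mul_le_of_le_one_left (abs_nonneg _) (phiLE_le_one hφ _ _)).trans (abs_apply_le ξ k)
  have e3 := (abs_add_le (‖ξ‖ * η k / ‖η‖) (phiLE φ 5 (Real.sqrt ε * ‖η‖) * ξ k))
  have e4 : ‖ξ‖ ≤ 2 * jap η := hn.1.trans (by linarith [norm_le_jap η])
  rw [Real.rpow_zero, Real.rpow_one, one_mul, abs_mul, abs_mul, abs_of_pos hε]
  norm_num
  calc _ ≤ 1 / 2 * (ε * (4 * jap η)) := by gcongr; linarith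
    _ = _ := by ring

theorem remSymC_bound (hφ : IsCutoff φ) (hN : 0 ≤ N) (ξ η : Plane) :
    jap ξ ^ N * ‖((remSymC φ ξ η : ℝ) : ℂ)‖
      ≤ (155 ^ N * 155) * (jap (ξ - η) ^ (1 : ℝ) * jap η ^ N) := by
  have h1 := rhoSym_bound hφ hN ξ η
  have h3 := jap_rpow_pos N ξ
  have h4 : 0 ≤ jap ξ ^ N * (‖ξ‖ * |rhoSym φ ξ η|) := by positivity
  rw [Complex.norm_real, Real.norm_eq_abs, remSymC, abs_mul, abs_mul, abs_norm,
    abs_of_pos (by norm_num : (0 : ℝ) < 1 / 2)]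
  linarith

theorem remSymD_bound (hφ : IsCutoff φ) (hN : 0 ≤ N) (hε : 0 < ε) (k : Fin 2) (ξ η : Plane) :
    jap ξ ^ N * ‖((remSymD φ ε k ξ η : ℝ) : ℂ)‖
      ≤ 2 ^ N * 1 * (jap (ξ - η) ^ (0 : ℝ) * jap η ^ N) := by
  have := paraSym_mul_bound hφ hN (a := 0) (r := 0) (c := 1) zero_le_one
    (t := fun ξ η => 1 / 2 * (ξ k / ‖ξ‖ * mHi φ ε η)) (fun ξ η hn hη _ => by
      have e1 := abs_coord_div_le ξ k
      have e2 := abs_mHi_le_two hφ hε η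
      rw [Real.rpow_zero, Real.rpow_zero, abs_mul, abs_mul]
      norm_num
      calc 1 / 2 * (|ξ k / ‖ξ‖| * |mHi φ ε η|) ≤ 1 / 2 * (1 * 2) := by gcongr
        _ = 1 := by norm_num) ξ η
  rw [add_zero] at this
  rwa [Complex.norm_real, Real.norm_eq_abs, remSymD]

theorem remSymE_bound (hφ : IsCutoff φ) (hN : 0 ≤ N) (hε : 0 < ε) (hε1 : ε ≤ 1) (k : Fin 2)
    (ξ η : Plane) : jap ξ ^ N * ‖((remSymE φ ε k ξ η : ℝ) : ℂ)‖
      ≤ 2 ^ N * 1 * (jap (ξ - η) ^ (0 : ℝ) * jap η ^ N) := by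
  have := paraSym_mul_bound hφ hN (a := 0) (r := 0) (c := 1) zero_le_one
    (t := fun ξ η => 1 / 4 * (ξ k / ‖ξ‖ * (mHi φ ε η * (ε * η k)))) (fun ξ η hn hη _ => by
      have e1 := abs_coord_div_le ξ k
      have e2 := abs_mHi_mul_le hφ hε hε1 η
      have e3 : |mHi φ ε η * (ε * η k)| ≤ 2 := by
        rw [abs_mul, abs_mul, abs_of_pos hε]
        refine le_trans ?_ e2
        gcongr
        exact abs_apply_le η k
      rw [Real.rpow_zero, Real.rpow_zero, abs_mul (1 / 4), abs_mul (ξ k / ‖ξ‖),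
        abs_of_pos (by norm_num : (0 : ℝ) < 1 / 4), mul_one]
      calc 1 / 4 * (|ξ k / ‖ξ‖| * |mHi φ ε η * (ε * η k)|) ≤ 1 / 4 * (1 * 2) := by gcongr
        _ ≤ 1 * 1 := by norm_num) ξ η
  rw [add_zero] at this
  rwa [Complex.norm_real, Real.norm_eq_abs, remSymE]

theorem remSymF_bound (hφ : IsCutoff φ) (hN : 0 ≤ N) (k : Fin 2) (ξ η : Plane) :
    jap ξ ^ N * ‖((remSymF φ ε k ξ η : ℝ) : ℂ)‖
      ≤ 2 ^ N * 1 * (jap (ξ - η) ^ (1 : ℝ) * jap η ^ N) := by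
  have := paraSym_mul_bound hφ hN (a := 1) (r := 0) (c := 1) zero_le_one
    (t := fun ξ η => -(1 / 2) * ((1 - phiLE φ 5 (Real.sqrt ε * ‖η‖)) * (ξ k / ‖ξ‖ * (ξ k - η k))))
    (fun ξ η hn hη _ => by
      have e1 := abs_coord_div_le ξ k
      have e2 := abs_apply_le (ξ - η) k
      have e3 := norm_sub_le_jap ξ η
      have e4 : |1 - phiLE φ 5 (Real.sqrt ε * ‖η‖)| ≤ 1 := by
        rw [abs_le]
        constructor <;> linarith [phiLE_le_one hφ 5 (Real.sqrt ε * ‖η‖),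
          phiLE_nonneg hφ 5 (Real.sqrt ε * ‖η‖)]
      rw [PiLp.sub_apply] at e2
      rw [Real.rpow_zero, abs_mul, abs_mul, abs_mul]
      norm_num
      calc 1 / 2 * (|1 - phiLE φ 5 (Real.sqrt ε * ‖η‖)| * (|ξ k / ‖ξ‖| * |ξ k - η k|))
          ≤ 1 / 2 * (1 * (1 * ‖ξ - η‖)) := by gcongr
        _ ≤ _ := by rw [Real.rpow_one] at e3; linarith [norm_nonneg (ξ - η)]) ξ η
  rw [add_zero] at this
  rwa [Complex.norm_real, Real.norm_eq_abs, remSymF]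

theorem remSymG_bound (hφ : IsCutoff φ) (hN : 0 ≤ N) (k : Fin 2) (ξ η : Plane) :
    jap ξ ^ N * ‖((remSymG φ k ξ η : ℝ) : ℂ)‖
      ≤ 2 ^ N * 2 * (jap (ξ - η) ^ (1 : ℝ) * jap η ^ N) := by
  have := paraSym_mul_bound hφ hN (a := 1) (r := 0) (c := 2) zero_le_two
    (t := fun ξ η => ‖ξ‖ * η k / ‖η‖ - ξ k)
    (fun ξ η hn hη _ => by
      have e2 := abs_unit_sub_le (ξ := ξ) hη k
      have e3 := norm_sub_le_jap ξ η
      rw [Real.rpow_zero]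
      linarith) ξ η
  rw [add_zero] at this
  rwa [Complex.norm_real, Real.norm_eq_abs, remSymG]

theorem remSymH_bound (hφ : IsCutoff φ) (hN : 0 ≤ N) (hε : 0 < ε) (ξ η : Plane) :
    jap ξ ^ N * ‖((remSymH φ ε ξ η : ℝ) : ℂ)‖
      ≤ 2 ^ N * (2 * ε) * (jap (ξ - η) ^ (0 : ℝ) * jap η ^ (N + 1)) := by
  rw [Complex.norm_real, Real.norm_eq_abs, remSymH]
  refine paraSym_mul_bound hφ hN (a := 0) (r := 1) (c := 2 * ε) (by positivity)
    (t := fun ξ η => -(ε * ‖ξ‖)) (fun ξ η hn hη _ => ?_) ξ η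
  have e4 : ‖ξ‖ ≤ 2 * jap η := hn.1.trans (by linarith [norm_le_jap η])
  rw [Real.rpow_zero, Real.rpow_one, one_mul, abs_neg, abs_mul, abs_of_pos hε, abs_norm]
  nlinarith

end Quadratic

/-! ### The remainder of the equation of `V` -/

/-- `f` is integrable with integral `I`. -/
def HasInt (f : Plane → ℂ) (I : ℂ) : Prop := Integrable f volume ∧ ∫ η, f η = I

namespace HasInt

variable {f g : Plane → ℂ} {I J : ℂ}

theorem of_bil {q : Plane → Plane → ℂ} {F G : Plane → ℂ} {ξ : Plane}
    (h : Integrable (fun η => q ξ η * F (ξ - η) * G η) volume) :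
    HasInt (fun η => q ξ η * F (ξ - η) * G η) (bil q F G ξ) := ⟨h, rfl⟩

theorem add (hf : HasInt f I) (hg : HasInt g J) : HasInt (fun η => f η + g η) (I + J) :=
  ⟨hf.1.add hg.1, by rw [integral_add hf.1 hg.1, hf.2, hg.2]⟩

theorem sub (hf : HasInt f I) (hg : HasInt g J) : HasInt (fun η => f η - g η) (I - J) :=
  ⟨hf.1.sub hg.1, by rw [integral_sub hf.1 hg.1, hf.2, hg.2]⟩

theorem mul (c : ℂ) (hf : HasInt f I) : HasInt (fun η => c * f η) (c * I) :=
  ⟨hf.1.const_mul c, by rw [integral_const_mul, hf.2]⟩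

theorem sum {ι : Type*} (t : Finset ι) {f : ι → Plane → ℂ} {I : ι → ℂ}
    (hf : ∀ i, HasInt (f i) (I i)) : HasInt (fun η => ∑ i ∈ t, f i η) (∑ i ∈ t, I i) :=
  ⟨integrable_finsetSum t fun i _ => (hf i).1, by
    rw [integral_finsetSum t fun i _ => (hf i).1]
    exact Finset.sum_congr rfl fun i _ => (hf i).2⟩

theorem unique (hf : HasInt f I) (hg : HasInt g J) (h : f =ᵐ[volume] g) : I = J := by
  rw [← hf.2, ← hg.2, integral_congr_ae h]

end HasInt

/-- The integrand of the quadratic terms at fixed `(ξ, η)`, as a polynomial identity. Dictionary: `X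
= |ξ|`, `Xi = |ξ|⁻¹`, `n = |η|`, `ni = |η|⁻¹`, `d = |ξ - η|⁻¹`, `c = χ`, `r` is the symbol of the
comparable frequencies, `m = mHi`, `p` is the low-frequency cut-off. Lower-case `z, w, b, u` are `ζ,
w, b, v` at `ξ - η`, and upper-case letters are the same functions at `η`. -/
theorem quadratic_algebra {i e X Xi x0 x1 n ni n0 n1 d c r m p z w b0 b1 u0 u1 Z W B0 B1 U0 U1 : ℂ}
    (hi : i * i = -1) (hX : Xi * (x0 ^ 2 + x1 ^ 2) = X) (hn : ni ^ 2 * (n0 ^ 2 + n1 ^ 2) = 1)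
    (hm : m * (1 - e * n ^ 2) = 1 - p) (hu0 : u0 = -(i * (x0 - n0) * d) * w - e * b0)
    (hu1 : u1 = -(i * (x1 - n1) * d) * w - e * b1)
    (hU0 : U0 = -(i * n0 * ni) * W - e * B0)
    (hU1 : U1 = -(i * n1 * ni) * W - e * B1) :
    e / 2 * (1 - e * X ^ 2) * (i * x0 * (c * m * z * U0) + i * x1 * (c * m * z * U1))
    - e * (i * x0 * (c * z * U0 + c * u0 * Z + r * z * U0) + i * x1 * (c * z * U1 + c * u1 * Z + r * z * U1))
    + i * (e / 2) * X * (2 * (c * u0 * U0) + r * u0 * U0 + (2 * (c * u1 * U1) + r * u1 * U1))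
    - i * (e / 2) * (i * x0 * Xi * (c * m * ((1 - e * n ^ 2) * (i * n0)) * z * Z)
      + i * x1 * Xi * (c * m * ((1 - e * n ^ 2) * (i * n1)) * z * Z))
    - (i * (e * (1 / 2 * ((x0 * (x0 - n0) + x1 * (x1 - n1)) * d) + 1 / 4 * X) * c) * (z + i * w) * (Z + i * W)
      + i * (e * (-1 * (1 / 2) * ((x0 * (x0 - n0) + x1 * (x1 - n1)) * d) + 1 / 4 * X) * c) * (z - i * w) * (Z + i * W))
    - (i * (e / 8 * (x0 * (ni * n0 - Xi * x0) + x1 * (ni * n1 - Xi * x1)) * p * c) * (z + i * w) * (Z + i * W)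
     + i * (e / 8 * (x0 * (-(ni * n0) - Xi * x0) + x1 * (-(ni * n1) - Xi * x1)) * p * c) * (z + i * w) * (Z - i * W)
     + (i * (e / 8 * (x0 * (ni * n0 - Xi * x0) + x1 * (ni * n1 - Xi * x1)) * p * c) * (z - i * w) * (Z + i * W)
     + i * (e / 8 * (x0 * (-(ni * n0) - Xi * x0) + x1 * (-(ni * n1) - Xi * x1)) * p * c) * (z - i * w) * (Z - i * W)))
    - e ^ 2 * (i * x0 * (c * b0 * (Z + i * W)) + i * x1 * (c * b1 * (Z + i * W)))
    = i * e * ((-(x0 * r) + (1 / 2 * (e * (n ^ 2 - X ^ 2) * m * x0) + 1 / 2 * (X * n0 * ni - x0)) * c) * z * U0)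
      + i * e * (1 / 2 * (e * (X * n0 * ni + p * x0)) * c * z * B0)
      + i * e * (1 / 2 * (X * r) * u0 * U0)
      + i * e * (-(1 / 2) * ((1 - p) * (x0 * Xi * (x0 - n0))) * c * z * Z)
      + e * ((X * n0 * ni - x0) * c * u0 * W)
      + i * e * (-(e * X) * c * u0 * B0)
      + (i * e * ((-(x1 * r) + (1 / 2 * (e * (n ^ 2 - X ^ 2) * m * x1) + 1 / 2 * (X * n1 * ni - x1)) * c) * z * U1)
      + i * e * (1 / 2 * (e * (X * n1 * ni + p * x1)) * c * z * B1)
      + i * e * (1 / 2 * (X * r) * u1 * U1)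
      + i * e * (-(1 / 2) * ((1 - p) * (x1 * Xi * (x1 - n1))) * c * z * Z)
      + e * ((X * n1 * ni - x1) * c * u1 * W)
      + i * e * (-(e * X) * c * u1 * B1)) := by
  have hi2 : i ^ 2 = -1 := by rw [sq, hi]
  have hi3 : i ^ 3 = -i := by rw [pow_succ, hi2]; ring
  rw [← sub_eq_zero]
  -- The two sides differ by this combination of the constraints. The relation for `m` is used
  -- twice: for `(1 + εΔ)∇·B^ε`, against `U`, and for the linear part of `∂_t v` inside `B^ε`,
  -- against `Z`. The other two normalize `|ξ|` and `|η|`.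
  have key : (i * e / 2 * c * z * Z * Xi * (x0 * n0 + x1 * n1)
      + i * e / 2 * c * z * (x0 * U0 + x1 * U1)) * (m * (1 - e * n ^ 2) - (1 - p))
      + i * e / 2 * c * z * Z * (Xi * (x0 ^ 2 + x1 ^ 2) - X)
      - e / 2 * c * X * z * W * (ni ^ 2 * (n0 ^ 2 + n1 ^ 2) - 1) = 0 := by
    rw [hm, hX, hn]; ring
  rw [← key]
  subst hu0 hu1 hU0 hU1
  ring_nf
  simp only [hi2, hi3]
  ring

section Remainder

variable {φ : ℝ → ℝ} {ε N : ℝ}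

theorem zero_bound_of_le_one {q : Plane → Plane → ℝ} (h : ∀ ξ η, |q ξ η| ≤ 1) (ξ η : Plane) :
    jap ξ ^ (0 : ℝ) * ‖((q ξ η : ℝ) : ℂ)‖ ≤ 1 * (jap (ξ - η) ^ (0 : ℝ) * jap η ^ (0 : ℝ)) := by
  simpa using h ξ η

theorem integrable_real_symbol {q : Plane → Plane → ℝ} (hq : Measurable fun p : Plane × Plane => q p.1 p.2)
    (h : ∀ ξ η, |q ξ η| ≤ 1) {f g : L2} (hf : Integrable (hat f) volume) :
    ∀ᵐ ξ : Plane, Integrable (fun η => ((q ξ η : ℝ) : ℂ) * hat f (ξ - η) * hat g η) volume :=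
  integrable_bil (q := fun ξ η => ((q ξ η : ℝ) : ℂ)) (measurable_ofReal_symbol hq) (zero_bound_of_le_one h) (aesm_hat f) (aesm_hat g)
    (wNorm_zero_ne_top hf) (sNorm_zero_hat_ne_top g)

theorem abs_swap_paraSym_le_one (hφ : IsCutoff φ) (ξ η : Plane) : |paraSym φ ξ (ξ - η)| ≤ 1 :=
  abs_paraSym_le_one hφ _ _

/-- The paraproduct decomposition of a product. -/
theorem hat_prod_split (hφ : IsCutoff φ) {f g : L2} (hf : Integrable (hat f) volume)
    (hg : Integrable (hat g) volume) : ∀ᵐ ξ : Plane, hat (prod f g) ξ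
      = convC * (bil (fun ξ η => ((paraSym φ ξ η : ℝ) : ℂ)) (hat f) (hat g) ξ
        + bil (fun ξ η => ((paraSym φ ξ η : ℝ) : ℂ)) (hat g) (hat f) ξ
        + bil (fun ξ η => ((rhoSym φ ξ η : ℝ) : ℂ)) (hat f) (hat g) ξ) := by
  filter_upwards [hat_prod_eq_bil hf hg,
    integrable_real_symbol (measurable_paraSym hφ) (abs_paraSym_le_one hφ) (g := g) hf,
    integrable_real_symbol (measurable_comp_sub (measurable_paraSym hφ))
      (abs_swap_paraSym_le_one hφ) (g := g) hf,
    integrable_real_symbol (measurable_rhoSym hφ) (abs_rhoSym_le_one hφ) (g := g) hf] with ξ h0 h1 h2 h3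
  rw [h0, bil_swap (fun ξ η => ((paraSym φ ξ η : ℝ) : ℂ)) (hat g) (hat f)]
  congr 1
  have h123 := ((HasInt.of_bil (q := fun ξ η => ((paraSym φ ξ η : ℝ) : ℂ)) h1).add
    (HasInt.of_bil (q := fun ξ η => ((paraSym φ ξ (ξ - η) : ℝ) : ℂ)) h2)).add
    (HasInt.of_bil (q := fun ξ η => ((rhoSym φ ξ η : ℝ) : ℂ)) h3)
  rw [← h123.2]
  refine integral_congr_ae (ae_of_all _ fun η => ?_)
  simp only [rhoSym]
  push_cast
  ring

/-- The symbol of the quadratic term coming from the linear part of the equation of `v`. -/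
noncomputable def linSym (φ : ℝ → ℝ) (ε : ℝ) (k : Fin 2) (ξ η : Plane) : ℂ :=
  bSym φ ε ξ η * (lapSym ε η * dSym k η)

theorem norm_bSym_le (hφ : IsCutoff φ) (hε : 0 < ε) (ξ η : Plane) : ‖bSym φ ε ξ η‖ ≤ 2 := by
  rw [bSym, Complex.norm_real, Real.norm_eq_abs, abs_mul]
  have h1 := abs_paraSym_le_one hφ ξ η
  have h2 := abs_mHi_le_two hφ hε η
  calc |paraSym φ ξ η| * |mHi φ ε η| ≤ 1 * 2 := by gcongr
    _ = 2 := one_mul 2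

theorem measurable_linSym (hφ : IsCutoff φ) (ε : ℝ) (k : Fin 2) :
    Measurable fun p : Plane × Plane => linSym φ ε k p.1 p.2 :=
  (measurable_bSym hφ ε).mul (((measurable_lapSym ε).mul (measurable_dSym k)).comp measurable_snd)

theorem bSym_bound_zero (hφ : IsCutoff φ) (hε : 0 < ε) (ξ η : Plane) :
    jap ξ ^ (0 : ℝ) * ‖bSym φ ε ξ η‖ ≤ 2 * (jap (ξ - η) ^ (0 : ℝ) * jap η ^ (0 : ℝ)) := by
  simpa using norm_bSym_le hφ hε ξ η

theorem linSym_bound (hφ : IsCutoff φ) (hε : 0 < ε) (hε1 : ε ≤ 1) (k : Fin 2) (ξ η : Plane) :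
    jap ξ ^ (0 : ℝ) * ‖linSym φ ε k ξ η‖ ≤ 2 * (jap (ξ - η) ^ (0 : ℝ) * jap η ^ (3 : ℝ)) := by
  rw [Real.rpow_zero, Real.rpow_zero, one_mul, one_mul, linSym, norm_mul]
  have h1 := norm_lapSym_mul_dSym_le hε hε1 k η
  rw [one_mul] at h1
  gcongr
  exact norm_bSym_le hφ hε ξ η

variable {ζ : L2} {v : Fin 2 → L2}

/-- The remainder on the Fourier side, up to a factor: the sum of its bilinear pieces. -/
noncomputable def remHat (φ : ℝ → ℝ) (ε : ℝ) (ζ : L2) (v : Fin 2 → L2) (ξ : Plane) : ℂ :=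
  ∑ k, (Complex.I * ε * bil (fun ξ η => ((remSymA φ ε k ξ η : ℝ) : ℂ)) (hat ζ) (hat (v k)) ξ
    + Complex.I * ε * bil (fun ξ η => ((remSymB φ ε k ξ η : ℝ) : ℂ)) (hat ζ) (hat (gradB φ ε ζ v k)) ξ
    + Complex.I * ε * bil (fun ξ η => ((remSymC φ ξ η : ℝ) : ℂ)) (hat (v k)) (hat (v k)) ξ
    + Complex.I * ε * bil (fun ξ η => ((remSymF φ ε k ξ η : ℝ) : ℂ)) (hat ζ) (hat ζ) ξ
    + ε * bil (fun ξ η => ((remSymG φ k ξ η : ℝ) : ℂ)) (hat (v k)) (hat (wave φ ε ζ v)) ξ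
    + Complex.I * ε * bil (fun ξ η => ((remSymH φ ε ξ η : ℝ) : ℂ)) (hat (v k)) (hat (gradB φ ε ζ v k)) ξ)

namespace IsProfile

variable (h : IsProfile φ ε N ζ v)
include h

theorem memH_pm_goodV (μ : ℤˣ) : MemH N (pm μ (goodV φ ε ζ v)) :=
  memH_pm (by linarith [h.five_le]) h.memH_goodV μ

theorem int_pm_goodV (μ : ℤˣ) : Integrable (hat (pm μ (goodV φ ε ζ v))) volume :=
  (h.memH_pm_goodV μ).integrable (by linarith [h.five_le])

theorem integrable_of_bound {q : Plane → Plane → ℂ} (hq : Measurable fun p : Plane × Plane => q p.1 p.2)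
    {s a r C : ℝ} (hb : ∀ ξ η, jap ξ ^ s * ‖q ξ η‖ ≤ C * (jap (ξ - η) ^ a * jap η ^ r)) {f g : L2}
    (ha : a ≤ 1) (hf : MemH N f) (hg : MemH r g) :
    ∀ᵐ ξ : Plane, Integrable (fun η => q ξ η * hat f (ξ - η) * hat g η) volume :=
  integrable_bil hq hb (aesm_hat f) (aesm_hat g) (hf.wNorm_ne_top (by linarith [h.five_le]))
    (memH_iff.1 hg)

theorem hasInt_of_bound {q : Plane → Plane → ℂ} (hq : Measurable fun p : Plane × Plane => q p.1 p.2)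
    {s a r C : ℝ} (hb : ∀ ξ η, jap ξ ^ s * ‖q ξ η‖ ≤ C * (jap (ξ - η) ^ a * jap η ^ r)) {f g : L2}
    (ha : a ≤ 1) (hf : MemH N f) (hg : MemH r g) :
    ∀ᵐ ξ : Plane, HasInt (fun η => q ξ η * hat f (ξ - η) * hat g η) (bil q (hat f) (hat g) ξ) :=
  (h.integrable_of_bound hq hb ha hf hg).mono fun _ hi => HasInt.of_bil hi

theorem hasInt_real {q : Plane → Plane → ℝ} (hq : Measurable fun p : Plane × Plane => q p.1 p.2)
    {s a r C : ℝ} (hb : ∀ ξ η, jap ξ ^ s * ‖((q ξ η : ℝ) : ℂ)‖ ≤ C * (jap (ξ - η) ^ a * jap η ^ r))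
    {f g : L2} (ha : a ≤ 1) (hf : MemH N f) (hg : MemH r g) :
    ∀ᵐ ξ : Plane, HasInt (fun η => ((q ξ η : ℝ) : ℂ) * hat f (ξ - η) * hat g η)
      (bil (fun ξ η => ((q ξ η : ℝ) : ℂ)) (hat f) (hat g) ξ) :=
  h.hasInt_of_bound (q := fun ξ η => ((q ξ η : ℝ) : ℂ)) (measurable_ofReal_symbol hq) hb ha hf hg

set_option maxHeartbeats 400000 in
/-- The cancellations among the quadratic terms of the equation of `V`. -/
theorem quadratic_identity : ∀ᵐ ξ : Plane,
    (ε / 2 : ℂ) * lapSym ε ξ * ∑ k, dSym k ξ * bil (bSym φ ε) (hat ζ) (hat (v k)) ξ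
    - ε * ∑ k, dSym k ξ * (bil (fun ξ η => ((paraSym φ ξ η : ℝ) : ℂ)) (hat ζ) (hat (v k)) ξ
        + bil (fun ξ η => ((paraSym φ ξ η : ℝ) : ℂ)) (hat (v k)) (hat ζ) ξ
        + bil (fun ξ η => ((rhoSym φ ξ η : ℝ) : ℂ)) (hat ζ) (hat (v k)) ξ)
    + Complex.I * (ε / 2) * (‖ξ‖ : ℂ) * ∑ k,
      (2 * bil (fun ξ η => ((paraSym φ ξ η : ℝ) : ℂ)) (hat (v k)) (hat (v k)) ξ
        + bil (fun ξ η => ((rhoSym φ ξ η : ℝ) : ℂ)) (hat (v k)) (hat (v k)) ξ)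
    - Complex.I * (ε / 2) * ∑ k, dSym k ξ / (‖ξ‖ : ℂ) * bil (linSym φ ε k) (hat ζ) (hat ζ) ξ
    - ∑ μ : ℤˣ, bil (sSym φ ε μ) (hat (pm μ (goodV φ ε ζ v))) (hat (pm 1 (goodV φ ε ζ v))) ξ
    - ∑ μ : ℤˣ, ∑ ν : ℤˣ, bil (qSym φ ε μ ν) (hat (pm μ (goodV φ ε ζ v))) (hat (pm ν (goodV φ ε ζ v))) ξ
    - ε ^ 2 * ∑ k, dSym k ξ * bil (fun ξ η => ((paraSym φ ξ η : ℝ) : ℂ)) (hat (gradB φ ε ζ v k))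
        (hat (goodV φ ε ζ v)) ξ
    = remHat φ ε ζ v ξ := by
  have hφ := h.cutoff
  have hε := h.pos
  have hε1 := h.le_one
  have hN := h.five_le
  have hN0 := h.nonneg
  have mz := h.mem_zeta
  have mv := h.mem_v
  have mb := h.memH_gradB
  have mbN : ∀ k, MemH N (gradB φ ε ζ v k) := fun k => (mb k).mono (by linarith)
  have mw := h.memH_wave
  have mV := h.memH_goodV
  have mp := h.memH_pm_goodV
  have rA := fun k => h.hasInt_real (measurable_remSymA hφ ε k)
    (remSymA_bound hφ hN0 hε k) le_rfl mz (mv k)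
  have rB := fun k => h.hasInt_real (measurable_remSymB hφ ε k)
    (remSymB_bound hφ hN0 hε k) zero_le_one mz (mb k)
  have rC := fun k => h.hasInt_real (measurable_remSymC hφ)
    (remSymC_bound hφ hN0) le_rfl (mv k) (mv k)
  have rF := fun k => h.hasInt_real (measurable_remSymF hφ ε k)
    (remSymF_bound hφ hN0 k) le_rfl mz mz
  have rG := fun k => h.hasInt_real (measurable_remSymG hφ k)
    (remSymG_bound hφ hN0 k) le_rfl (mv k) mw
  have rH := fun k => h.hasInt_real (measurable_remSymH hφ ε)
    (remSymH_bound hφ hN0 hε) zero_le_one (mv k) (mb k)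
  have lA := fun k => h.hasInt_of_bound (measurable_bSym hφ ε) (bSym_bound_zero hφ hε) zero_le_one
    mz ((mv k).mono (r := 0) hN0)
  have lc := fun k => h.hasInt_real (measurable_paraSym hφ) (zero_bound_of_le_one (abs_paraSym_le_one hφ)) zero_le_one
    mz ((mv k).mono hN0)
  have ld := fun k => h.hasInt_real (measurable_paraSym hφ) (zero_bound_of_le_one (abs_paraSym_le_one hφ)) zero_le_one
    (mv k) (mz.mono hN0)
  have lρ := fun k => h.hasInt_real (measurable_rhoSym hφ) (zero_bound_of_le_one (abs_rhoSym_le_one hφ)) zero_le_one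
    mz ((mv k).mono hN0)
  have lee := fun k => h.hasInt_real (measurable_paraSym hφ) (zero_bound_of_le_one (abs_paraSym_le_one hφ)) zero_le_one
    (mv k) ((mv k).mono hN0)
  have lr := fun k => h.hasInt_real (measurable_rhoSym hφ) (zero_bound_of_le_one (abs_rhoSym_le_one hφ)) zero_le_one
    (mv k) ((mv k).mono hN0)
  have lg := fun k => h.hasInt_of_bound (measurable_linSym hφ ε k) (linSym_bound hφ hε hε1 k) zero_le_one
    mz (mz.mono (r := 3) (by linarith))
  have lS := fun μ => h.hasInt_of_bound (measurable_sSym hφ ε μ) (sSym_bound hφ hε hε1 μ) zero_le_one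
    (mp μ) ((mp 1).mono (r := 1) (by linarith))
  have lQ := fun μ ν => h.hasInt_of_bound (measurable_qSym hφ ε μ ν) (qSym_bound_zero hφ hε hε1 μ ν)
    zero_le_one (mp μ) ((mp ν).mono (r := 1) (by linarith))
  have lC := fun k => h.hasInt_real (measurable_paraSym hφ) (zero_bound_of_le_one (abs_paraSym_le_one hφ)) zero_le_one
    (mbN k) (mV.mono hN0)
  filter_upwards [ae_ne_zero, ae_all_iff.2 rA, ae_all_iff.2 rB, ae_all_iff.2 rC, ae_all_iff.2 rF,
    ae_all_iff.2 rG, ae_all_iff.2 rH, ae_all_iff.2 lA, ae_all_iff.2 lc, ae_all_iff.2 ld,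
    ae_all_iff.2 lρ, ae_all_iff.2 lee, ae_all_iff.2 lr, ae_all_iff.2 lg, ae_all_iff.2 lS,
    ae_all_iff.2 fun μ => ae_all_iff.2 (lQ μ), ae_all_iff.2 lC]
    with ξ hξ iA iB iC iF iG iH jA jc jd jρ je jr jg jS jQ jC
  have HR := HasInt.sum Finset.univ fun k : Fin 2 =>
    ((((((iA k).mul (Complex.I * ε)).add ((iB k).mul (Complex.I * ε))).add
      ((iC k).mul (Complex.I * ε))).add
      ((iF k).mul (Complex.I * ε))).add
      ((iG k).mul (ε : ℂ))).add
      ((iH k).mul (Complex.I * ε))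
  have HL := (((((((HasInt.sum Finset.univ fun k : Fin 2 => (jA k).mul (dSym k ξ)).mul
      ((ε / 2 : ℂ) * lapSym ε ξ)).sub
    ((HasInt.sum Finset.univ fun k : Fin 2 =>
      (((jc k).add
        (jd k)).add
        (jρ k)).mul (dSym k ξ)).mul (ε : ℂ))).add
    ((HasInt.sum Finset.univ fun k : Fin 2 =>
      ((je k).mul 2).add
        (jr k)).mul
        (Complex.I * (ε / 2) * (‖ξ‖ : ℂ)))).sub
    ((HasInt.sum Finset.univ fun k : Fin 2 => (jg k).mul (dSym k ξ / (‖ξ‖ : ℂ))).mul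
        (Complex.I * (ε / 2)))).sub
    (HasInt.sum Finset.univ fun μ : ℤˣ => (jS μ))).sub
    (HasInt.sum Finset.univ fun μ : ℤˣ => HasInt.sum Finset.univ fun ν : ℤˣ => (jQ μ ν))).sub
    ((HasInt.sum Finset.univ fun k : Fin 2 =>
      (jC k).mul (dSym k ξ)).mul ((ε : ℂ) ^ 2))
  -- For this `ξ` both sides are integrals over `η` of known integrable functions, so the identity
  -- only has to be checked for almost every `η`.
  refine HL.unique HR ?_
  have hV1 := h.hat_pm 1
  have hV2 := h.hat_pm (-1)
  have hv0 := h.hat_v_eq 0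
  have hv1 := h.hat_v_eq 1
  filter_upwards [ae_ne_zero, hv0, hv1, ae_sub_left hv0 ξ, ae_sub_left hv1 ξ, hV1, hV2, h.hat_goodV,
    ae_sub_left hV1 ξ, ae_sub_left hV2 ξ] with η hη v0 v1 v0' v1' p1 p2 pV p1' p2'
  have eu : (Finset.univ : Finset ℤˣ) = {1, -1} := by decide
  have hne : (1 : ℤˣ) ≠ -1 := by decide
  have hX : ((‖ξ‖ : ℂ))⁻¹ * ((ξ 0 : ℂ) ^ 2 + (ξ 1 : ℂ) ^ 2) = (‖ξ‖ : ℂ) := by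
    have e : (ξ 0 : ℂ) ^ 2 + (ξ 1 : ℂ) ^ 2 = (‖ξ‖ : ℂ) ^ 2 := by exact_mod_cast (norm_sq_eq ξ).symm
    have h0 : (‖ξ‖ : ℂ) ≠ 0 := by exact_mod_cast norm_ne_zero_iff.2 hξ
    rw [e, sq, inv_mul_cancel_left₀ h0]
  have hn : ((‖η‖ : ℂ))⁻¹ ^ 2 * ((η 0 : ℂ) ^ 2 + (η 1 : ℂ) ^ 2) = 1 := by
    have e : (η 0 : ℂ) ^ 2 + (η 1 : ℂ) ^ 2 = (‖η‖ : ℂ) ^ 2 := by exact_mod_cast (norm_sq_eq η).symm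
    have h0 : (‖η‖ : ℂ) ≠ 0 := by exact_mod_cast norm_ne_zero_iff.2 hη
    rw [e, inv_pow, inv_mul_cancel₀ (pow_ne_zero 2 h0)]
  have hm : (mHi φ ε η : ℂ) * (1 - ε * (‖η‖ : ℂ) ^ 2) = 1 - (phiLE φ 5 (Real.sqrt ε * ‖η‖) : ℂ) := by
    exact_mod_cast mHi_mul_lap hφ hε η
  have hS : ∀ a b : Plane, inner ℝ a b = a 0 * b 0 + a 1 * b 1 := fun a b => by
    rw [PiLp.inner_apply, Fin.sum_univ_two]
    simp [mul_comm]
  have key := quadratic_algebra (e := (ε : ℂ)) (c := (paraSym φ ξ η : ℂ)) (r := (rhoSym φ ξ η : ℂ))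
    (z := hat ζ (ξ - η)) (Z := hat ζ η) (d := ((‖ξ - η‖ : ℂ))⁻¹)
    Complex.I_mul_I hX hn hm (u0 := hat (v 0) (ξ - η)) (u1 := hat (v 1) (ξ - η))
    (U0 := hat (v 0) η) (U1 := hat (v 1) η) (w := hat (wave φ ε ζ v) (ξ - η)) (W := hat (wave φ ε ζ v) η)
    (b0 := hat (gradB φ ε ζ v 0) (ξ - η)) (b1 := hat (gradB φ ε ζ v 1) (ξ - η))
    (B0 := hat (gradB φ ε ζ v 0) η) (B1 := hat (gradB φ ε ζ v 1) η)
    (by rw [v0', dSym, PiLp.sub_apply]; push_cast; ring) (by rw [v1', dSym, PiLp.sub_apply]; push_cast; ring)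
    (by rw [v0, dSym]; ring) (by rw [v1, dSym]; ring)
  simp only [Fin.sum_univ_two, eu, Finset.sum_pair hne, p1, p2, pV, p1', p2', remSymA, remSymB, remSymC,
    remSymF, remSymG, remSymH, sSym, qSym, linSym, bSym, lapSym, dSym, hS, PiLp.sub_apply,
    PiLp.smul_apply, smul_eq_mul, Units.val_one, Units.val_neg, Int.cast_one, Int.cast_neg]
  push_cast
  linear_combination key

end IsProfile

end Remainder

/-! ### The equation of `V` on the Fourier side -/

section Remainder

variable {φ : ℝ → ℝ} {ε N : ℝ} {ζ : L2} {v : Fin 2 → L2}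

theorem bil_const_mul (c : Plane → ℂ) (q : Plane → Plane → ℂ) (F G : Plane → ℂ) (ξ : Plane) :
    bil (fun ξ η => c ξ * q ξ η) F G ξ = c ξ * bil q F G ξ := by
  simp only [bil, mul_assoc, integral_const_mul]

theorem bil_remSymD (k : Fin 2) (F G : Plane → ℂ) (ξ : Plane) :
    bil (fun ξ η => ((remSymD φ ε k ξ η : ℝ) : ℂ)) F G ξ
      = 1 / 2 * ((ξ k : ℂ) / (‖ξ‖ : ℂ)) * bil (bSym φ ε) F G ξ := by
  rw [← bil_const_mul (fun ξ => 1 / 2 * ((ξ k : ℂ) / (‖ξ‖ : ℂ)))]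
  refine integral_congr_ae (ae_of_all _ fun η => ?_)
  simp only [remSymD, bSym]
  push_cast
  ring

theorem bil_remSymE (k : Fin 2) (F G : Plane → ℂ) (ξ : Plane) :
    Complex.I * bil (fun ξ η => ((remSymE φ ε k ξ η : ℝ) : ℂ)) F G ξ
      = ε / 4 * ((ξ k : ℂ) / (‖ξ‖ : ℂ)) * bil (fun ξ η => bSym φ ε ξ η * dSym k η) F G ξ := by
  rw [← bil_const_mul (fun ξ => ε / 4 * ((ξ k : ℂ) / (‖ξ‖ : ℂ))), ← bil_const_mul (fun _ => Complex.I)]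
  refine integral_congr_ae (ae_of_all _ fun η => ?_)
  simp only [remSymE, bSym, dSym]
  push_cast
  ring

namespace IsProfile

variable (h : IsProfile φ ε N ζ v)
include h

/-- Inserting the equation of `v` into `∂_t B^ε` separates a linear part, which takes part in the
quadratic cancellation, from the cubic contribution of `|v|²`, which is bounded separately. -/
theorem bil_bSym_rhsV (k : Fin 2) : ∀ᵐ ξ : Plane, bil (bSym φ ε) (hat ζ) (hat (rhsV ε ζ v k)) ξ
    = -bil (linSym φ ε k) (hat ζ) (hat ζ) ξ - (ε / 2) *
      bil (fun ξ η => bSym φ ε ξ η * dSym k η) (hat ζ) (hat (∑ l, prod (v l) (v l))) ξ := by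
  have hφ := h.cutoff
  have hN := h.five_le
  have m2 : Measurable fun p : Plane × Plane => bSym φ ε p.1 p.2 * dSym k p.2 :=
    (measurable_bSym hφ ε).mul ((measurable_dSym k).comp measurable_snd)
  have b2 : ∀ ξ η : Plane, jap ξ ^ (0 : ℝ) * ‖bSym φ ε ξ η * dSym k η‖
      ≤ 2 * (jap (ξ - η) ^ (0 : ℝ) * jap η ^ (1 : ℝ)) := fun ξ η => by
    rw [Real.rpow_zero, Real.rpow_zero, one_mul, one_mul, norm_mul, Real.rpow_one]
    have := (norm_dSym_le k η).trans (norm_le_jap η)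
    gcongr
    exact norm_bSym_le hφ h.pos ξ η
  filter_upwards [h.hasInt_of_bound (measurable_linSym hφ ε k) (linSym_bound hφ h.pos h.le_one k) zero_le_one
    h.mem_zeta (h.mem_zeta.mono (r := 3) (by linarith)),
    h.hasInt_of_bound (q := fun ξ η => bSym φ ε ξ η * dSym k η) m2 b2 zero_le_one h.mem_zeta
      (h.memH_sum_sq.mono (r := 1) (by linarith)),
    h.hasInt_of_bound (measurable_bSym hφ ε) (bSym_bound_zero hφ h.pos) zero_le_one h.mem_zeta
      (g := rhsV ε ζ v k) (memH_iff.2 (sNorm_zero_hat_ne_top _))] with ξ h1 h2 h3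
  have h4 := (h1.mul (-1)).sub (h2.mul (ε / 2 : ℂ))
  refine (h3.unique h4 ?_).trans (by ring)
  filter_upwards [h.hat_rhsV k] with η hη
  rw [hη, linSym]
  push_cast
  ring

theorem hat_dV : hat h.dV =ᵐ[volume] fun ξ => hat (rhsZeta ε ζ v) ξ + Complex.I * ∑ k,
    dSym k ξ / (‖ξ‖ : ℂ) * (hat (rhsV ε ζ v k) ξ + (ε / 2) * (convC * bil (bSym φ ε) (hat (rhsZeta ε ζ v))
      (hat (v k)) ξ + convC * bil (bSym φ ε) (hat ζ) (hat (rhsV ε ζ v k)) ξ)) := by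
  have hk : ∀ k, ∀ᵐ ξ : Plane, hat (rhsV ε ζ v k + ((ε / 2 : ℝ) : ℂ) •
    (highPara h.cutoff h.pos h.le_one (rhsZeta ε ζ v) (v k)
      + highPara h.cutoff h.pos h.le_one ζ (rhsV ε ζ v k))) ξ = hat (rhsV ε ζ v k) ξ
      + (ε / 2) * (convC * bil (bSym φ ε) (hat (rhsZeta ε ζ v))
      (hat (v k)) ξ + convC * bil (bSym φ ε) (hat ζ) (hat (rhsV ε ζ v k)) ξ) := fun k => by
    filter_upwards [hat_add (rhsV ε ζ v k) (((ε / 2 : ℝ) : ℂ) •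
      (highPara h.cutoff h.pos h.le_one (rhsZeta ε ζ v) (v k)
        + highPara h.cutoff h.pos h.le_one ζ (rhsV ε ζ v k))),
      hat_smul ((ε / 2 : ℝ) : ℂ) (highPara h.cutoff h.pos h.le_one (rhsZeta ε ζ v) (v k)
        + highPara h.cutoff h.pos h.le_one ζ (rhsV ε ζ v k)),
      hat_add (highPara h.cutoff h.pos h.le_one (rhsZeta ε ζ v) (v k))
        (highPara h.cutoff h.pos h.le_one ζ (rhsV ε ζ v k)),
      hat_highPara h.cutoff h.pos h.le_one (rhsZeta ε ζ v) (v k),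
      hat_highPara h.cutoff h.pos h.le_one ζ (rhsV ε ζ v k)] with ξ h1 h2 h3 h4 h5
    rw [h1, h2, h3, h4, h5]
    push_cast
    rfl
  rw [dV]
  filter_upwards [hat_add (rhsZeta ε ζ v) (Complex.I • rieszDiv (fun k => rhsV ε ζ v k + ((ε / 2 : ℝ) : ℂ) •
    (highPara h.cutoff h.pos h.le_one (rhsZeta ε ζ v) (v k)
      + highPara h.cutoff h.pos h.le_one ζ (rhsV ε ζ v k)))),
    hat_smul Complex.I (rieszDiv (fun k => rhsV ε ζ v k + ((ε / 2 : ℝ) : ℂ) •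
    (highPara h.cutoff h.pos h.le_one (rhsZeta ε ζ v) (v k)
      + highPara h.cutoff h.pos h.le_one ζ (rhsV ε ζ v k)))),
    hat_rieszDiv (fun k => rhsV ε ζ v k + ((ε / 2 : ℝ) : ℂ) •
    (highPara h.cutoff h.pos h.le_one (rhsZeta ε ζ v) (v k)
      + highPara h.cutoff h.pos h.le_one ζ (rhsV ε ζ v k))), ae_all_iff.2 hk] with ξ h1 h2 h3 h4
  rw [h1, h2, h3]
  simp only [h4]

theorem hat_Lam : hat (Lam ε (goodV φ ε ζ v)) =ᵐ[volume]
    fun ξ => (‖ξ‖ : ℂ) * lapSym ε ξ * hat (goodV φ ε ζ v) ξ := by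
  refine hat_mult ((h.memH_goodV.mono (r := 3) (by linarith [h.five_le])).memLp_mult (C := 1) ?_ fun ξ => ?_)
  · exact (Complex.measurable_ofReal.comp measurable_norm).mul (measurable_lapSym ε)
  · have h1 : ‖lapSym ε ξ‖ ≤ jap ξ ^ 2 := by
      rw [lapSym, Complex.norm_real, Real.norm_eq_abs, jap_sq, abs_le]
      constructor <;> nlinarith [sq_nonneg ‖ξ‖, h.pos, h.le_one]
    have h3 : jap ξ ^ (3 : ℝ) = jap ξ * jap ξ ^ 2 := by
      rw [← pow_succ', ← Real.rpow_natCast]; norm_num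
    rw [norm_mul, Complex.norm_real, norm_norm, h3, one_mul]
    have := norm_le_jap ξ
    have := jap_pos ξ
    gcongr

theorem memH_para_gradB (k : Fin 2) : MemH N (para φ (gradB φ ε ζ v k) (goodV φ ε ζ v)) :=
  memH_para h.cutoff h.nonneg (h.int_gradB k) h.memH_goodV

theorem hat_cubic : hat (cubic φ ε ζ v) =ᵐ[volume] fun ξ => ε ^ 2 * ∑ k, dSym k ξ * (convC *
    bil (fun ξ η => ((paraSym φ ξ η : ℝ) : ℂ)) (hat (gradB φ ε ζ v k)) (hat (goodV φ ε ζ v)) ξ) := by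
  have hk : ∀ k, ∀ᵐ ξ : Plane, hat (deriv k (para φ (gradB φ ε ζ v k) (goodV φ ε ζ v))) ξ
      = dSym k ξ * (convC * bil (fun ξ η => ((paraSym φ ξ η : ℝ) : ℂ)) (hat (gradB φ ε ζ v k))
        (hat (goodV φ ε ζ v)) ξ) := fun k => by
    filter_upwards [hat_mult (h.memLp_dSym ((h.memH_para_gradB k).mono (by linarith [h.five_le])) k),
      hat_para h.cutoff (h.int_gradB k) (goodV φ ε ζ v)] with ξ h1 h2
    rw [deriv, h1, h2]
  filter_upwards [hat_smul ((ε ^ 2 : ℝ) : ℂ) (divg fun k => para φ (gradB φ ε ζ v k) (goodV φ ε ζ v)),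
    hat_sum Finset.univ fun k => deriv k (para φ (gradB φ ε ζ v k) (goodV φ ε ζ v)), ae_all_iff.2 hk]
    with ξ h1 h2 h3
  rw [cubic, h1, divg, h2]
  simp only [h3]
  push_cast
  rfl

theorem hat_wave : hat (wave φ ε ζ v) =ᵐ[volume] fun ξ => ∑ k, dSym k ξ / (‖ξ‖ : ℂ) *
    (hat (v k) ξ + ε * (1 / 2 * convC * bil (bSym φ ε) (hat ζ) (hat (v k)) ξ)) := by
  filter_upwards [hat_rieszDiv (goodU φ ε ζ v), ae_all_iff.2 h.hat_goodU, ae_all_iff.2 h.hat_Bop]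
    with ξ h1 h2 h3
  rw [wave, h1]
  simp only [h2, h3]

/-- The remainder of the equation of `V` is a sum of smooth bilinear terms. -/
theorem hat_remainder {S : ℤˣ → L2} {Q : ℤˣ → ℤˣ → L2}
    (hS : ∀ μ, IsBilinear (sSym φ ε μ) (pm μ (goodV φ ε ζ v)) (pm 1 (goodV φ ε ζ v)) (S μ))
    (hQ : ∀ μ ν, IsBilinear (qSym φ ε μ ν) (pm μ (goodV φ ε ζ v)) (pm ν (goodV φ ε ζ v)) (Q μ ν)) :
    hat (h.dV - (Complex.I • Lam ε (goodV φ ε ζ v) + ∑ μ, S μ + ∑ μ, ∑ ν, Q μ ν + cubic φ ε ζ v))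
      =ᵐ[volume] fun ξ => convC * (remHat φ ε ζ v ξ + ∑ k,
        (-ε * bil (fun ξ η => ((remSymD φ ε k ξ η : ℝ) : ℂ)) (hat (rhsZeta ε ζ v)) (hat (v k)) ξ
        + Complex.I * ε * bil (fun ξ η => ((remSymE φ ε k ξ η : ℝ) : ℂ)) (hat ζ)
          (hat (∑ l, prod (v l) (v l))) ξ)) := by
  have eQ : ∀ μ, hat (∑ ν, Q μ ν) =ᵐ[volume] fun ξ => ∑ ν, hat (Q μ ν) ξ := fun μ => hat_sum _ _
  filter_upwards [ae_ne_zero, h.quadratic_identity,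
    hat_sub h.dV (Complex.I • Lam ε (goodV φ ε ζ v) + ∑ μ, S μ + ∑ μ, ∑ ν, Q μ ν + cubic φ ε ζ v),
    hat_add (Complex.I • Lam ε (goodV φ ε ζ v) + ∑ μ, S μ + ∑ μ, ∑ ν, Q μ ν) (cubic φ ε ζ v),
    hat_add (Complex.I • Lam ε (goodV φ ε ζ v) + ∑ μ, S μ) (∑ μ, ∑ ν, Q μ ν),
    hat_add (Complex.I • Lam ε (goodV φ ε ζ v)) (∑ μ, S μ),
    hat_smul Complex.I (Lam ε (goodV φ ε ζ v)), hat_sum Finset.univ S,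
    hat_sum Finset.univ fun μ => ∑ ν, Q μ ν, ae_all_iff.2 eQ, ae_all_iff.2 fun μ => (hS μ).2,
    ae_all_iff.2 fun μ => ae_all_iff.2 fun ν => (hQ μ ν).2, h.hat_cubic, h.hat_Lam, h.hat_goodV,
    h.hat_wave, h.hat_dV, ae_all_iff.2 h.bil_bSym_rhsV, h.hat_rhsZeta, ae_all_iff.2 h.hat_rhsV,
    h.hat_sum_sq, ae_all_iff.2 fun k => hat_prod_split h.cutoff h.int_zeta (h.int_v k),
    ae_all_iff.2 fun k => hat_prod_split h.cutoff (h.int_v k) (h.int_v k)]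
    with ξ hξ hq r1 r2 r3 r4 r5 r6 r7 r8 r9 r10 r11 r12 r13 r14 r15 r16 r17 r18 r19 r20 r21
  have hn : (‖ξ‖ : ℂ) ≠ 0 := by exact_mod_cast norm_ne_zero_iff.2 hξ
  have hsq : (ξ 0 : ℂ) ^ 2 + (ξ 1 : ℂ) ^ 2 = (‖ξ‖ : ℂ) ^ 2 := by exact_mod_cast (norm_sq_eq ξ).symm
  have s9 : ∀ μ, hat (S μ) ξ = convC * bil (sSym φ ε μ) (hat (pm μ (goodV φ ε ζ v)))
      (hat (pm 1 (goodV φ ε ζ v))) ξ := r9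
  have s10 : ∀ μ ν, hat (Q μ ν) ξ = convC * bil (qSym φ ε μ ν) (hat (pm μ (goodV φ ε ζ v)))
      (hat (pm ν (goodV φ ε ζ v))) ξ := r10
  have eE := fun k => bil_remSymE (φ := φ) (ε := ε) k (hat ζ) (hat (∑ l, prod (v l) (v l))) ξ
  have eD := fun k => bil_remSymD (φ := φ) (ε := ε) k (hat (rhsZeta ε ζ v)) (hat (v k)) ξ
  rw [r1, r2, r3, r4, r5, r6, r7, ← hq]
  simp only [r8, s9, s10, r11, r12, r13, r15, r17, r16, r18, r14, eD, ← Finset.mul_sum]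
  generalize (∑ μ : ℤˣ, bil (sSym φ ε μ) (hat (pm μ (goodV φ ε ζ v))) (hat (pm 1 (goodV φ ε ζ v))) ξ) = s
  generalize (∑ μ : ℤˣ, ∑ ν : ℤˣ, bil (qSym φ ε μ ν) (hat (pm μ (goodV φ ε ζ v)))
    (hat (pm ν (goodV φ ε ζ v))) ξ) = q
  generalize (∑ l, prod (v l) (v l)) = p at *
  simp only [r19, r20, r21, Fin.sum_univ_two]
  have eE0 := eE 0
  have eE1 := eE 1
  generalize bil (fun ξ η => ((remSymE φ ε 0 ξ η : ℝ) : ℂ)) (hat ζ) (hat p) ξ = E0 at *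
  generalize bil (fun ξ η => ((remSymE φ ε 1 ξ η : ℝ) : ℂ)) (hat ζ) (hat p) ξ = E1 at *
  generalize bil (fun ξ η => bSym φ ε ξ η * dSym 0 η) (hat ζ) (hat p) ξ = J0 at *
  generalize bil (fun ξ η => bSym φ ε ξ η * dSym 1 η) (hat ζ) (hat p) ξ = J1 at *
  -- With the unit direction `(x0, x1)` as variable no division by `|ξ|` remains, and the identity
  -- becomes polynomial modulo `x0² + x1² = 1`.
  obtain ⟨x0, hx0⟩ : ∃ x, x = (ξ 0 : ℂ) / (‖ξ‖ : ℂ) := ⟨_, rfl⟩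
  obtain ⟨x1, hx1⟩ : ∃ x, x = (ξ 1 : ℂ) / (‖ξ‖ : ℂ) := ⟨_, rfl⟩
  have e0 : (ξ 0 : ℂ) = x0 * (‖ξ‖ : ℂ) := by rw [hx0, div_mul_cancel₀ _ hn]
  have e1 : (ξ 1 : ℂ) = x1 * (‖ξ‖ : ℂ) := by rw [hx1, div_mul_cancel₀ _ hn]
  have hu : x0 ^ 2 + x1 ^ 2 = 1 := by
    rw [hx0, hx1, div_pow, div_pow, ← add_div, hsq, div_self (pow_ne_zero 2 hn)]
  have d0 : dSym 0 ξ / (‖ξ‖ : ℂ) = Complex.I * x0 := by rw [hx0, dSym, mul_div_assoc]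
  have d1 : dSym 1 ξ / (‖ξ‖ : ℂ) = Complex.I * x1 := by rw [hx1, dSym, mul_div_assoc]
  rw [← hx0] at eE0
  rw [← hx1] at eE1
  rw [d0, d1, dSym, dSym, e0, e1, mul_div_cancel_right₀ x0 hn, mul_div_cancel_right₀ x1 hn]
  have hE0 : E0 = -Complex.I * (ε / 4 * x0 * J0) := by
    rw [← eE0]; linear_combination E0 * Complex.I_mul_I
  have hE1 : E1 = -Complex.I * (ε / 4 * x1 * J1) := by
    rw [← eE1]; linear_combination E1 * Complex.I_mul_I
  rw [hE0, hE1]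
  have hi2 : Complex.I ^ 2 = -1 := Complex.I_sq
  have hi3 : Complex.I ^ 3 = -Complex.I := by rw [pow_succ, hi2]; ring
  rw [← sub_eq_zero]
  -- `|D|⁻¹ div ∇ = -|D|`, applied to the two gradients in the equation of `v`; this is the only
  -- place where the unit length of the direction is used.
  have key : Complex.I * (‖ξ‖ : ℂ) * (lapSym ε ξ * hat ζ ξ + ε / 2 * hat p ξ)
      * (x0 ^ 2 + x1 ^ 2 - 1) = 0 := by
    rw [hu, sub_self, mul_zero]
  simp only [r19, r21, Fin.sum_univ_two] at key
  rw [← key]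
  push_cast
  ring_nf
  simp only [hi2, hi3]
  ring

end IsProfile

end Remainder

/-! ### The bound of the remainder -/

/-- `F` is a measurable function whose weighted norm is at most `C T`. -/
structure TermBound (N : ℝ) (T : ℝ≥0∞) (C : ℝ) (F : Plane → ℂ) : Prop where
  aesm : AEStronglyMeasurable F volume
  nonneg : 0 ≤ C
  le : sNorm N F ≤ ENNReal.ofReal C * T

namespace TermBound

variable {N C D : ℝ} {T : ℝ≥0∞} {F G : Plane → ℂ}

theorem add (hF : TermBound N T C F) (hG : TermBound N T D G) :
    TermBound N T (C + D) fun ξ => F ξ + G ξ :=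
  ⟨hF.aesm.add hG.aesm, add_nonneg hF.nonneg hG.nonneg,
    (sNorm_add_le N hF.aesm hG.aesm).trans (by
      rw [ENNReal.ofReal_add hF.nonneg hG.nonneg, add_mul]
      exact add_le_add hF.le hG.le)⟩

theorem const_mul (c : ℂ) (hF : TermBound N T C F) : TermBound N T (‖c‖ * C) fun ξ => c * F ξ :=
  ⟨hF.aesm.const_mul c, mul_nonneg (norm_nonneg _) hF.nonneg, (sNorm_const_mul_le N c F).trans (by
    rw [ENNReal.ofReal_mul (norm_nonneg _), mul_assoc]
    exact mul_le_mul_right hF.le _)⟩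

theorem sum_two {F : Fin 2 → Plane → ℂ} (hF : ∀ k, TermBound N T C (F k)) :
    TermBound N T (2 * C) fun ξ => ∑ k, F k ξ := by
  simp only [Fin.sum_univ_two, two_mul]
  exact (hF 0).add (hF 1)

theorem of_bil {q : Plane → Plane → ℂ} (hq : Measurable fun p : Plane × Plane => q p.1 p.2)
    {a r B : ℝ} (hb : ∀ ξ η, jap ξ ^ N * ‖q ξ η‖ ≤ B * (jap (ξ - η) ^ a * jap η ^ r))
    {f g : L2} {c : ℂ} (hB : 0 ≤ B) (hD : 0 ≤ D)
    (h : wNorm a (hat f) * sNorm r (hat g) ≤ ENNReal.ofReal D * T) (hC : ‖c‖ * (B * D) ≤ C) :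
    TermBound N T C fun ξ => c * bil q (hat f) (hat g) ξ := by
  refine ⟨(aesm_bil hq (aesm_hat f) (aesm_hat g)).const_mul c, le_trans (by positivity) hC, ?_⟩
  calc _ ≤ ENNReal.ofReal ‖c‖ * (ENNReal.ofReal B * (ENNReal.ofReal D * T)) :=
        (sNorm_const_mul_le N c _).trans (mul_le_mul_right ((sNorm_bil_le hb (aesm_hat f)
          (aesm_hat g)).trans (mul_le_mul_right h _)) _)
    _ = ENNReal.ofReal (‖c‖ * (B * D)) * T := by
        rw [ENNReal.ofReal_mul (norm_nonneg _), ENNReal.ofReal_mul hB]; ring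
    _ ≤ _ := by gcongr

end TermBound

theorem mul_le_sq_add_sq (a b : ℝ≥0∞) : a * b ≤ a ^ 2 + b ^ 2 := by
  rcases le_total a b with h | h
  · exact (mul_le_mul_left h b).trans ((sq b).symm.le.trans le_add_self)
  · exact (mul_le_mul_right h a).trans ((sq a).symm.le.trans le_self_add)

section Remainder

variable {φ : ℝ → ℝ} {ε N : ℝ} {ζ : L2} {v : Fin 2 → L2}

/-- The size of the remainder. -/
noncomputable def remSize (φ : ℝ → ℝ) (ε N : ℝ) (ζ : L2) (v : Fin 2 → L2) : ℝ≥0∞ :=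
  (1 + sNorm N (hat ζ)) * (sNorm N (hat ζ) ^ 2 + (∑ k, sNorm N (hat (v k))) ^ 2
    + (∑ k, sNorm N (hat (goodU φ ε ζ v k))) ^ 2)

theorem le_remSize {a : ℝ≥0∞} (h : a ≤ (sNorm N (hat ζ) ^ 2 + (∑ k, sNorm N (hat (v k))) ^ 2
    + (∑ k, sNorm N (hat (goodU φ ε ζ v k))) ^ 2)) : (1 + sNorm N (hat ζ)) * a ≤ remSize φ ε N ζ v :=
  mul_le_mul_right h _

theorem le_remSize' {a : ℝ≥0∞} (h : a ≤ (sNorm N (hat ζ) ^ 2 + (∑ k, sNorm N (hat (v k))) ^ 2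
    + (∑ k, sNorm N (hat (goodU φ ε ζ v k))) ^ 2)) : a ≤ remSize φ ε N ζ v :=
  (le_mul_of_one_le_left zero_le le_self_add).trans (le_remSize h)

theorem le_remSize'' {a : ℝ≥0∞} (h : a ≤ (sNorm N (hat ζ) ^ 2 + (∑ k, sNorm N (hat (v k))) ^ 2
    + (∑ k, sNorm N (hat (goodU φ ε ζ v k))) ^ 2)) : sNorm N (hat ζ) * a ≤ remSize φ ε N ζ v :=
  (mul_le_mul_left le_add_self _).trans (le_remSize h)

theorem sNorm_le_sum (k : Fin 2) : sNorm N (hat (v k)) ≤ ∑ l, sNorm N (hat (v l)) :=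
  Finset.single_le_sum (f := fun l => sNorm N (hat (v l))) (fun _ _ => zero_le) (Finset.mem_univ k)

/-- The constant in the bound of the remainder. -/
noncomputable def remConst (N : ℝ) : ℝ :=
  ‖convC‖ * (2 * ((155 ^ N * 155 + 2 ^ N * 7) * embC
    + 2 ^ N * 8 * (embC * (‖(1 / 2 * convC : ℂ)‖ * 2 ^ (N + 1) * embC))
    + 155 ^ N * 155 * embC + 2 ^ N * embC + 2 ^ N * 2 * embC
    + 2 ^ N * 8 * (embC * (‖(1 / 2 * convC : ℂ)‖ * 2 ^ (N + 1) * embC)))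
    + 2 * (2 ^ N * (embC + ‖convC‖ * 2 * embC ^ 2) + 2 ^ N * (embC * prodC N)))

namespace IsProfile

variable (h : IsProfile φ ε N ζ v)
include h

theorem sNorm_wave_le : sNorm N (hat (wave φ ε ζ v)) ≤ ∑ k, sNorm N (hat (goodU φ ε ζ v k)) :=
  sNorm_rieszDiv_le N _

/-- The factor `4/ε` meets the `2ε` in the bounds of `remSymB` and `remSymH`; their product is the
`8` in `remConst`. -/
theorem sNorm_gradB_le (k : Fin 2) : sNorm (N + 1) (hat (gradB φ ε ζ v k))
    ≤ ENNReal.ofReal (‖(1 / 2 * convC : ℂ)‖ * 2 ^ (N + 1) * embC * (4 / ε))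
      * (sNorm N (hat ζ) * ∑ l, sNorm N (hat (v l))) := by
  have hε := h.pos
  have hc := embC_nonneg
  refine (sNorm_gradPart_le (N + 1) _ k).trans ?_
  rw [Finset.mul_sum, Finset.mul_sum]
  refine Finset.sum_le_sum fun l _ => (h.sNorm_Bop_le l).trans ?_
  calc _ ≤ ENNReal.ofReal (‖(1 / 2 * convC : ℂ)‖ * (2 ^ (N + 1) * (4 / ε)))
        * ((ENNReal.ofReal embC * sNorm N (hat ζ)) * sNorm N (hat (v l))) := by
        gcongr
        exact wNorm_hat_le (by linarith [h.five_le]) _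
    _ = ENNReal.ofReal (‖(1 / 2 * convC : ℂ)‖ * (2 ^ (N + 1) * (4 / ε))) * ENNReal.ofReal embC
        * (sNorm N (hat ζ) * sNorm N (hat (v l))) := by ring
    _ = _ := by
        rw [← ENNReal.ofReal_mul (by positivity)]
        congr 2
        ring

/-- Each of the eight symbols sees at most one derivative on the low-frequency factor. The norm of
`u` enters only through `w`, in the term with `remSymG`; the factor `1 + ‖ζ‖` comes from `∂_t ζ`,
from `b` and from the term with `|v|²`. -/
theorem sNorm_remainder_le : TermBound N (remSize φ ε N ζ v) (ε * remConst N)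
    fun ξ => convC * (remHat φ ε ζ v ξ + ∑ k,
        (-ε * bil (fun ξ η => ((remSymD φ ε k ξ η : ℝ) : ℂ)) (hat (rhsZeta ε ζ v)) (hat (v k)) ξ
        + Complex.I * ε * bil (fun ξ η => ((remSymE φ ε k ξ η : ℝ) : ℂ)) (hat ζ)
          (hat (∑ l, prod (v l) (v l))) ξ)) := by
  have hφ := h.cutoff
  have hε := h.pos
  have hε1 := h.le_one
  have hN := h.five_le
  have hN0 := h.nonneg
  have hc := embC_nonneg
  have hp := prodC_nonneg N
  have nI : ‖(Complex.I * ε : ℂ)‖ = ε := by simp [abs_of_pos hε]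
  have nR : ‖(ε : ℂ)‖ = ε := by simp [abs_of_pos hε]
  have nM : ‖(-ε : ℂ)‖ = ε := by simp [abs_of_pos hε]
  set z := sNorm N (hat ζ) with hz
  set x := ∑ k, sNorm N (hat (v k)) with hx
  have hxk : ∀ k, sNorm N (hat (v k)) ≤ x := fun k => sNorm_le_sum k
  have w1 : ∀ {a : ℝ} (f : L2), a ≤ 1 → wNorm a (hat f) ≤ ENNReal.ofReal embC * sNorm N (hat f) :=
    fun f ha => wNorm_hat_le (by linarith) f
  set β := ‖(1 / 2 * convC : ℂ)‖ * 2 ^ (N + 1) * embC with hβ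
  have hβ0 : 0 ≤ β := by positivity
  have hzx : z * x ≤ z ^ 2 + x ^ 2 + (∑ k, sNorm N (hat (goodU φ ε ζ v k))) ^ 2 :=
    (mul_le_sq_add_sq z x).trans le_self_add
  have hxx : x * x ≤ z ^ 2 + x ^ 2 + (∑ k, sNorm N (hat (goodU φ ε ζ v k))) ^ 2 := by
    rw [← sq]; exact le_add_self.trans le_self_add
  have hzz : z * z ≤ z ^ 2 + x ^ 2 + (∑ k, sNorm N (hat (goodU φ ε ζ v k))) ^ 2 := by
    rw [← sq, add_assoc]; exact le_self_add
  have tA := fun k => TermBound.of_bil (N := N) (T := remSize φ ε N ζ v) (c := Complex.I * ε) (D := embC)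
    (C := ε * ((155 ^ N * 155 + 2 ^ N * 7) * embC))
    (measurable_ofReal_symbol (measurable_remSymA hφ ε k)) (remSymA_bound hφ hN0 hε k) (f := ζ) (g := v k)
    (by positivity) hc (by
      refine (mul_le_mul' (w1 ζ le_rfl) (hxk k)).trans ?_
      rw [mul_assoc]
      gcongr
      exact le_remSize' hzx) (by rw [nI])
  have tB := fun k => TermBound.of_bil (N := N) (T := remSize φ ε N ζ v) (c := Complex.I * ε)
    (D := embC * (β * (4 / ε))) (C := ε * (2 ^ N * 8 * (embC * β)))
    (measurable_ofReal_symbol (measurable_remSymB hφ ε k)) (remSymB_bound hφ hN0 hε k) (f := ζ)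
    (g := gradB φ ε ζ v k)
    (by positivity) (by positivity) (by
      refine (mul_le_mul' (w1 ζ zero_le_one) (h.sNorm_gradB_le k)).trans ?_
      rw [ENNReal.ofReal_mul hc]
      calc _ = ENNReal.ofReal embC * ENNReal.ofReal (β * (4 / ε)) * (z * (z * x)) := by ring
        _ ≤ _ := by gcongr; exact le_remSize'' hzx) (by rw [nI]; apply le_of_eq; field_simp; ring)
  have tC := fun k => TermBound.of_bil (N := N) (T := remSize φ ε N ζ v) (c := Complex.I * ε) (D := embC)
    (C := ε * (155 ^ N * 155 * embC))
    (measurable_ofReal_symbol (measurable_remSymC hφ)) (remSymC_bound hφ hN0) (f := v k) (g := v k)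
    (by positivity) hc (by
      refine (mul_le_mul' ((w1 (v k) le_rfl).trans (mul_le_mul_right (hxk k) _)) (hxk k)).trans ?_
      rw [mul_assoc]
      gcongr
      exact le_remSize' hxx) (by rw [nI])
  have tF := fun k => TermBound.of_bil (N := N) (T := remSize φ ε N ζ v) (c := Complex.I * ε) (D := embC)
    (C := ε * (2 ^ N * embC))
    (measurable_ofReal_symbol (measurable_remSymF hφ ε k)) (remSymF_bound hφ hN0 k) (f := ζ) (g := ζ)
    (by positivity) hc (by
      refine (mul_le_mul' (w1 ζ le_rfl) le_rfl).trans ?_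
      rw [mul_assoc]
      gcongr
      exact le_remSize' hzz) (by rw [nI, mul_one])
  have tG := fun k => TermBound.of_bil (N := N) (T := remSize φ ε N ζ v) (c := (ε : ℂ)) (D := embC)
    (C := ε * (2 ^ N * 2 * embC))
    (measurable_ofReal_symbol (measurable_remSymG hφ k)) (remSymG_bound hφ hN0 k) (f := v k)
    (g := wave φ ε ζ v)
    (by positivity) hc (by
      refine (mul_le_mul' ((w1 (v k) le_rfl).trans (mul_le_mul_right (hxk k) _)) h.sNorm_wave_le).trans ?_
      rw [mul_assoc]
      gcongr
      refine le_remSize' ((mul_le_sq_add_sq _ _).trans ?_)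
      rw [add_assoc]
      exact le_add_self) (by rw [nR])
  have tH := fun k => TermBound.of_bil (N := N) (T := remSize φ ε N ζ v) (c := Complex.I * ε)
    (D := embC * (β * (4 / ε))) (C := ε * (2 ^ N * 8 * (embC * β)))
    (measurable_ofReal_symbol (measurable_remSymH hφ ε)) (remSymH_bound hφ hN0 hε) (f := v k)
    (g := gradB φ ε ζ v k)
    (by positivity) (by positivity) (by
      refine (mul_le_mul' ((w1 (v k) zero_le_one).trans (mul_le_mul_right (hxk k) _))
        (h.sNorm_gradB_le k)).trans ?_
      rw [ENNReal.ofReal_mul hc]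
      calc _ = ENNReal.ofReal embC * ENNReal.ofReal (β * (4 / ε)) * (z * (x * x)) := by ring
        _ ≤ _ := by gcongr; exact le_remSize'' hxx) (by rw [nI]; apply le_of_eq; field_simp; ring)
  have tD := fun k => TermBound.of_bil (N := N) (T := remSize φ ε N ζ v) (c := (-ε : ℂ))
    (D := embC + ‖convC‖ * 2 * embC ^ 2)
    (C := ε * (2 ^ N * (embC + ‖convC‖ * 2 * embC ^ 2)))
    (measurable_ofReal_symbol (measurable_remSymD hφ ε k)) (remSymD_bound hφ hN0 hε k)
    (f := rhsZeta ε ζ v) (g := v k)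
    (by positivity) (by positivity) (by
      refine (mul_le_mul' h.wNorm_rhsZeta_le (hxk k)).trans ?_
      rw [mul_assoc, mul_assoc (1 + _)]
      gcongr
      exact le_remSize hxx) (by rw [nM, mul_one])
  have tE := fun k => TermBound.of_bil (N := N) (T := remSize φ ε N ζ v) (c := Complex.I * ε)
    (D := embC * prodC N) (C := ε * (2 ^ N * (embC * prodC N)))
    (measurable_ofReal_symbol (measurable_remSymE hφ ε k)) (remSymE_bound hφ hN0 hε hε1 k) (f := ζ)
    (g := ∑ l, prod (v l) (v l))
    (by positivity) (by positivity) (by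
      refine (mul_le_mul' (w1 ζ zero_le_one) h.sNorm_sum_sq_le).trans ?_
      rw [ENNReal.ofReal_mul hc]
      have hs : ∑ l, sNorm N (hat (v l)) ^ 2 ≤ x * x := by
        rw [hx, Finset.sum_mul]
        refine Finset.sum_le_sum fun l _ => ?_
        rw [sq]
        gcongr
        exact hxk l
      calc _ = ENNReal.ofReal embC * ENNReal.ofReal (prodC N) * (z * ∑ l, sNorm N (hat (v l)) ^ 2) := by ring
        _ ≤ _ := by gcongr; exact le_remSize'' (hs.trans hxx)) (by rw [nI, mul_one])
  have tot := ((TermBound.sum_two fun k => (((((tA k).add (tB k)).add (tC k)).add (tF k)).add (tG k)).add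
    (tH k)).add (TermBound.sum_two fun k => (tD k).add (tE k))).const_mul convC
  have e : ε * remConst N = ‖convC‖ * (2 * (ε * ((155 ^ N * 155 + 2 ^ N * 7) * embC)
      + ε * (2 ^ N * 8 * (embC * β)) + ε * (155 ^ N * 155 * embC) + ε * (2 ^ N * embC)
      + ε * (2 ^ N * 2 * embC) + ε * (2 ^ N * 8 * (embC * β)))
      + 2 * (ε * (2 ^ N * (embC + ‖convC‖ * 2 * embC ^ 2)) + ε * (2 ^ N * (embC * prodC N)))) := by
    rw [remConst]; ring
  rw [e]
  exact tot

end IsProfile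

end Remainder

/-! ### The pairing with the cubic term -/

/-- The integrand of a trilinear form with one real factor. -/
noncomputable def triInt (κ : Plane → Plane → ℝ) (W V : Plane → ℂ) (p : Plane × Plane) : ℂ :=
  Complex.I * (κ p.1 p.2 : ℂ) * W (p.1 - p.2) * ((starRingEnd ℂ) (V p.1) * V p.2)

section Trilinear

variable {κ : Plane → Plane → ℝ} {W V : Plane → ℂ} {N C : ℝ}

theorem aesm_triInt (hκ : Measurable fun p : Plane × Plane => κ p.1 p.2)
    (hW : AEStronglyMeasurable W volume) (hV : AEStronglyMeasurable V volume) :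
    AEStronglyMeasurable (triInt κ W V) (volume.prod volume) :=
  ((((measurable_ofReal_symbol hκ).const_mul Complex.I).aestronglyMeasurable.mul
    (hW.comp_quasiMeasurePreserving quasi_sub)).mul
    (((Complex.continuous_conj.comp_aestronglyMeasurable hV).comp_quasiMeasurePreserving
      Measure.quasiMeasurePreserving_fst).mul
    (hV.comp_quasiMeasurePreserving Measure.quasiMeasurePreserving_snd)))

/-- Cauchy-Schwarz in `ξ` pairs one copy of `V` with the convolution of `W` and the other copy, to
which Young's inequality applies. -/
theorem lintegral_triInt_le (hκ : Measurable fun p : Plane × Plane => κ p.1 p.2)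
    (hb : ∀ ξ η, |κ ξ η| ≤ C * (jap (ξ - η) ^ (1 : ℝ) * (jap ξ ^ N * jap η ^ N)))
    (hW : AEStronglyMeasurable W volume) (hV : AEStronglyMeasurable V volume) :
    ∫⁻ p, ‖triInt κ W V p‖ₑ ∂(volume.prod volume)
      ≤ ENNReal.ofReal C * (sNorm N V * (wNorm 1 W * sNorm N V)) := by
  have aW := aem_weight 1 hW
  have aV := aem_weight N hV
  set A : Plane → ℝ≥0∞ := fun ξ => ENNReal.ofReal (jap ξ ^ (1 : ℝ)) * ‖W ξ‖ₑ with hA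
  set B : Plane → ℝ≥0∞ := fun ξ => ENNReal.ofReal (jap ξ ^ N) * ‖V ξ‖ₑ with hB
  have hpt : ∀ ξ η, ‖triInt κ W V (ξ, η)‖ₑ ≤ ENNReal.ofReal C * B ξ * (A (ξ - η) * B η) := fun ξ η => by
    have h1 : ‖triInt κ W V (ξ, η)‖ₑ = ENNReal.ofReal |κ ξ η| * ‖W (ξ - η)‖ₑ * (‖V ξ‖ₑ * ‖V η‖ₑ) := by
      rw [triInt, enorm_mul, enorm_mul, enorm_mul, enorm_mul, ← ofReal_norm Complex.I,
        Complex.norm_I, ENNReal.ofReal_one, one_mul, ← ofReal_norm (κ ξ η : ℂ), Complex.norm_real,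
        Real.norm_eq_abs, ← ofReal_norm ((starRingEnd ℂ) (V ξ)), RCLike.norm_conj, ofReal_norm]
    have n1 := (jap_rpow_pos N ξ).le
    have n2 := (jap_rpow_pos N η).le
    have n3 := (jap_rpow_pos 1 (ξ - η)).le
    have h3 := ENNReal.ofReal_le_ofReal (hb ξ η)
    rw [ENNReal.ofReal_mul' (mul_nonneg n3 (mul_nonneg n1 n2)), ENNReal.ofReal_mul n3,
      ENNReal.ofReal_mul n1] at h3
    rw [h1]
    calc _ ≤ ENNReal.ofReal C * (ENNReal.ofReal (jap (ξ - η) ^ (1 : ℝ)) * (ENNReal.ofReal (jap ξ ^ N)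
          * ENNReal.ofReal (jap η ^ N))) * ‖W (ξ - η)‖ₑ * (‖V ξ‖ₑ * ‖V η‖ₑ) := by gcongr
      _ = _ := by rw [hA, hB]; ring
  rw [lintegral_prod _ (aesm_triInt hκ hW hV).enorm]
  calc _ ≤ ∫⁻ ξ, ENNReal.ofReal C * (B ξ * conv A B ξ) := by
        refine lintegral_mono fun ξ => (lintegral_mono (hpt ξ)).trans (le_of_eq ?_)
        rw [lintegral_const_mul', mul_assoc]
        · rfl
        · simp only [hB]; finiteness
    _ = ENNReal.ofReal C * ∫⁻ ξ, B ξ * conv A B ξ := lintegral_const_mul' _ _ (by finiteness)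
    _ ≤ _ := by
        gcongr
        refine (lintegral_mul_le_eLpNorm aV (aemeasurable_conv aW aV)).trans ?_
        gcongr
        · exact le_rfl
        · exact eLpNorm_conv_le aW aV

theorem integrable_triInt (hκ : Measurable fun p : Plane × Plane => κ p.1 p.2)
    (hb : ∀ ξ η, |κ ξ η| ≤ C * (jap (ξ - η) ^ (1 : ℝ) * (jap ξ ^ N * jap η ^ N)))
    (hW : AEStronglyMeasurable W volume) (hV : AEStronglyMeasurable V volume)
    (hW1 : wNorm 1 W ≠ ⊤) (hV1 : sNorm N V ≠ ⊤) : Integrable (triInt κ W V) (volume.prod volume) :=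
  ⟨aesm_triInt hκ hW hV, (lintegral_triInt_le hκ hb hW hV).trans_lt (by
    rw [lt_top_iff_ne_top]; finiteness)⟩

theorem norm_integral_triInt_le (hκ : Measurable fun p : Plane × Plane => κ p.1 p.2)
    (hb : ∀ ξ η, |κ ξ η| ≤ C * (jap (ξ - η) ^ (1 : ℝ) * (jap ξ ^ N * jap η ^ N)))
    (hW : AEStronglyMeasurable W volume) (hV : AEStronglyMeasurable V volume)
    (hW1 : wNorm 1 W ≠ ⊤) (hV1 : sNorm N V ≠ ⊤) :
    ‖∫ p, triInt κ W V p ∂(volume.prod volume)‖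
      ≤ (ENNReal.ofReal C * (sNorm N V * (wNorm 1 W * sNorm N V))).toReal := by
  rw [← toReal_enorm]
  exact ENNReal.toReal_mono (by finiteness)
    ((enorm_integral_le_lintegral_enorm _).trans (lintegral_triInt_le hκ hb hW hV))

/-- The real part of a trilinear form is that of its antisymmetrized kernel. -/
theorem re_integral_triInt (hi : Integrable (triInt κ W V) (volume.prod volume)) (hW : HatReal W) :
    (∫ p, triInt κ W V p ∂(volume.prod volume)).re
      = (∫ p, triInt (fun ξ η => κ ξ η - κ η ξ) W V p ∂(volume.prod volume)).re / 2 := by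
  set J := ∫ p, triInt κ W V p ∂(volume.prod volume) with hJ
  have hc : (starRingEnd ℂ) J = ∫ p, (starRingEnd ℂ) (triInt κ W V p.swap) ∂(volume.prod volume) := by
    rw [hJ, ← integral_conj]
    exact (integral_prod_swap fun p => (starRingEnd ℂ) (triInt κ W V p)).symm
  have hic : Integrable (fun p : Plane × Plane => (starRingEnd ℂ) (triInt κ W V p.swap))
      (volume.prod volume) :=
    (Complex.conjLIE.toContinuousLinearEquiv.toContinuousLinearMap).integrable_comp hi.swap
  have hs : J + (starRingEnd ℂ) J
      = ∫ p, triInt (fun ξ η => κ ξ η - κ η ξ) W V p ∂(volume.prod volume) := by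
    rw [hc, hJ, ← integral_add hi hic]
    refine integral_congr_ae ?_
    -- Conjugation together with the exchange of `ξ` and `η` preserves the product of the two
    -- factors `V`, reverses the sign of `i`, and sends `W(ξ - η)` to the conjugate of `W(η - ξ)`,
    -- which is `W(ξ - η)` again by reality.
    filter_upwards [quasi_sub.ae (ae_neg hW)] with p hp
    rw [neg_neg, neg_sub] at hp
    simp only [triInt, Prod.fst_swap, Prod.snd_swap, map_mul, Complex.conj_I, Complex.conj_ofReal,
      Complex.conj_conj, ← hp]
    push_cast
    ring
  rw [← hs, Complex.add_re, Complex.conj_re]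
  ring

end Trilinear

theorem measurable_antisymm {κ : Plane → Plane → ℝ} (hκ : Measurable fun p : Plane × Plane => κ p.1 p.2) :
    Measurable fun p : Plane × Plane => κ p.1 p.2 - κ p.2 p.1 :=
  hκ.sub (hκ.comp (measurable_snd.prodMk measurable_fst))

/-- The kernel of the pairing with a truncation `ψ` of the cubic term. -/
noncomputable def cubicKer (φ : ℝ → ℝ) (N : ℝ) (ψ : Plane → ℝ) (k : Fin 2) (ξ η : Plane) : ℝ :=
  jap ξ ^ (2 * N) * (ψ ξ * ξ k * paraSym φ ξ η)

section Cubic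

variable {φ : ℝ → ℝ} {ε N : ℝ} {ζ : L2} {v : Fin 2 → L2}

theorem measurable_cubicKer (hφ : IsCutoff φ) (N : ℝ) {ψ : Plane → ℝ} (hψ : Measurable ψ) (k : Fin 2) :
    Measurable fun p : Plane × Plane => cubicKer φ N ψ k p.1 p.2 := by
  have h1 := measurable_paraSym hφ
  have h2 : Measurable fun p : Plane × Plane => jap p.1 ^ (2 * N) :=
    (measurable_jap_rpow (2 * N)).comp measurable_fst
  have h3 : Measurable fun p : Plane × Plane => ψ p.1 := hψ.comp measurable_fst
  unfold cubicKer
  generalize paraSym φ = c at *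
  fun_prop

/-- The truncation enters as the factor `ψ` of the commutator bound, with constant `3L` independent
of `n`; the second clause, `ψ = 1`, is the kernel of the limit. -/
theorem exists_cubicKer_bound (hφ : IsCutoff φ) (hN : 1 / 2 ≤ N) : ∃ K : ℝ, 0 ≤ K ∧
    (∀ (n : ℤ) (k : Fin 2) (ξ η : Plane), |cubicKer φ N (fun z => phiLE φ n ‖z‖) k ξ η
      - cubicKer φ N (fun z => phiLE φ n ‖z‖) k η ξ| ≤ K * (jap (ξ - η) ^ (1 : ℝ) * (jap ξ ^ N * jap η ^ N))) ∧
    ∀ (k : Fin 2) (ξ η : Plane), |cubicKer φ N (fun _ => 1) k ξ η - cubicKer φ N (fun _ => 1) k η ξ|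
      ≤ K * (jap (ξ - η) ^ (1 : ℝ) * (jap ξ ^ N * jap η ^ N)) := by
  obtain ⟨L, hL0, hL⟩ := hφ.exists_lipschitz
  obtain ⟨K, hK0, hK⟩ := exists_symbol_symm_bound hφ hN (C := 3 * L) (by positivity)
  have hle : ∀ ξ η : Plane, K * (‖ξ - η‖ * (jap ξ ^ N * jap η ^ N))
      ≤ K * (jap (ξ - η) ^ (1 : ℝ) * (jap ξ ^ N * jap η ^ N)) := fun ξ η => by
    have h1 := jap_rpow_pos N ξ
    have h2 := jap_rpow_pos N η
    have h3 := norm_sub_le_jap ξ η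
    gcongr
  refine ⟨K, hK0, fun n k ξ η => le_trans ?_ (hle ξ η), fun k ξ η => le_trans ?_ (hle ξ η)⟩
  · refine hK (fun z => z k) (fun z => phiLE φ n ‖z‖) (fun z => abs_apply_le z k) (fun z z' => ?_)
      (fun z => ?_) (fun ξ η h => phiLE_norm_sub_le hφ hL0 hL n h) ξ η
    · exact abs_apply_le (z - z') k
    · rw [abs_of_nonneg (phiLE_nonneg hφ _ _)]
      exact phiLE_le_one hφ _ _
  · refine hK (fun z => z k) (fun _ => 1) (fun z => abs_apply_le z k) (fun z z' => ?_)
      (fun z => by simp) (fun ξ η _ => ?_) ξ η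
    · exact abs_apply_le (z - z') k
    · rw [sub_self, abs_zero, zero_mul]
      positivity

/-- The constant grows with `n`. It only provides the absolute convergence that permits symmetrizing
the truncated pairing. -/
theorem exists_cubicKer_trunc_bound (hφ : IsCutoff φ) (hN : 0 ≤ N) (n : ℕ) :
    ∃ C : ℝ, ∀ (k : Fin 2) (ξ η : Plane), |cubicKer φ N (fun z => phiLE φ n ‖z‖) k ξ η|
      ≤ C * (jap (ξ - η) ^ (1 : ℝ) * (jap ξ ^ N * jap η ^ N)) := by
  refine ⟨(1 + 3 / 2 * 2 ^ n) ^ (2 * N) * (3 / 2 * 2 ^ n), fun k ξ η => ?_⟩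
  have hone : 1 ≤ jap (ξ - η) ^ (1 : ℝ) * (jap ξ ^ N * jap η ^ N) :=
    one_le_mul_of_one_le_of_one_le (Real.one_le_rpow (one_le_jap _) zero_le_one)
      (one_le_mul_of_one_le_of_one_le (Real.one_le_rpow (one_le_jap _) hN)
        (Real.one_le_rpow (one_le_jap _) hN))
  have hpos : (0 : ℝ) ≤ (1 + 3 / 2 * 2 ^ n) ^ (2 * N) * (3 / 2 * 2 ^ n) := by positivity
  refine le_trans ?_ (le_mul_of_one_le_right hpos hone)
  rcases le_or_gt ‖ξ‖ (3 / 2 * 2 ^ n) with h | h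
  · have h1 : jap ξ ≤ 1 + 3 / 2 * 2 ^ n := by
      refine jap_add_le.le_of_sq_le_sq ?_ (by positivity)
      rw [jap_sq]
      nlinarith [norm_nonneg ξ]
    have h2 := jap_rpow_pos (2 * N) ξ
    have h3 : |phiLE φ n ‖ξ‖| ≤ 1 := by
      rw [abs_of_nonneg (phiLE_nonneg hφ _ _)]; exact phiLE_le_one hφ _ _
    have h4 := (abs_apply_le ξ k).trans h
    have h5 := abs_paraSym_le_one hφ ξ η
    rw [cubicKer, abs_mul, abs_of_pos h2, abs_mul, abs_mul]
    calc _ ≤ (1 + 3 / 2 * 2 ^ n : ℝ) ^ (2 * N) * (1 * (3 / 2 * 2 ^ n) * 1) := by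
          gcongr
          exact (jap_pos ξ).le
      _ = _ := by ring
  · have h0 : phiLE φ n ‖ξ‖ = 0 := phiLE_eq_zero hφ (by rwa [zpow_natCast])
    rw [cubicKer, h0, zero_mul, zero_mul, mul_zero, abs_zero]
    exact hpos

namespace IsProfile

variable (h : IsProfile φ ε N ζ v)
include h

/-- The pairing of a truncation of the cubic term, on the Fourier side. -/
theorem inner_trunc_cubic (n : ℕ) :
    inner ℂ (japD N (goodV φ ε ζ v)) (japD N (PLE φ n (cubic φ ε ζ v)))
      = (((1 / (4 * Real.pi ^ 2)) ^ 2 * ε ^ 2 : ℝ) : ℂ) * ∑ k, ∫ p, triInt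
        (cubicKer φ N (fun z => phiLE φ n ‖z‖) k) (hat (gradB φ ε ζ v k)) (hat (goodV φ ε ζ v)) p
        ∂(volume.prod volume) := by
  have hφ := h.cutoff
  have hN0 := h.nonneg
  obtain ⟨C, hC⟩ := exists_cubicKer_trunc_bound hφ hN0 n
  have hmφ : Measurable fun z : Plane => phiLE φ n ‖z‖ := (measurable_phiLE hφ n).comp measurable_norm
  have hi : ∀ k, Integrable (triInt (cubicKer φ N (fun z => phiLE φ n ‖z‖) k) (hat (gradB φ ε ζ v k))
      (hat (goodV φ ε ζ v))) (volume.prod volume) := fun k =>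
    integrable_triInt (measurable_cubicKer hφ N hmφ k) (hC k) (aesm_hat _) (aesm_hat _)
      ((h.memH_gradB k).wNorm_ne_top (by linarith [h.five_le])) (memH_iff.1 h.memH_goodV)
  have e1 : hat (japD N (goodV φ ε ζ v)) =ᵐ[volume]
      fun ξ => ((jap ξ ^ N : ℝ) : ℂ) * hat (goodV φ ε ζ v) ξ := hat_mult h.memH_goodV
  have hmem : MemH N (PLE φ n (cubic φ ε ζ v)) := by
    refine MemH.of_hat (r := 0) (C := (1 + 3 / 2 * 2 ^ n) ^ N) (memH_iff.2 (sNorm_zero_hat_ne_top _))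
      (hat_PLE hφ n (cubic φ ε ζ v)) fun ξ => ?_
    rw [Real.rpow_zero, mul_one, Complex.norm_real, Real.norm_of_nonneg (phiLE_nonneg hφ _ _)]
    rcases le_or_gt ‖ξ‖ (3 / 2 * 2 ^ n) with h' | h'
    · have h1 : jap ξ ≤ 1 + 3 / 2 * 2 ^ n := by
        refine jap_add_le.le_of_sq_le_sq ?_ (by positivity)
        rw [jap_sq]
        nlinarith [norm_nonneg ξ]
      calc _ ≤ (1 + 3 / 2 * 2 ^ n : ℝ) ^ N * 1 := by
            gcongr
            · exact phiLE_nonneg hφ _ _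
            · exact (jap_pos ξ).le
            · exact phiLE_le_one hφ _ _
        _ = _ := mul_one _
    · rw [phiLE_eq_zero hφ (by rwa [zpow_natCast]), mul_zero]
      positivity
  have e2 : hat (japD N (PLE φ n (cubic φ ε ζ v))) =ᵐ[volume]
      fun ξ => ((jap ξ ^ N : ℝ) : ℂ) * hat (PLE φ n (cubic φ ε ζ v)) ξ := hat_mult hmem
  rw [inner_eq_hat]
  have hk : ∀ k, ∫ p, triInt
        (cubicKer φ N (fun z => phiLE φ n ‖z‖) k) (hat (gradB φ ε ζ v k)) (hat (goodV φ ε ζ v)) p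
        ∂(volume.prod volume) = ∫ ξ, ∫ η, triInt
        (cubicKer φ N (fun z => phiLE φ n ‖z‖) k) (hat (gradB φ ε ζ v k)) (hat (goodV φ ε ζ v)) (ξ, η) :=
    fun k => integral_prod _ (hi k)
  simp only [hk]
  rw [← integral_finsetSum _ fun k _ => (hi k).integral_prod_left]
  have hc : (((1 / (4 * Real.pi ^ 2)) ^ 2 * ε ^ 2 : ℝ) : ℂ)
      = (1 / (4 * Real.pi ^ 2) : ℂ) * (convC * ε ^ 2) := by
    rw [convC]; push_cast; ring
  rw [hc, mul_assoc]
  congr 1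
  rw [← integral_const_mul]
  refine integral_congr_ae ?_
  filter_upwards [e1, e2, hat_PLE hφ n (cubic φ ε ζ v), h.hat_cubic] with ξ h1 h2 h3 h4
  rw [h1, h2, h3, h4, map_mul, Complex.conj_ofReal]
  have h5 : ∀ k, ∫ η, triInt (cubicKer φ N (fun z => phiLE φ n ‖z‖) k) (hat (gradB φ ε ζ v k))
      (hat (goodV φ ε ζ v)) (ξ, η) = Complex.I * ((jap ξ ^ (2 * N) * (phiLE φ n ‖ξ‖ * ξ k) : ℝ) : ℂ)
      * (starRingEnd ℂ) (hat (goodV φ ε ζ v) ξ) * bil (fun ξ η => ((paraSym φ ξ η : ℝ) : ℂ))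
        (hat (gradB φ ε ζ v k)) (hat (goodV φ ε ζ v)) ξ := fun k => by
    rw [bil, ← integral_const_mul]
    refine integral_congr_ae (ae_of_all _ fun η => ?_)
    simp only [triInt, cubicKer]
    push_cast
    ring
  simp only [h5, dSym, Fin.sum_univ_two]
  have h6 : jap ξ ^ (2 * N) = jap ξ ^ N * jap ξ ^ N := by
    rw [← Real.rpow_add (jap_pos ξ), two_mul]
  rw [h6]
  push_cast
  ring

/-- The bound of `B^ε` that is uniform in `ε`. -/
theorem sNorm_Bop_le' (k : Fin 2) : sNorm N (hat (Bop φ ε ζ v k))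
    ≤ ENNReal.ofReal (‖(1 / 2 * convC : ℂ)‖ * (2 ^ N * 2) * embC) *
      (sNorm N (hat ζ) * sNorm N (hat (v k))) := by
  have hb : ∀ ξ η : Plane, jap ξ ^ N * ‖bSym φ ε ξ η‖ ≤ 2 ^ N * 2 * (jap (ξ - η) ^ (0 : ℝ) * jap η ^ N) :=
    fun ξ η => by
      have := paraSym_mul_bound h.cutoff h.nonneg (a := 0) (r := 0) (c := 2) zero_le_two
        (t := fun _ η => mHi φ ε η) (fun ξ η _ _ _ => by
          simpa using abs_mHi_le_two h.cutoff h.pos η) ξ η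
      rwa [add_zero, mul_comm (mHi φ ε η), ← Real.norm_eq_abs, ← Complex.norm_real] at this
  rw [sNorm_congr (h.hat_Bop k)]
  refine (sNorm_const_mul_le N _ _).trans ((mul_le_mul_right
    (sNorm_bil_le hb (aesm_hat _) (aesm_hat _)) _).trans ?_)
  have hc := embC_nonneg
  rw [ENNReal.ofReal_mul (p := ‖(1 / 2 * convC : ℂ)‖ * (2 ^ N * 2)) (q := embC) (by positivity),
    ENNReal.ofReal_mul (p := ‖(1 / 2 * convC : ℂ)‖) (q := 2 ^ N * 2) (norm_nonneg _)]
  calc _ ≤ ENNReal.ofReal ‖(1 / 2 * convC : ℂ)‖ * (ENNReal.ofReal (2 ^ N * 2) *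
        ((ENNReal.ofReal embC * sNorm N (hat ζ)) * sNorm N (hat (v k)))) := by
        gcongr
        exact wNorm_hat_le (by linarith [h.five_le]) _
    _ = _ := by ring

/-- Here `b` is a low-frequency factor and needs no gain of derivatives, so the bound can be kept
uniform in `ε`. -/
theorem wNorm_gradB_le (k : Fin 2) : wNorm 1 (hat (gradB φ ε ζ v k))
    ≤ ENNReal.ofReal (embC * (‖(1 / 2 * convC : ℂ)‖ * (2 ^ N * 2) * embC)) *
      (sNorm N (hat ζ) * ∑ l, sNorm N (hat (v l))) := by
  have hc := embC_nonneg
  refine (wNorm_hat_le (s := N) (by linarith [h.five_le]) _).trans ?_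
  rw [ENNReal.ofReal_mul hc, mul_assoc, Finset.mul_sum, Finset.mul_sum]
  gcongr
  exact (sNorm_gradPart_le N _ k).trans (Finset.sum_le_sum fun l _ => h.sNorm_Bop_le' l)

/-- The pairing with the cubic term exists and is bounded. -/
theorem hasRePairing_cubic {K : ℝ}
    (hK1 : ∀ (n : ℤ) (k : Fin 2) (ξ η : Plane), |cubicKer φ N (fun z => phiLE φ n ‖z‖) k ξ η
      - cubicKer φ N (fun z => phiLE φ n ‖z‖) k η ξ| ≤ K * (jap (ξ - η) ^ (1 : ℝ) * (jap ξ ^ N * jap η ^ N)))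
    (hK2 : ∀ (k : Fin 2) (ξ η : Plane), |cubicKer φ N (fun _ => 1) k ξ η - cubicKer φ N (fun _ => 1) k η ξ|
      ≤ K * (jap (ξ - η) ^ (1 : ℝ) * (jap ξ ^ N * jap η ^ N))) :
    ∃ ℓ : ℝ, HasRePairing φ N (cubic φ ε ζ v) (goodV φ ε ζ v) ℓ ∧
      |ℓ| ≤ (1 / (4 * Real.pi ^ 2)) ^ 2 * ε ^ 2 * ∑ k, (ENNReal.ofReal K * (sNorm N (hat (goodV φ ε ζ v)) *
        (wNorm 1 (hat (gradB φ ε ζ v k)) * sNorm N (hat (goodV φ ε ζ v))))).toReal := by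
  have hφ := h.cutoff
  set V := hat (goodV φ ε ζ v) with hVdef
  set W : Fin 2 → Plane → ℂ := fun k => hat (gradB φ ε ζ v k) with hWdef
  have aV : AEStronglyMeasurable V volume := aesm_hat _
  have aW : ∀ k, AEStronglyMeasurable (W k) volume := fun k => aesm_hat _
  have fV : sNorm N V ≠ ⊤ := memH_iff.1 h.memH_goodV
  have fW : ∀ k, wNorm 1 (W k) ≠ ⊤ := fun k => (h.memH_gradB k).wNorm_ne_top (by linarith [h.five_le])
  have mφ : ∀ n : ℤ, Measurable fun z : Plane => phiLE φ n ‖z‖ := fun n =>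
    (measurable_phiLE hφ n).comp measurable_norm
  have m1 : ∀ (n : ℤ) (k : Fin 2), Measurable fun p : Plane × Plane =>
      cubicKer φ N (fun z => phiLE φ n ‖z‖) k p.1 p.2 := fun n k => measurable_cubicKer hφ N (mφ n) k
  have m2 : ∀ k : Fin 2, Measurable fun p : Plane × Plane => cubicKer φ N (fun _ => 1) k p.1 p.2 :=
    fun k => measurable_cubicKer hφ N measurable_const k
  let A : ℕ → Fin 2 → Plane × Plane → ℂ := fun n k => triInt (fun ξ η =>
    cubicKer φ N (fun z => phiLE φ n ‖z‖) k ξ η - cubicKer φ N (fun z => phiLE φ n ‖z‖) k η ξ) (W k) V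
  let A' : Fin 2 → Plane × Plane → ℂ := fun k => triInt (fun ξ η =>
    cubicKer φ N (fun _ => 1) k ξ η - cubicKer φ N (fun _ => 1) k η ξ) (W k) V
  -- The real part sees only the antisymmetrized kernels, which obey a bound uniform in `n`.
  have hre : ∀ n : ℕ, (inner ℂ (japD N (goodV φ ε ζ v)) (japD N (PLE φ n (cubic φ ε ζ v))) : ℂ).re
      = (1 / (4 * Real.pi ^ 2)) ^ 2 * ε ^ 2 * ∑ k, (∫ p, A n k p ∂(volume.prod volume)).re / 2 := fun n => by
    obtain ⟨C, hC⟩ := exists_cubicKer_trunc_bound hφ h.nonneg n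
    rw [h.inner_trunc_cubic n, Complex.re_ofReal_mul, Complex.re_sum]
    congr 1
    refine Finset.sum_congr rfl fun k _ => ?_
    exact re_integral_triInt (integrable_triInt (m1 n k) (hC k) (aW k) aV (fW k) fV) (h.hatReal_gradB k)
  have hlim : ∀ k, Tendsto (fun n : ℕ => ∫ p, A n k p ∂(volume.prod volume)) atTop
      (𝓝 (∫ p, A' k p ∂(volume.prod volume))) := fun k => by
    have mb : Measurable fun p : Plane × Plane => K * (jap (p.1 - p.2) ^ (1 : ℝ) * (jap p.1 ^ N * jap p.2 ^ N)) := by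
      have e1 : Measurable fun p : Plane × Plane => jap (p.1 - p.2) ^ (1 : ℝ) :=
        (measurable_jap_rpow 1).comp (measurable_fst.sub measurable_snd)
      have e2 : Measurable fun p : Plane × Plane => jap p.1 ^ N := (measurable_jap_rpow N).comp measurable_fst
      have e3 : Measurable fun p : Plane × Plane => jap p.2 ^ N := (measurable_jap_rpow N).comp measurable_snd
      fun_prop
    have hK0 : ∀ ξ η : Plane, 0 ≤ K * (jap (ξ - η) ^ (1 : ℝ) * (jap ξ ^ N * jap η ^ N)) := fun ξ η =>
      (abs_nonneg _).trans (hK2 k ξ η)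
    refine tendsto_integral_of_dominated_convergence
      (fun p => ‖triInt (fun ξ η => K * (jap (ξ - η) ^ (1 : ℝ) * (jap ξ ^ N * jap η ^ N))) (W k) V p‖)
      (fun n => aesm_triInt (measurable_antisymm (m1 n k)) (aW k) aV)
      (integrable_triInt (C := K) (N := N) mb (fun ξ η => by rw [abs_of_nonneg (hK0 ξ η)]) (aW k) aV
        (fW k) fV).norm
      (fun n => ae_of_all _ fun p => ?_) (ae_of_all _ fun p => ?_)
    · simp only [A, triInt, norm_mul, Complex.norm_real, Real.norm_eq_abs]
      gcongr
      exact (hK1 n k p.1 p.2).trans ((le_abs_self _).trans_eq (by simp only [abs_mul]))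
    -- At each fixed pair of frequencies the truncation equals `1` for large `n`, so the kernels are
    -- eventually constant.
    · have hone : ∀ z : Plane, ∀ᶠ n : ℕ in atTop, phiLE φ n ‖z‖ = 1 := fun z => by
        have h2 := (tendsto_pow_atTop_atTop_of_one_lt (one_lt_two (α := ℝ))).eventually_ge_atTop ‖z‖
        filter_upwards [h2] with n hn
        refine phiLE_eq_one hφ (norm_nonneg _) ?_
        rw [zpow_natCast]
        linarith [pow_pos (two_pos (α := ℝ)) n]
      refine tendsto_const_nhds.congr' ?_
      filter_upwards [hone p.1, hone p.2] with n h1 h2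
      simp only [A, A', triInt, cubicKer, h1, h2]
  refine ⟨(1 / (4 * Real.pi ^ 2)) ^ 2 * ε ^ 2 * ∑ k, (∫ p, A' k p ∂(volume.prod volume)).re / 2, ?_, ?_⟩
  · rw [HasRePairing]
    simp only [hre]
    refine Tendsto.const_mul _ (tendsto_finsetSum _ fun k _ => ?_)
    exact ((Complex.continuous_re.tendsto _).comp (hlim k)).div_const 2
  · have hε := h.pos
    rw [abs_mul, abs_of_nonneg (by positivity : 0 ≤ (1 / (4 * Real.pi ^ 2)) ^ 2 * ε ^ 2)]
    refine mul_le_mul_of_nonneg_left ((Finset.abs_sum_le_sum_abs _ _).trans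
      (Finset.sum_le_sum fun k _ => ?_)) (by positivity)
    refine le_trans ?_ (norm_integral_triInt_le (measurable_antisymm (m2 k)) (hK2 k) (aW k) aV (fW k) fV)
    have h1 := Complex.abs_re_le_norm (∫ p, A' k p ∂(volume.prod volume))
    rw [abs_div, abs_two]
    have h2 := abs_nonneg (∫ p, A' k p ∂(volume.prod volume)).re
    exact le_trans (by linarith) h1

end IsProfile

end Cubic

/-! ### Return to the Sobolev norms -/

theorem hNorm_le_hNormVec (s : ℝ) (F : Fin 2 → L2) (k : Fin 2) : hNorm s (F k) ≤ hNormVec s F :=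
  Real.le_sqrt_of_sq_le
    (Finset.single_le_sum (f := fun k => hNorm s (F k) ^ 2) (fun _ _ => sq_nonneg _) (Finset.mem_univ k))

theorem hNormVec_nonneg (s : ℝ) (F : Fin 2 → L2) : 0 ≤ hNormVec s F := Real.sqrt_nonneg _

theorem sum_sNorm_hat_le {s : ℝ} {F : Fin 2 → L2} (hF : ∀ k, MemH s (F k)) :
    ∑ k, sNorm s (hat (F k)) ≤ ENNReal.ofReal (4 * Real.pi * hNormVec s F) := by
  have hp := Real.pi_pos
  have h1 : ∀ k, sNorm s (hat (F k)) ≤ ENNReal.ofReal (2 * Real.pi * hNormVec s F) := fun k => by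
    rw [sNorm_hat (hF k)]
    exact ENNReal.ofReal_le_ofReal (mul_le_mul_of_nonneg_left (hNorm_le_hNormVec s F k) (by positivity))
  rw [Fin.sum_univ_two]
  refine (add_le_add (h1 0) (h1 1)).trans ?_
  have h2 := hNormVec_nonneg s F
  rw [← ENNReal.ofReal_add (by positivity) (by positivity)]
  exact ENNReal.ofReal_le_ofReal (by linarith)

theorem remConst_nonneg (N : ℝ) : 0 ≤ remConst N := by
  have h1 := embC_nonneg
  have h2 := prodC_nonneg N
  rw [remConst]
  positivity

theorem hNorm_le_of_sNorm_le {s A : ℝ} {f : L2} (hA : 0 ≤ A) (h : sNorm s (hat f) ≤ ENNReal.ofReal A) :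
    hNorm s f ≤ (2 * Real.pi)⁻¹ * A := by
  rw [hNorm_eq]
  have := Real.pi_pos
  gcongr
  exact ENNReal.toReal_le_of_le_ofReal hA h

namespace IsProfile

variable {φ : ℝ → ℝ} {ε N : ℝ} {ζ : L2} {v : Fin 2 → L2} (h : IsProfile φ ε N ζ v)
include h

theorem remSize_le : remSize φ ε N ζ v ≤ ENNReal.ofReal (2 * Real.pi * (4 * Real.pi) ^ 2 *
    ((1 + hNorm N ζ) * (hNorm N ζ ^ 2 + hNormVec N v ^ 2 + hNormVec N (goodU φ ε ζ v) ^ 2))) := by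
  have hp := Real.pi_gt_three
  have h0 := hNorm_nonneg N ζ
  have h1 := hNormVec_nonneg N v
  have h2 := hNormVec_nonneg N (goodU φ ε ζ v)
  rw [remSize, sNorm_hat h.mem_zeta]
  refine (mul_le_mul' le_rfl (add_le_add (add_le_add le_rfl (pow_le_pow_left' (sum_sNorm_hat_le h.mem_v) 2))
    (pow_le_pow_left' (sum_sNorm_hat_le h.memH_goodU) 2))).trans ?_
  rw [← ENNReal.ofReal_one, ← ENNReal.ofReal_add zero_le_one (by positivity),
    ← ENNReal.ofReal_pow (by positivity), ← ENNReal.ofReal_pow (by positivity),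
    ← ENNReal.ofReal_pow (by positivity), ← ENNReal.ofReal_add (by positivity) (by positivity),
    ← ENNReal.ofReal_add (by positivity) (by positivity), ← ENNReal.ofReal_mul (by positivity)]
  refine ENNReal.ofReal_le_ofReal ?_
  have e1 : 1 + 2 * Real.pi * hNorm N ζ ≤ 2 * Real.pi * (1 + hNorm N ζ) := by linarith
  have e2 : (2 * Real.pi * hNorm N ζ) ^ 2 + (4 * Real.pi * hNormVec N v) ^ 2
      + (4 * Real.pi * hNormVec N (goodU φ ε ζ v)) ^ 2
      ≤ (4 * Real.pi) ^ 2 * (hNorm N ζ ^ 2 + hNormVec N v ^ 2 + hNormVec N (goodU φ ε ζ v) ^ 2) := by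
    nlinarith [mul_nonneg (sq_nonneg Real.pi) (sq_nonneg (hNorm N ζ))]
  calc _ ≤ (2 * Real.pi * (1 + hNorm N ζ)) * ((4 * Real.pi) ^ 2 *
        (hNorm N ζ ^ 2 + hNormVec N v ^ 2 + hNormVec N (goodU φ ε ζ v) ^ 2)) := by gcongr
    _ = _ := by ring

/-- The remainder lies in `H^N`, with the quadratic bound. -/
theorem remainder_bound {S : ℤˣ → L2} {Q : ℤˣ → ℤˣ → L2}
    (hS : ∀ μ, IsBilinear (sSym φ ε μ) (pm μ (goodV φ ε ζ v)) (pm 1 (goodV φ ε ζ v)) (S μ))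
    (hQ : ∀ μ ν, IsBilinear (qSym φ ε μ ν) (pm μ (goodV φ ε ζ v)) (pm ν (goodV φ ε ζ v)) (Q μ ν)) :
    MemH N (h.dV - (Complex.I • Lam ε (goodV φ ε ζ v) + ∑ μ, S μ + ∑ μ, ∑ ν, Q μ ν + cubic φ ε ζ v)) ∧
    hNorm N (h.dV - (Complex.I • Lam ε (goodV φ ε ζ v) + ∑ μ, S μ + ∑ μ, ∑ ν, Q μ ν + cubic φ ε ζ v))
      ≤ remConst N * (4 * Real.pi) ^ 2 * (ε * (1 + hNorm N ζ) *
        (hNorm N ζ ^ 2 + hNormVec N v ^ 2 + hNormVec N (goodU φ ε ζ v) ^ 2)) := by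
  have hp := Real.pi_pos
  have hε := h.pos
  have hr := remConst_nonneg N
  have h0 := hNorm_nonneg N ζ
  have hb := h.sNorm_remainder_le.le
  rw [← sNorm_congr (h.hat_remainder hS hQ)] at hb
  have hb' := hb.trans (mul_le_mul' le_rfl h.remSize_le)
  rw [← ENNReal.ofReal_mul (by positivity)] at hb'
  refine ⟨memH_iff.2 (ne_top_of_le_ne_top ENNReal.ofReal_ne_top hb'), ?_⟩
  refine (hNorm_le_of_sNorm_le (by positivity) hb').trans_eq ?_
  field_simp

/-- The pairing with the cubic term exists and is bounded. -/
theorem exists_rePairing_cubic {K : ℝ} (hK0 : 0 ≤ K)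
    (hK1 : ∀ (n : ℤ) (k : Fin 2) (ξ η : Plane), |cubicKer φ N (fun z => phiLE φ n ‖z‖) k ξ η
      - cubicKer φ N (fun z => phiLE φ n ‖z‖) k η ξ| ≤ K * (jap (ξ - η) ^ (1 : ℝ) * (jap ξ ^ N * jap η ^ N)))
    (hK2 : ∀ (k : Fin 2) (ξ η : Plane), |cubicKer φ N (fun _ => 1) k ξ η - cubicKer φ N (fun _ => 1) k η ξ|
      ≤ K * (jap (ξ - η) ^ (1 : ℝ) * (jap ξ ^ N * jap η ^ N))) :
    ∃ ℓ : ℝ, HasRePairing φ N (cubic φ ε ζ v) (goodV φ ε ζ v) ℓ ∧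
      |ℓ| ≤ 4 * (K * (embC * (‖(1 / 2 * convC : ℂ)‖ * (2 ^ N * 2) * embC))) *
        (ε ^ 2 * hNorm N ζ * hNormVec N v * hNorm N (goodV φ ε ζ v) ^ 2) := by
  obtain ⟨ℓ, h1, h2⟩ := h.hasRePairing_cubic hK1 hK2
  refine ⟨ℓ, h1, h2.trans ?_⟩
  have hp := Real.pi_pos
  have hε := h.pos
  have hc := embC_nonneg
  have e0 := hNorm_nonneg N ζ
  have e1 := hNorm_nonneg N (goodV φ ε ζ v)
  have e2 := hNormVec_nonneg N v
  set c := embC * (‖(1 / 2 * convC : ℂ)‖ * (2 ^ N * 2) * embC) with hcdef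
  have hc0 : 0 ≤ c := by positivity
  set a := 2 * Real.pi * hNorm N (goodV φ ε ζ v) with ha
  set b := c * ((2 * Real.pi * hNorm N ζ) * (4 * Real.pi * hNormVec N v)) with hb
  have hk : ∀ k, (ENNReal.ofReal K * (sNorm N (hat (goodV φ ε ζ v)) *
      (wNorm 1 (hat (gradB φ ε ζ v k)) * sNorm N (hat (goodV φ ε ζ v))))).toReal ≤ K * (a * (b * a)) := fun k => by
    have hw : wNorm 1 (hat (gradB φ ε ζ v k)) ≤ ENNReal.ofReal b := by
      refine (h.wNorm_gradB_le k).trans ((mul_le_mul' le_rfl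
        (mul_le_mul' (sNorm_hat h.mem_zeta).le (sum_sNorm_hat_le h.mem_v))).trans_eq ?_)
      rw [hb, ENNReal.ofReal_mul hc0, ENNReal.ofReal_mul (p := 2 * Real.pi * hNorm N ζ) (by positivity)]
    refine ENNReal.toReal_le_of_le_ofReal (by positivity) ?_
    rw [sNorm_hat h.memH_goodV, ENNReal.ofReal_mul hK0, ENNReal.ofReal_mul (p := a) (by positivity),
      ENNReal.ofReal_mul (p := b) (by positivity)]
    gcongr
  refine (mul_le_mul_of_nonneg_left (Finset.sum_le_sum fun k _ => hk k) (by positivity)).trans_eq ?_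
  rw [Fin.sum_univ_two, ha, hb]
  field_simp
  ring

end IsProfile

end Bsq

/-! ### The proposition -/

theorem proposition3p1 (φ : ℝ → ℝ) (hφ : Bsq.IsCutoff φ) (N : ℝ) (hN : 5 ≤ N) :
    ∃ K : ℝ, 0 < K ∧ ∀ ε : ℝ, 0 < ε → ε ≤ 1 →
      -- the symbols of the quadratic terms
      (∀ (μ : ℤˣ) (ξ η : Bsq.Plane),
        (starRingEnd ℂ) (Bsq.sSym φ ε μ ξ η) = -Bsq.sSym φ ε μ ξ η ∧
        ‖((Bsq.jap ξ ^ (-N) * Bsq.jap η ^ (-N) : ℝ) : ℂ) *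
            (((Bsq.jap ξ ^ (2 * N) : ℝ) : ℂ) * Bsq.sSym φ ε μ ξ η
              - ((Bsq.jap η ^ (2 * N) : ℝ) : ℂ) * Bsq.sSym φ ε (-μ) η ξ)‖
          ≤ K * (ε * ‖ξ - η‖ * Bsq.phiLE φ (-6) (‖ξ - η‖ / max ‖ξ‖ ‖η‖)) ∧
        ‖Bsq.qSym φ ε μ (-1) ξ η‖
          ≤ K * (ε * ‖ξ‖ * Bsq.phiLE φ 5 (Real.sqrt ε * ‖η‖)
              * Bsq.phiLE φ (-6) (‖ξ - η‖ / ‖η‖)) ∧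
        ‖Bsq.qSym φ ε μ 1 ξ η‖
          ≤ K * (ε * ‖ξ - η‖ * Bsq.phiLE φ 5 (Real.sqrt ε * ‖η‖)
              * Bsq.phiLE φ (-6) (‖ξ - η‖ / ‖η‖))) ∧
      -- the evolution equation of `V` and the bounds of the cubic term and of the remainder
      ∀ (T : ℝ) (ζ : ℝ → Bsq.L2) (v : ℝ → Fin 2 → Bsq.L2), 0 < T →
        Bsq.IsSolution ε N T ζ v →
        ∀ t ∈ Set.Icc 0 T,
          -- all the objects are well defined
          (∀ k, Summable (Bsq.paraTerm φ (ζ t) (Bsq.highInv φ ε (v t) k))) ∧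
          (∀ k, Summable (Bsq.paraTerm φ (Bsq.gradB φ ε (ζ t) (v t) k)
            (Bsq.goodV φ ε (ζ t) (v t)))) ∧
          (∀ k, Bsq.MemH N (Bsq.goodU φ ε (ζ t) (v t) k)) ∧
          Bsq.MemH N (Bsq.goodV φ ε (ζ t) (v t)) ∧
          (∀ k, Bsq.MemH N (Bsq.para φ (Bsq.gradB φ ε (ζ t) (v t) k)
            (Bsq.goodV φ ε (ζ t) (v t)))) ∧
          ∃ (S : ℤˣ → Bsq.L2) (Q : ℤˣ → ℤˣ → Bsq.L2) (R : Bsq.L2),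
            (∀ μ, Bsq.IsBilinear (Bsq.sSym φ ε μ) (Bsq.pm μ (Bsq.goodV φ ε (ζ t) (v t)))
              (Bsq.pm 1 (Bsq.goodV φ ε (ζ t) (v t))) (S μ)) ∧
            (∀ μ ν, Bsq.IsBilinear (Bsq.qSym φ ε μ ν) (Bsq.pm μ (Bsq.goodV φ ε (ζ t) (v t)))
              (Bsq.pm ν (Bsq.goodV φ ε (ζ t) (v t))) (Q μ ν)) ∧
            HasDerivWithinAt (fun τ => Bsq.goodV φ ε (ζ τ) (v τ))
              (Complex.I • Bsq.Lam ε (Bsq.goodV φ ε (ζ t) (v t))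
                + ∑ μ, S μ + ∑ μ, ∑ ν, Q μ ν + Bsq.cubic φ ε (ζ t) (v t) + R)
              (Set.Icc 0 T) t ∧
            (∃ ℓ : ℝ,
              Bsq.HasRePairing φ N (Bsq.cubic φ ε (ζ t) (v t))
                (Bsq.goodV φ ε (ζ t) (v t)) ℓ ∧
              |ℓ| ≤ K * (ε ^ 2 * Bsq.hNorm N (ζ t) * Bsq.hNormVec N (v t)
                * Bsq.hNorm N (Bsq.goodV φ ε (ζ t) (v t)) ^ 2)) ∧
            Bsq.MemH N R ∧
            Bsq.hNorm N R ≤ K * (ε * (1 + Bsq.hNorm N (ζ t)) *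
              (Bsq.hNorm N (ζ t) ^ 2 + Bsq.hNormVec N (v t) ^ 2
                + Bsq.hNormVec N (Bsq.goodU φ ε (ζ t) (v t)) ^ 2)) := by
  obtain ⟨K₁, hK₁, hs⟩ := Bsq.exists_sSym_bound hφ (show 1 / 2 ≤ N by linarith)
  obtain ⟨K₂, hK₂, hc, hc'⟩ := Bsq.exists_cubicKer_bound hφ (show 1 / 2 ≤ N by linarith)
  set K₃ := 4 * (K₂ * (Bsq.embC * (‖(1 / 2 * Bsq.convC : ℂ)‖ * (2 ^ N * 2) * Bsq.embC)))
  set K₄ := Bsq.remConst N * (4 * Real.pi) ^ 2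
  have hK₃ : 0 ≤ K₃ := by
    have := Bsq.embC_nonneg
    positivity
  have hK₄ : 0 ≤ K₄ := mul_nonneg (Bsq.remConst_nonneg N) (sq_nonneg _)
  -- The summand `1` makes the constant positive and covers the two bounds of `q^ε`, which hold with
  -- constant `1`.
  refine ⟨K₁ + K₃ + K₄ + 1, by positivity, fun ε hε hε1 => ⟨fun μ ξ η => ⟨Bsq.conj_sSym φ ε μ ξ η, ?_, ?_, ?_⟩,
    fun T ζ v _ hsol t ht => ?_⟩⟩
  · refine (hs ε hε μ ξ η).trans (mul_le_mul_of_nonneg_right (by linarith) ?_)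
    have := Bsq.phiLE_nonneg hφ (-6) (‖ξ - η‖ / max ‖ξ‖ ‖η‖)
    positivity
  · have h1 := Bsq.phiLE_nonneg hφ 5 (Real.sqrt ε * ‖η‖)
    have h2 := Bsq.phiLE_nonneg hφ (-6) (‖ξ - η‖ / ‖η‖)
    exact (Bsq.qSym_bound hφ hε μ (-1) ξ η).trans
      (le_mul_of_one_le_left (by positivity) (by linarith))
  · have h1 := Bsq.phiLE_nonneg hφ 5 (Real.sqrt ε * ‖η‖)
    have h2 := Bsq.phiLE_nonneg hφ (-6) (‖ξ - η‖ / ‖η‖)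
    exact (Bsq.qSym_one_bound hφ hε μ ξ η).trans
      (le_mul_of_one_le_left (by positivity) (by linarith))
  · have h := hsol.isProfile hφ hε hε1 hN ht
    have hV1 : ∀ μ, Bsq.MemH 1 (Bsq.pm μ (Bsq.goodV φ ε (ζ t) (v t))) := fun μ =>
      (h.memH_pm_goodV μ).mono (by linarith)
    choose S hS using fun μ => Bsq.exists_isBilinear (Bsq.measurable_sSym hφ ε μ)
      (Bsq.sSym_bound hφ hε hε1 μ) (h.int_pm_goodV μ) (hV1 1)
    choose Q hQ using fun μ ν => Bsq.exists_isBilinear (Bsq.measurable_qSym hφ ε μ ν)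
      (Bsq.qSym_bound_zero hφ hε hε1 μ ν) (h.int_pm_goodV μ) (hV1 ν)
    obtain ⟨hR, hR'⟩ := h.remainder_bound hS hQ
    obtain ⟨ℓ, hℓ, hℓ'⟩ := h.exists_rePairing_cubic hK₂ hc hc'
    have e0 := Bsq.hNorm_nonneg N (ζ t)
    have e1 := Bsq.hNormVec_nonneg N (v t)
    refine ⟨fun k => Bsq.summable_paraTerm hφ h.int_zeta _,
      fun k => Bsq.summable_paraTerm hφ (h.int_gradB k) _, h.memH_goodU, h.memH_goodV, h.memH_para_gradB,
      S, Q, _, hS, hQ, ?_, ⟨ℓ, hℓ, hℓ'.trans (mul_le_mul_of_nonneg_right (by linarith) (by positivity))⟩,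
      hR, hR'.trans (mul_le_mul_of_nonneg_right (by linarith) (by positivity))⟩
    -- The remainder is the difference between the derivative of `V` and the listed terms, so the
    -- equation holds by construction; the content lies in the bounds.
    rw [add_sub_cancel]
    exact Bsq.hasDerivWithinAt_goodV hφ hε hε1 hN hsol ht
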